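/- **Setting.** Fix an integer $k\ge 1$, a real $\alpha\in[0,1)$ and $q\in(0,1/2)$. The ring lattice $R_{n,k}$ has vertices $0,\dots,n-1$, and $i$ is joined to $i+1,\dots,i+k$ modulo $n$. The Newman–Watts graph $H_{n,k,\alpha}$ is obtained from $R_{n,k}$ by replacing every non-edge, independently, by an edge with probability $\alpha/n$. Given a graph $G=(V,E)$ with $|V|=n$, an unknown labelling $Y\in\{\pm1\}^V$ and $0<p<q$, one observes $G$, edge measurements $X\in\{\pm1\}^E$ and vertex measurements $Z\in\{\pm1\}^V$. All measurements are independent; $X_{uv}=-Y_uY_v$ with probability $p$ and $X_{uv}=Y_uY_v$ otherwise; $Z_v=-Y_v$ with probability $q$ and $Z_v=Y_v$ otherwise. The error of $\widehat Y\in\{\pm1\}^V$ is the Hamming error $|\{v:\widehat Y_v\ne Y_v\}|$. **Decoder with budget $L\in\mathbb N$.** Discard all edges outside $R_{n,k}$. For $i=0,\dots,\lceil n/(k+1)\rceil-1$ let $W_i$ be the closed neighbourhood of the vertex $i(k+1)$ in $R_{n,k}$, and let $W_i^\star$ be $W_i$ together with all its neighbours. Choose $\widehat Y^{i}\in\{\pm1\}^{W_i^\star}$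 that minimizes the number of edges $uv$ of $R_{n,k}$ inside $W_i^\star$ with $\widehat Y^i_u\widehat Y^i_v\neq X_{uv}$. For consecutive $i,i+1$ choose $v\in W_i\cap W_{i+1}$ and put $S_i=\widehat Y^i_v\widehat Y^{i+1}_v$. Choose signs $s_i$ that minimize $\sum_i|\{v\in W_i: s_i\widehat Y^i_v\ne Z_v\}|$ subject to $|\{i: s_i\ne s_{i+1}S_i\}|\le L$. Output $\widehat Y_v=s_i\widehat Y^i_v$ for an arbitrary $i$ with $v\in W_i$. All ties and choices are arbitrary; "every output" means every way of resolving them, even depending on $X$ and $Z$. **Running time** is the number of unit-cost instructions of one fixed word-RAM program, which may depend on the fixed parameters $k,\alpha,q$ but not on $n$, $p$, $L$ or the input. It has words of $O(\log(n+L))$ bits; $n$ and $L$ are given in registers, and the measurements are given as a read-only random-access $n\times n$ matrix for $X$ (with a special value at non-edges) and a read-only array for $Z$. The time bounds hold for every graph $G\supseteq R_{n,k}$ on the same vertex set and all inputs $X,Z$, and the program computes an output of the decoder. **Theorem.** For $H_{n,k,\alpha}$ the optimal Hamming rate is $\widetilde\Theta(p^kn)$, where $\widetilde\Theta$ hides powers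 of $\log n$, and it is achieved by the decoder. Precisely: 1. *(Lower bound.)* There is $c>0$, depending only on $k,\alpha,q$, such that with probability $1-o(1)$ over $G\sim H_{n,k,\alpha}$: for every $p\in(0,q)$ and every (possibly randomized) estimator $\widehat Y$ on $G$ there is $Y$ with $\mathbb E\,|\{v:\widehat Y_v\ne Y_v\}|\ge c\,p^kn$. There are constants $A,C>0$ and $n_0$, depending only on $k,\alpha,q$, such that: 2. *(Decoder with failure probability $\delta$.)* For all $n\ge n_0$, $p\in(0,q)$, $\delta\in(0,1)$ and $G\supseteq R_{n,k}$ (in particular for every sample $G$ of $H_{n,k,\alpha}$), the decoder with budget $L=\lfloor A(p^kn+\log(2/\delta))\rfloor$ satisfies, for every $Y$ and with probability at least $1-\delta$ over $X,Z$, that every output has error at most $C\,(p^kn+\log(2/\delta))\log n$. It runs in time at most $C(\lceil p^kn\rceil+\log(2/\delta))\,n$, i.e. $O(\lceil p^kn\rceil n)$ for fixed $\delta$. 3. *(High probability.)* For every sequence $p_n\in(0,q)$ (in particular when $np_n\to\infty$) there are budgets $L_n$ such that, for all ground truths $Y_n$, with probability $1-o(1)$ over $G\sim H_{n,k,\alpha}$,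 $X$ and $Z$, every output of the decoder with budget $L_n$ has error at most $C\,p_n^kn\,(\log n)^3$. For all large $n$ it runs in time at most $C\lceil p_n^kn\rceil n\log n$, and in time at most $C\lceil p_n^kn\rceil n$ if $p_n^kn\to\infty$ or $p_n^kn\to0$. -/

import Mathlib

open Filter Topology

noncomputable section

namespace NewmanWatts

/-! ## Graphs -/

/-- The regular ring lattice on `n` vertices (labelled `0, …, n-1`): `i` is joined to
`i+1, …, i+k` modulo `n`. -/
def ringLattice (n k : ℕ) : SimpleGraph (Fin n) :=
  SimpleGraph.fromRel fun i j => ∃ d : ℕ, 1 ≤ d ∧ d ≤ k ∧ (i.val + d) % n = j.val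

open Classical in
/-- The probability of the graph `G` under the Newman–Watts model: start from the ring lattice and
replace every non-edge, independently, by an edge with probability `α / n`. -/
def graphWeight (n k : ℕ) (α : ℝ) (G : SimpleGraph (Fin n)) : ℝ :=
  if ringLattice n k ≤ G then
    ∏ e ∈ (ringLattice n k)ᶜ.edgeFinset, (if e ∈ G.edgeSet then α / n else 1 - α / n)
  else 0

open Classical in
/-- The probability that a Newman–Watts graph has the property `A`. -/
def graphProb (n k : ℕ) (α : ℝ) (A : SimpleGraph (Fin n) → Prop) : ℝ :=
  ∑ G : SimpleGraph (Fin n), if A G then graphWeight n k α G else 0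

/-! ## Noisy observations of a labelling with values in `{+1, -1} = ℤˣ` -/

/-- The product `y u * y v` of the labels at the ends of the pair `e = {u, v}`. -/
def edgeSign {V : Type} (y : V → ℤˣ) (e : Sym2 V) : ℤˣ := Sym2.mul (e.map y)

open Classical in
/-- The probability of the edge measurements `X` and the vertex measurements `Z` when the ground
truth is `Y`: all measurements are independent, an edge measurement is flipped with probability
`p` and a vertex measurement with probability `q`. -/
def obsWeight {V : Type} [Fintype V] (G : SimpleGraph V) (Y : V → ℤˣ) (p q : ℝ)
    (X : G.edgeSet → ℤˣ) (Z : V → ℤˣ) : ℝ :=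
  (∏ e : G.edgeSet, if X e = edgeSign Y e.1 then 1 - p else p) *
    ∏ v : V, if Z v = Y v then 1 - q else q

open Classical in
/-- The probability of an event that depends on the measurements. -/
def obsProb {V : Type} [Fintype V] (G : SimpleGraph V) (Y : V → ℤˣ) (p q : ℝ)
    (A : (G.edgeSet → ℤˣ) → (V → ℤˣ) → Prop) : ℝ :=
  ∑ X : G.edgeSet → ℤˣ, ∑ Z : V → ℤˣ, if A X Z then obsWeight G Y p q X Z else 0

/-- The probability of an event when a Newman–Watts graph is drawn first and then the
measurements on this graph. -/
def modelProb (n k : ℕ) (α p q : ℝ) (Y : Fin n → ℤˣ)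
    (A : (G : SimpleGraph (Fin n)) → (G.edgeSet → ℤˣ) → (Fin n → ℤˣ) → Prop) : ℝ :=
  ∑ G : SimpleGraph (Fin n), graphWeight n k α G * obsProb G Y p q (A G)

/-- A (possibly randomized) estimator of the ground truth on the known graph `G`. -/
abbrev Estimator {V : Type} (G : SimpleGraph V) : Type :=
  (G.edgeSet → ℤˣ) → (V → ℤˣ) → PMF (V → ℤˣ)

open Classical in
/-- The expected Hamming error of an estimator when the ground truth is `Y`. -/
def expectedError {V : Type} [Fintype V] (G : SimpleGraph V) (Y : V → ℤˣ) (p q : ℝ)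
    (est : Estimator G) : ℝ :=
  ∑ X : G.edgeSet → ℤˣ, ∑ Z : V → ℤˣ,
    obsWeight G Y p q X Z * ∑ y : V → ℤˣ, (est X Z y).toReal * (hammingDist y Y : ℝ)

/-! ## The tree decomposition decoder -/

/-- The data of a decomposition of the vertex set `V` into components indexed by `ι`: the
components `W`, the extended components `W⋆`, and the tree on the components. -/
structure Decomposition (V ι : Type) where
  bag : ι → Finset V
  star : ι → Finset V
  tree : SimpleGraph ι

section Decoder

variable {V ι : Type} [Fintype V] [Fintype ι]

open Classical in
/-- The number of edges of `H` inside `A` on which the labelling `y` disagrees with `X`. -/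
def disagreement (H : SimpleGraph V) (X : H.edgeSet → ℤˣ) (A : Finset V) (y : V → ℤˣ) : ℕ :=
  (Finset.univ.filter fun e : H.edgeSet =>
    (∀ v ∈ e.1, v ∈ A) ∧ edgeSign y e.1 ≠ X e).card

/-- `y` is a maximum likelihood labelling of `A` for the edge measurements. Only the values of `y`
on `A` matter. -/
def IsLocalEstimator (H : SimpleGraph V) (X : H.edgeSet → ℤˣ) (A : Finset V) (y : V → ℤˣ) :
    Prop :=
  ∀ y' : V → ℤˣ, disagreement H X A y ≤ disagreement H X A y'

open Classical in
/-- The number of tree edges `{i, j}` that are violated by the signs `s`, i.e. with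
`s i ≠ s j * S {i, j}`. -/
def violations (T : SimpleGraph ι) (S : Sym2 ι → ℤˣ) (s : ι → ℤˣ) : ℕ :=
  (T.edgeFinset.filter fun e => edgeSign s e ≠ S e).card

/-- `s` solves the constrained problem on the tree `T`: it has minimal total cost among the sign
patterns with at most `L` violated edges. -/
def IsTreeDecoding (T : SimpleGraph ι) (cost : ι → ℤˣ → ℕ) (S : Sym2 ι → ℤˣ) (L : ℕ)
    (s : ι → ℤˣ) : Prop :=
  violations T S s ≤ L ∧
    ∀ s' : ι → ℤˣ, violations T S s' ≤ L → ∑ i, cost i (s i) ≤ ∑ i, cost i (s' i)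

open Classical in
/-- The number of vertices of the component `W` at which `x` times the labelling `y` disagrees
with the vertex measurements. -/
def bagCost (W : Finset V) (Z : V → ℤˣ) (y : V → ℤˣ) (x : ℤˣ) : ℕ :=
  (W.filter fun v => x * y v ≠ Z v).card

/-- `out` is a possible output of the tree decomposition decoder with probed graph `H`,
decomposition `D` and budget `L`; all ties and all arbitrary choices of the algorithm may be
resolved in any way. Here `loc i` is the local estimator of the component `i`, `S` the signs of
the tree edges, `s` the solution of the constrained problem on the tree, and `c v` the component
that is used to label the vertex `v`. -/
def IsDecoderOutput (H : SimpleGraph V) (D : Decomposition V ι) (L : ℕ)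
    (X : H.edgeSet → ℤˣ) (Z : V → ℤˣ) (out : V → ℤˣ) : Prop :=
  ∃ (loc : ι → V → ℤˣ) (S : Sym2 ι → ℤˣ) (s : ι → ℤˣ) (c : V → ι),
    (∀ i, IsLocalEstimator H X (D.star i) (loc i)) ∧
    (∀ i j, D.tree.Adj i j →
      ∃ v, v ∈ D.bag i ∧ v ∈ D.bag j ∧ S s(i, j) = loc i v * loc j v) ∧
    IsTreeDecoding D.tree (fun i x => bagCost (D.bag i) Z (loc i) x) S L s ∧
    ∀ v, v ∈ D.bag (c v) ∧ out v = s (c v) * loc (c v) v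

end Decoder

/-! ## The decomposition of the ring lattice -/

/-- The number `⌈n / (k+1)⌉` of components. -/
def numBags (n k : ℕ) : ℕ := (n + k) / (k + 1)

open Classical in
/-- The closed neighbourhood of the vertex number `i * (k + 1)` in the ring lattice. -/
def ringBag (n k : ℕ) (i : Fin (numBags n k)) : Finset (Fin n) :=
  Finset.univ.filter fun v =>
    ∃ c : Fin n, c.val = i.val * (k + 1) ∧ (v = c ∨ (ringLattice n k).Adj c v)

open Classical in
/-- The decomposition of the ring lattice: the components are the closed neighbourhoods of the
vertices `0, k+1, 2(k+1), …`, consecutive components are joined, so that the tree is a path, and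
an extended component consists of the component and all its neighbours. -/
def ringDecomposition (n k : ℕ) : Decomposition (Fin n) (Fin (numBags n k)) where
  bag := ringBag n k
  star i := ringBag n k i ∪
    Finset.univ.filter fun v => ∃ u ∈ ringBag n k i, (ringLattice n k).Adj u v
  tree := SimpleGraph.pathGraph (numBags n k)

open Classical in
/-- Forget the measurements on the edges of `G` that do not belong to `H` (used for `H ≤ G`). -/
def discard {V : Type} (H G : SimpleGraph V) (X : G.edgeSet → ℤˣ) : H.edgeSet → ℤˣ :=
  fun e => if h : e.1 ∈ G.edgeSet then X ⟨e.1, h⟩ else 1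

/-- `out` is a possible output of the decoder that discards the added edges and then runs the tree
decomposition decoder on the ring lattice with budget `L`. -/
def IsRingDecoderOutput (n k L : ℕ) (G : SimpleGraph (Fin n)) (X : G.edgeSet → ℤˣ)
    (Z : Fin n → ℤˣ) (out : Fin n → ℤˣ) : Prop :=
  IsDecoderOutput (ringLattice n k) (ringDecomposition n k) L (discard (ringLattice n k) G X) Z out

/-- The budget of that decoder for the failure parameter `δ`: a constant multiple of
`p ^ k * n + log (2 / δ)`, rounded down (violated edges are counted by an integer). -/
def ringBudget (n k : ℕ) (A p δ : ℝ) : ℕ := ⌊A * (p ^ k * n + Real.log (2 / δ))⌋₊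

/-! ## A word RAM with unit-cost instructions -/

/-- The arithmetic operations of the machine on words (subtraction is truncated, comparisons
return `0` or `1`). -/
inductive Op
  | add | sub | mul | div | mod | lt | eq

/-- The value of an operation. -/
def Op.eval : Op → ℕ → ℕ → ℕ
  | .add, a, b => a + b
  | .sub, a, b => a - b
  | .mul, a, b => a * b
  | .div, a, b => a / b
  | .mod, a, b => a % b
  | .lt, a, b => if a < b then 1 else 0
  | .eq, a, b => if a = b then 1 else 0

/-- Programs. Registers are named by fixed numbers; the memory is addressed indirectly through
registers.
* `const d c`: register `d` gets the constant `c`;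
* `op o d a b`: register `d` gets the value of `o` on registers `a` and `b`;
* `load d a`: register `d` gets the memory cell whose address is in register `a`;
* `store a b`: the memory cell whose address is in register `a` gets register `b`;
* `readX d a b`: register `d` gets the entry of the matrix of edge measurements at the pair
  (register `a`, register `b`);
* `readZ d a`: register `d` gets the vertex measurement at register `a`;
* `seq`, `ite a` and `loop a`: composition, branching on and looping while register `a` is
  non-zero. -/
inductive Program
  | skip
  | const (d c : ℕ)
  | op (o : Op) (d a b : ℕ)
  | load (d a : ℕ)
  | store (a b : ℕ)
  | readX (d a b : ℕ)
  | readZ (d a : ℕ)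
  | seq (P Q : Program)
  | ite (a : ℕ) (P Q : Program)
  | loop (a : ℕ) (P : Program)

/-- The registers and the memory. -/
structure State where
  reg : ℕ → ℕ
  mem : ℕ → ℕ

/-- Write a register. -/
def State.setReg (σ : State) (d x : ℕ) : State := ⟨Function.update σ.reg d x, σ.mem⟩

/-- Write a memory cell. -/
def State.setMem (σ : State) (a x : ℕ) : State := ⟨σ.reg, Function.update σ.mem a x⟩

/-- `Exec inX inZ B P σ τ t`: with the read-only inputs `inX` and `inZ`, the program `P` started in
`σ` halts in `τ` after `t` steps, and never writes a number larger than `B` (the bound on the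
words of the machine). -/
inductive Exec (inX : ℕ → ℕ → ℕ) (inZ : ℕ → ℕ) (B : ℕ) : Program → State → State → ℕ → Prop
  | skip (σ : State) : Exec inX inZ B .skip σ σ 1
  | const (σ : State) (d c : ℕ) (h : c ≤ B) :
      Exec inX inZ B (.const d c) σ (σ.setReg d c) 1
  | op (σ : State) (o : Op) (d a b : ℕ) (h : o.eval (σ.reg a) (σ.reg b) ≤ B) :
      Exec inX inZ B (.op o d a b) σ (σ.setReg d (o.eval (σ.reg a) (σ.reg b))) 1
  | load (σ : State) (d a : ℕ) :
      Exec inX inZ B (.load d a) σ (σ.setReg d (σ.mem (σ.reg a))) 1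
  | store (σ : State) (a b : ℕ) :
      Exec inX inZ B (.store a b) σ (σ.setMem (σ.reg a) (σ.reg b)) 1
  | readX (σ : State) (d a b : ℕ) (h : inX (σ.reg a) (σ.reg b) ≤ B) :
      Exec inX inZ B (.readX d a b) σ (σ.setReg d (inX (σ.reg a) (σ.reg b))) 1
  | readZ (σ : State) (d a : ℕ) (h : inZ (σ.reg a) ≤ B) :
      Exec inX inZ B (.readZ d a) σ (σ.setReg d (inZ (σ.reg a))) 1
  | seq {P Q : Program} {σ τ ρ : State} {t u : ℕ} (h₁ : Exec inX inZ B P σ τ t)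
      (h₂ : Exec inX inZ B Q τ ρ u) : Exec inX inZ B (.seq P Q) σ ρ (t + u)
  | iteTrue {a : ℕ} {P Q : Program} {σ τ : State} {t : ℕ} (h : σ.reg a ≠ 0)
      (h₁ : Exec inX inZ B P σ τ t) : Exec inX inZ B (.ite a P Q) σ τ (t + 1)
  | iteFalse {a : ℕ} {P Q : Program} {σ τ : State} {t : ℕ} (h : σ.reg a = 0)
      (h₁ : Exec inX inZ B Q σ τ t) : Exec inX inZ B (.ite a P Q) σ τ (t + 1)
  | loopStop {a : ℕ} {P : Program} {σ : State} (h : σ.reg a = 0) :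
      Exec inX inZ B (.loop a P) σ σ 1
  | loopStep {a : ℕ} {P : Program} {σ τ ρ : State} {t u : ℕ} (h : σ.reg a ≠ 0)
      (h₁ : Exec inX inZ B P σ τ t) (h₂ : Exec inX inZ B (.loop a P) τ ρ u) :
      Exec inX inZ B (.loop a P) σ ρ (t + u + 1)

/-- The word that encodes a sign: `+1` is `1` and `-1` is `2`. -/
def signCode (x : ℤˣ) : ℕ := if x = 1 then 1 else 2

open Classical in
/-- The edge measurements as an `n × n` matrix; the entry at a pair that is not an edge of `G` (or
out of range) is `0`. -/
def inputX {n : ℕ} (G : SimpleGraph (Fin n)) (X : G.edgeSet → ℤˣ) (a b : ℕ) : ℕ :=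
  if h : ∃ (ha : a < n) (hb : b < n), s(⟨a, ha⟩, ⟨b, hb⟩) ∈ G.edgeSet then
    signCode (X ⟨s(⟨a, h.choose⟩, ⟨b, h.choose_spec.choose⟩), h.choose_spec.choose_spec⟩)
  else 0

/-- The vertex measurements as an array; entries out of range are `0`. -/
def inputZ {n : ℕ} (Z : Fin n → ℤˣ) (a : ℕ) : ℕ :=
  if h : a < n then signCode (Z ⟨a, h⟩) else 0

/-- The initial state: `n` in register `0`, the budget `L` in register `1`, and `0` elsewhere. -/
def initState (n L : ℕ) : State :=
  ⟨Function.update (Function.update (fun _ => 0) 0 n) 1 L, fun _ => 0⟩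

/-- On the observations `X`, `Z` and the budget `L`, the program halts within `T` steps, using
words of size at most `(n + L + 2) ^ w`, that is, of `O(log (n + L))` bits, and leaves in the memory
cells `0, …, n-1` an output of the decoder that discards the added edges. -/
def DecodesWithin (P : Program) (w n k L : ℕ) (G : SimpleGraph (Fin n)) (X : G.edgeSet → ℤˣ)
    (Z : Fin n → ℤˣ) (T : ℝ) : Prop :=
  ∃ (τ : State) (t : ℕ) (out : Fin n → ℤˣ),
    Exec (inputX G X) (inputZ Z) ((n + L + 2) ^ w) P (initState n L) τ t ∧
    (t : ℝ) ≤ T ∧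
    (∀ v : Fin n, τ.mem v.val = signCode (out v)) ∧
    IsRingDecoderOutput n k L G X Z out

end NewmanWatts

end

/-! Lower bound. Flipping the label of a vertex with at most 2k incident edges changes the law of at
most 2k edge measurements. An observation half-way between the two truths has likelihood of order at
least p^k under both, up to a constant factor for the vertex measurement (`exists_common_part`,
`le_sum_min_obsWeight`). Averaging over all labellings, every estimator errs at such a vertex with
probability of order p^k (`exists_le_expectedError`). The number of added edges is binomial with
mean at most αn/2. As α < 1, a Chernoff bound leaves a constant fraction of the vertices without
added edges (`sum_graphWeight_many_added`, `card_without_added`). This good event depends on G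
alone, so it serves all p and all estimators at once.

Upper bound. A labelling of an extended component that is wrong on the component by more than a
global sign disagrees with the truth on at least 2k-1 edges (`card_cut_ge`). Hence a minimizer is
correct up to sign unless at least k measurements there are flipped (`localEstimator_correct`).
Splitting the components into ten classes with disjoint extended components gives an exponential
moment for the number of bad ones, of order p^k n (`sum_noiseWeight_many_bad`). The true signs
violate only path edges at bad components, hence are feasible. Comparing the optimum with them shows
that the vertex measurements agree unusually little with the truth on the components with the wrong
sign (`decoder_analysis`). For a fixed pattern with w wrong components this has probability
exponentially small in w, up to a factor for the bad ones. Only n^O(L) patterns have O(L) sign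
changes, so w is at most of order L log n (`decoder_error_bound`). For sequences p_n, budget 0
settles the case of small p^k n (`le_obsProb_exact`), where an additive logarithm would be too much.

Running time. The local problems have constant size and are solved by enumeration. The signs come
from a dynamic program over component, budget and sign, and the optimum is traced back while the
output is written. A small expression language compiled to the machine tracks time and word size
(`runs_ringProgram`); `exists_ringDecoderOutput` identifies the computed numbers with a decoder
output. -/

namespace NewmanWatts

/-! ## Product noise on sign vectors -/

/-- Flip one coordinate of a sign vector. -/
def flipAt {ι : Type*} [DecidableEq ι] (e : ι) (x : ι → ℤˣ) : ι → ℤˣ := Function.update x e (-x e)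

theorem flipAt_involutive {ι : Type*} [DecidableEq ι] (e : ι) : Function.Involutive (flipAt e) := by
  intro x
  funext i
  by_cases h : i = e
  · subst h; simp [flipAt]
  · simp [flipAt, Function.update_of_ne h]

section Noise

variable {ι : Type*} [Fintype ι]

/-- The probability of `x` when every sign of `y` is flipped independently with probability `p`. -/
def noiseWeight (y : ι → ℤˣ) (p : ℝ) (x : ι → ℤˣ) : ℝ :=
  ∏ i, if x i = y i then 1 - p else p

theorem sum_prod_signs [DecidableEq ι] (f : ι → ℤˣ → ℝ) :
    ∑ x : ι → ℤˣ, ∏ i, f i (x i) = ∏ i, (f i 1 + f i (-1)) := by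
  have h := (Finset.prod_univ_sum (fun _ : ι => (Finset.univ : Finset ℤˣ)) f).symm
  rw [Fintype.piFinset_univ] at h
  rw [h]
  refine Finset.prod_congr rfl fun i _ => ?_
  rw [UnitsInt.univ, Finset.sum_pair (by decide)]

/-- Independence of the coordinates: all exponential moments of the vertex measurements reduce to
one factor per vertex. -/
theorem sum_noiseWeight_mul_prod [DecidableEq ι] (y : ι → ℤˣ) (p : ℝ) (f : ι → ℤˣ → ℝ) :
    ∑ x : ι → ℤˣ, noiseWeight y p x * ∏ i, f i (x i) =
      ∏ i, ((1 - p) * f i (y i) + p * f i (-y i)) := by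
  simp only [noiseWeight, ← Finset.prod_mul_distrib]
  rw [sum_prod_signs (fun i s => (if s = y i then 1 - p else p) * f i s)]
  refine Finset.prod_congr rfl fun i _ => ?_
  rcases Int.units_eq_one_or (y i) with h | h <;> rw [h]
  · simp [show ¬ ((-1 : ℤˣ) = 1) by decide]
  · simp [show ¬ ((1 : ℤˣ) = -1) by decide]; ring

theorem sum_noiseWeight [DecidableEq ι] (y : ι → ℤˣ) (p : ℝ) : ∑ x : ι → ℤˣ, noiseWeight y p x = 1 := by
  have h := sum_noiseWeight_mul_prod y p (fun _ _ => 1)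
  simpa using h

theorem noiseWeight_nonneg (y : ι → ℤˣ) {p : ℝ} (hp0 : 0 ≤ p) (hp1 : p ≤ 1) (x : ι → ℤˣ) :
    0 ≤ noiseWeight y p x := by
  refine Finset.prod_nonneg fun i _ => ?_
  split_ifs <;> linarith

variable [DecidableEq ι]

theorem neg_eq_iff_ne_sign (a b : ℤˣ) : -a = b ↔ a ≠ b := by
  revert a b; decide

theorem noiseWeight_flipAt (y : ι → ℤˣ) (p : ℝ) (e : ι) (x : ι → ℤˣ) (h : x e ≠ y e) :
    (1 - p) * noiseWeight y p x = p * noiseWeight y p (flipAt e x) := by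
  unfold noiseWeight
  rw [← Finset.mul_prod_erase Finset.univ _ (Finset.mem_univ e),
    ← Finset.mul_prod_erase Finset.univ (fun i => if flipAt e x i = y i then 1 - p else p)
      (Finset.mem_univ e)]
  have h1 : flipAt e x e = y e := by simp [flipAt, neg_eq_iff_ne_sign, h]
  have h2 : ∏ i ∈ Finset.univ.erase e, (if flipAt e x i = y i then 1 - p else p) =
      ∏ i ∈ Finset.univ.erase e, (if x i = y i then 1 - p else p) := by
    refine Finset.prod_congr rfl fun i hi => ?_
    rw [flipAt, Function.update_of_ne (Finset.ne_of_mem_erase hi)]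
  rw [h2, if_neg h, if_pos h1]
  ring

/-- Flipping `e` maps the half where `e` is wrong onto the half where it is right and leaves `g`
unchanged, while the weights are in the ratio p to 1-p. The two halves add up to everything. The
ratio is used in multiplied form, so p = 1 needs no exception. -/
theorem sum_noiseWeight_flip (y : ι → ℤˣ) (p : ℝ) (e : ι) (g : (ι → ℤˣ) → ℝ)
    (hg : ∀ x, g (flipAt e x) = g x) :
    ∑ x, noiseWeight y p x * ((if x e ≠ y e then 1 else 0) * g x) =
      p * ∑ x, noiseWeight y p x * g x := by
  have key : (1 - p) * ∑ x, noiseWeight y p x * ((if x e ≠ y e then 1 else 0) * g x) =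
      p * ∑ x, noiseWeight y p x * ((if x e = y e then 1 else 0) * g x) := by
    rw [Finset.mul_sum, Finset.mul_sum,
      ← Equiv.sum_comp (flipAt_involutive e).toPerm
        (fun x => p * (noiseWeight y p x * ((if x e = y e then 1 else 0) * g x)))]
    refine Finset.sum_congr rfl fun x _ => ?_
    have h1 : flipAt e x e = y e ↔ x e ≠ y e := by simp [flipAt, neg_eq_iff_ne_sign]
    simp only [Function.Involutive.coe_toPerm, h1, hg]
    by_cases h : x e = y e
    · simp [h]
    · simp only [ne_eq, h, not_false_eq_true, if_true, one_mul]
      rw [← mul_assoc, noiseWeight_flipAt y p e x h, mul_assoc]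
  have split : ∑ x, noiseWeight y p x * g x =
      ∑ x, noiseWeight y p x * ((if x e ≠ y e then 1 else 0) * g x) +
      ∑ x, noiseWeight y p x * ((if x e = y e then 1 else 0) * g x) := by
    rw [← Finset.sum_add_distrib]
    refine Finset.sum_congr rfl fun x _ => ?_
    by_cases h : x e = y e <;> simp [h]
  rw [split, mul_add, ← key]
  ring

theorem sum_noiseWeight_flips (y : ι → ℤˣ) (p : ℝ) (T : Finset ι) (g : (ι → ℤˣ) → ℝ)
    (hg : ∀ e ∈ T, ∀ x, g (flipAt e x) = g x) :
    ∑ x, noiseWeight y p x * ((if ∀ e ∈ T, x e ≠ y e then 1 else 0) * g x) =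
      p ^ T.card * ∑ x, noiseWeight y p x * g x := by
  induction T using Finset.induction_on with
  | empty => simp
  | insert e T he ih =>
    rw [Finset.card_insert_of_notMem he, pow_succ', mul_assoc,
      ← ih (fun e' h' => hg e' (Finset.mem_insert_of_mem h')),
      ← sum_noiseWeight_flip y p e]
    · refine Finset.sum_congr rfl fun x _ => ?_
      by_cases h : x e = y e <;> simp [h]
    · intro x
      have h : (∀ e' ∈ T, flipAt e x e' ≠ y e') ↔ ∀ e' ∈ T, x e' ≠ y e' := by
        refine forall₂_congr fun e' h' => ?_
        rw [flipAt, Function.update_of_ne (fun h => he (by rw [← h]; exact h'))]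
      simp only [h, hg e (Finset.mem_insert_self _ _)]

/-- Exponential moment of the number of blocks with at least `k` flips, for disjoint blocks. -/
theorem sum_noiseWeight_two_pow_blocks {κ : Type*} (y : ι → ℤˣ) {p : ℝ}
    (hp0 : 0 ≤ p) (hp1 : p ≤ 1) (k N : ℕ) (E : κ → Finset ι) (I : Finset κ)
    (hE : ∀ i ∈ I, ∀ j ∈ I, i ≠ j → Disjoint (E i) (E j)) (hN : ∀ i ∈ I, (E i).card ≤ N) :
    ∑ x, noiseWeight y p x *
        (2 : ℝ) ^ (I.filter fun i => k ≤ ((E i).filter fun e => x e ≠ y e).card).card ≤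
      (1 + 2 ^ N * p ^ k) ^ I.card := by
  classical
  -- The power is a product over blocks of 1 or 2. A block with at least k flips contains a k-set of
  -- flips, so its factor is at most 1 plus the number of k-sets all of whose elements are flipped.
  have step : ∀ x : ι → ℤˣ,
      (2 : ℝ) ^ (I.filter fun i => k ≤ ((E i).filter fun e => x e ≠ y e).card).card ≤
        ∏ i ∈ I, (1 + ∑ T ∈ (E i).powersetCard k, if ∀ e ∈ T, x e ≠ y e then (1 : ℝ) else 0) := by
    intro x
    rw [Finset.card_filter, ← Finset.prod_pow_eq_pow_sum]
    refine Finset.prod_le_prod (fun _ _ => by positivity) fun i _ => ?_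
    have hnn : ∀ T ∈ (E i).powersetCard k,
        (0 : ℝ) ≤ if ∀ e ∈ T, x e ≠ y e then (1 : ℝ) else 0 := fun T _ => by
      split_ifs <;> norm_num
    split_ifs with h
    · obtain ⟨T, hT, hTk⟩ := Finset.exists_subset_card_eq h
      have h1 := Finset.single_le_sum hnn (Finset.mem_powersetCard.2
        ⟨hT.trans (Finset.filter_subset _ _), hTk⟩)
      rw [if_pos fun e he => (Finset.mem_filter.1 (hT he)).2] at h1
      linarith
    · have := Finset.sum_nonneg hnn
      simp only [pow_zero]
      linarith
  have main : ∀ J : Finset κ, J ⊆ I → ∑ x, noiseWeight y p x *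
      ∏ i ∈ J, (1 + ∑ T ∈ (E i).powersetCard k, if ∀ e ∈ T, x e ≠ y e then (1 : ℝ) else 0) ≤
        (1 + 2 ^ N * p ^ k) ^ J.card := by
    intro J
    induction J using Finset.induction_on with
    | empty => intro _; simp [sum_noiseWeight]
    | insert i J hi ih =>
      intro hJ
      have hiI := hJ (Finset.mem_insert_self i J)
      have hJI : J ⊆ I := (Finset.subset_insert i J).trans hJ
      have ih := ih hJI
      rw [Finset.card_insert_of_notMem hi, pow_succ']
      simp only [Finset.prod_insert hi]
      set g : (ι → ℤˣ) → ℝ := fun x => ∏ i ∈ J,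
        (1 + ∑ T ∈ (E i).powersetCard k, if ∀ e ∈ T, x e ≠ y e then (1 : ℝ) else 0) with hgdef
      -- Disjointness enters here: the factors of the other blocks do not see the coordinates of
      -- block `i`, which can therefore be integrated out first.
      have hg : ∀ e ∈ E i, ∀ x, g (flipAt e x) = g x := by
        intro e he x
        simp only [hgdef]
        refine Finset.prod_congr rfl fun j hj => ?_
        congr 1
        refine Finset.sum_congr rfl fun T hT => ?_
        have h : (∀ e' ∈ T, flipAt e x e' ≠ y e') ↔ ∀ e' ∈ T, x e' ≠ y e' := by
          refine forall₂_congr fun e' h' => ?_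
          have hd := hE i hiI j (hJI hj) (fun h => hi (h ▸ hj))
          have h3 := (Finset.mem_powersetCard.1 hT).1 h'
          rw [flipAt, Function.update_of_ne]
          rintro rfl
          exact Finset.disjoint_left.1 hd he h3
        simp only [h]
      have expand : ∑ x, noiseWeight y p x * ((1 + ∑ T ∈ (E i).powersetCard k,
            if ∀ e ∈ T, x e ≠ y e then (1 : ℝ) else 0) * g x) =
          (1 + (((E i).powersetCard k).card : ℝ) * p ^ k) * ∑ x, noiseWeight y p x * g x := by
        have h1 : ∀ x, noiseWeight y p x * ((1 + ∑ T ∈ (E i).powersetCard k,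
            if ∀ e ∈ T, x e ≠ y e then (1 : ℝ) else 0) * g x) =
            noiseWeight y p x * g x + ∑ T ∈ (E i).powersetCard k,
              noiseWeight y p x * ((if ∀ e ∈ T, x e ≠ y e then (1 : ℝ) else 0) * g x) := by
          intro x
          rw [add_mul, mul_add, one_mul, Finset.sum_mul, Finset.mul_sum]
        simp only [h1]
        rw [Finset.sum_add_distrib, Finset.sum_comm]
        have h2 : ∀ T ∈ (E i).powersetCard k, ∑ x, noiseWeight y p x *
            ((if ∀ e ∈ T, x e ≠ y e then (1 : ℝ) else 0) * g x) =
            p ^ k * ∑ x, noiseWeight y p x * g x := by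
          intro T hT
          obtain ⟨hT1, hT2⟩ := Finset.mem_powersetCard.1 hT
          rw [sum_noiseWeight_flips y p T g (fun e he => hg e (hT1 he)), hT2]
        rw [Finset.sum_congr rfl h2, Finset.sum_const, nsmul_eq_mul]
        ring
      rw [expand]
      -- The number of k-subsets is bounded crudely by the number of all subsets.
      have hc : (((E i).powersetCard k).card : ℝ) ≤ 2 ^ N := by
        rw [Finset.card_powersetCard]
        calc (((E i).card.choose k : ℕ) : ℝ) ≤ ((2 ^ (E i).card : ℕ) : ℝ) := by
              exact_mod_cast Nat.choose_le_two_pow _ _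
          _ ≤ 2 ^ N := by
              push_cast
              exact pow_le_pow_right₀ (by norm_num) (hN i hiI)
      have hg0 : 0 ≤ ∑ x, noiseWeight y p x * g x := by
        refine Finset.sum_nonneg fun x _ => mul_nonneg (noiseWeight_nonneg y hp0 hp1 x) ?_
        refine Finset.prod_nonneg fun j _ => add_nonneg zero_le_one ?_
        exact Finset.sum_nonneg fun T _ => by split_ifs <;> norm_num
      have hpk : 0 ≤ p ^ k := pow_nonneg hp0 k
      refine mul_le_mul ?_ ih hg0 (by positivity)
      nlinarith
  refine le_trans (Finset.sum_le_sum fun x _ => ?_) (main I subset_rfl)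
  exact mul_le_mul_of_nonneg_left (step x) (noiseWeight_nonneg y hp0 hp1 x)

end Noise

/-! ## The lower bound -/

/-! ### Two-point bound for product noise -/

section TwoPoint

variable {ι : Type*} [Fintype ι] [DecidableEq ι]

/-- Two sign vectors that are opposite on at most `2 * k` coordinates and equal elsewhere are hard
to distinguish: their noisy versions have a common part of mass at least `p ^ k * (1 / 2) ^ k`. -/
theorem exists_common_part (y y' : ι → ℤˣ) (D : Finset ι) (k : ℕ) {p : ℝ} (hp0 : 0 ≤ p)
    (hp1 : p ≤ 1 / 2) (hD : D.card ≤ 2 * k) (hy : ∀ i ∈ D, y' i = -y i)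
    (hy' : ∀ i ∉ D, y' i = y i) :
    ∃ h : (ι → ℤˣ) → ℝ, (∀ x, 0 ≤ h x) ∧ ∑ x, h x = 1 ∧
      (∀ x, p ^ k * (1 / 2) ^ k * h x ≤ noiseWeight y p x) ∧
      ∀ x, p ^ k * (1 / 2) ^ k * h x ≤ noiseWeight y' p x := by
  -- The vector x0 defined from `T` is half-way between `y` and `y'`: it differs from each of them
  -- in at most k coordinates of `D`.
  obtain ⟨T, hTD, hT⟩ := Finset.exists_subset_card_eq (show D.card / 2 ≤ D.card by omega)
  set x0 : ι → ℤˣ := fun i => if i ∈ T then -y i else y i with hx0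
  -- The common part is a point mass at x0 on `D` times the noise law off `D`, where the two truths
  -- coincide.
  set f : ι → ℤˣ → ℝ := fun i s =>
    if i ∈ D then (if s = x0 i then 1 else 0) else (if s = y i then 1 - p else p) with hf
  have hf0 : ∀ i s, 0 ≤ f i s := by
    intro i s
    simp only [hf]
    split_ifs <;> linarith
  -- On `D` the weight of x0 is a power of 1-p times a power of p, both exponents at most k. Since p
  -- is at most 1/2, each factor 1-p is at least 1/2.
  have key : ∀ z : ι → ℤˣ, (∀ i ∉ D, z i = y i) → (D.filter fun i => x0 i = z i).card ≤ k →
      (D.filter fun i => ¬ x0 i = z i).card ≤ k →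
      ∀ x, p ^ k * (1 / 2) ^ k * ∏ i, f i (x i) ≤ noiseWeight z p x := by
    intro z hz h1 h2 x
    by_cases hx : ∀ i ∈ D, x i = x0 i
    · unfold noiseWeight
      rw [← Finset.prod_mul_prod_compl D, ← Finset.prod_mul_prod_compl D fun i =>
        if x i = z i then 1 - p else p]
      have e1 : ∏ i ∈ D, f i (x i) = 1 :=
        Finset.prod_eq_one fun i hi => by simp [hf, hi, hx i hi]
      have e2 : ∏ i ∈ Dᶜ, f i (x i) = ∏ i ∈ Dᶜ, if x i = z i then 1 - p else p := by
        refine Finset.prod_congr rfl fun i hi => ?_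
        have hi' := Finset.mem_compl.1 hi
        simp [hf, hi', hz i hi']
      have e3 : ∏ i ∈ D, (if x i = z i then 1 - p else p) =
          (1 - p) ^ (D.filter fun i => x0 i = z i).card *
            p ^ (D.filter fun i => ¬ x0 i = z i).card := by
        rw [Finset.prod_congr rfl fun i hi => by rw [hx i hi], Finset.prod_ite,
          Finset.prod_const, Finset.prod_const]
      rw [e1, e2, e3, one_mul]
      refine mul_le_mul_of_nonneg_right ?_ (Finset.prod_nonneg fun i _ => by
        split_ifs <;> linarith)
      rw [mul_comm]
      refine mul_le_mul ?_ (pow_le_pow_of_le_one hp0 (by linarith) h2) (by positivity)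
        (pow_nonneg (by linarith) _)
      calc ((1 : ℝ) / 2) ^ k ≤ (1 / 2) ^ (D.filter fun i => x0 i = z i).card :=
            pow_le_pow_of_le_one (by norm_num) (by norm_num) h1
        _ ≤ _ := pow_le_pow_left₀ (by norm_num) (by linarith) _
    · push Not at hx
      obtain ⟨i, hi, hne⟩ := hx
      rw [Finset.prod_eq_zero (Finset.mem_univ i) (by simp [hf, hi, hne]), mul_zero]
      exact noiseWeight_nonneg z hp0 (by linarith) x
  have c1 : (D.filter fun i => ¬ x0 i = y i) = T := by
    ext i
    simp only [Finset.mem_filter, hx0]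
    by_cases h : i ∈ T
    · simp [h, hTD h]
    · simp [h]
  have c2 : (D.filter fun i => x0 i = y i).card = D.card - D.card / 2 := by
    have := Finset.card_filter_add_card_filter_not (s := D) (fun i => x0 i = y i)
    rw [c1, hT] at this
    omega
  have c3 : ∀ i ∈ D, (x0 i = y' i ↔ ¬ x0 i = y i) := by
    intro i hi
    rw [hy i hi, eq_comm, neg_eq_iff_ne_sign, ne_comm]
  refine ⟨fun x => ∏ i, f i (x i), fun x => Finset.prod_nonneg fun i _ => hf0 i _, ?_, ?_, ?_⟩
  · rw [sum_prod_signs]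
    refine Finset.prod_eq_one fun i _ => ?_
    have hne : ¬ ((-1 : ℤˣ) = 1) := by decide
    have hne' : ¬ ((1 : ℤˣ) = -1) := by decide
    simp only [hf]
    by_cases hi : i ∈ D
    · rcases Int.units_eq_one_or (x0 i) with h | h <;> simp [hi, h, hne, hne']
    · rcases Int.units_eq_one_or (y i) with h | h <;> simp [hi, h, hne, hne']
  · refine key y (fun _ _ => rfl) ?_ ?_
    · rw [c2]; omega
    · rw [c1, hT]; omega
  · refine key y' hy' ?_ ?_
    · rw [Finset.filter_congr c3, c1, hT]; omega
    · rw [Finset.filter_congr fun i hi => not_congr (c3 i hi)]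
      simp only [not_not]
      rw [c2]; omega

end TwoPoint

/-! ### From two-point bounds to the Hamming error -/

section Estimation

variable {V : Type}

theorem edgeSign_mk (y : V → ℤˣ) (u v : V) : edgeSign y s(u, v) = y u * y v := rfl

open Classical in
-- Identifies the coordinates on which the edge laws of `Y` and of its flip at `v` differ: the edges
-- at `v`, and no others.
theorem edgeSign_flipAt (Y : V → ℤˣ) (v : V) {G : SimpleGraph V} (e : G.edgeSet) :
    edgeSign (flipAt v Y) e.1 = if v ∈ e.1 then -edgeSign Y e.1 else edgeSign Y e.1 := by
  obtain ⟨e, he⟩ := e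
  induction e using Sym2.inductionOn with
  | _ a b =>
    have hab : a ≠ b := G.ne_of_adj he
    simp only [edgeSign_mk, Sym2.mem_iff, flipAt]
    by_cases h1 : v = a
    · subst h1; simp [Function.update_of_ne hab.symm]
    · by_cases h2 : v = b
      · subst h2; simp [Function.update_of_ne hab]
      · simp [Function.update_of_ne (Ne.symm h1), Function.update_of_ne (Ne.symm h2), h1, h2]

variable [Fintype V]

theorem obsWeight_eq_noiseWeight (G : SimpleGraph V) [Fintype G.edgeSet] (Y : V → ℤˣ) (p q : ℝ)
    (X : G.edgeSet → ℤˣ) (Z : V → ℤˣ) :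
    obsWeight G Y p q X Z =
      noiseWeight (fun e : G.edgeSet => edgeSign Y e.1) p X * noiseWeight Y q Z := by
  unfold obsWeight noiseWeight
  congr!

theorem obsWeight_nonneg (G : SimpleGraph V) (Y : V → ℤˣ) {p q : ℝ} (hp0 : 0 ≤ p) (hp1 : p ≤ 1)
    (hq0 : 0 ≤ q) (hq1 : q ≤ 1) (X : G.edgeSet → ℤˣ) (Z : V → ℤˣ) :
    0 ≤ obsWeight G Y p q X Z := by
  classical
  rw [obsWeight_eq_noiseWeight]
  exact mul_nonneg (noiseWeight_nonneg _ hp0 hp1 X) (noiseWeight_nonneg _ hq0 hq1 Z)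

open Classical in
/-- The labels at a vertex with at most `2 * k` edges cannot be told apart. -/
theorem le_sum_min_obsWeight (G : SimpleGraph V) (Y : V → ℤˣ) {p q : ℝ} (k : ℕ) (hp0 : 0 ≤ p)
    (hp1 : p ≤ 1 / 2) (hq0 : 0 ≤ q) (hq1 : q ≤ 1 / 2) (v : V)
    (hv : (Finset.univ.filter fun e : G.edgeSet => v ∈ e.1).card ≤ 2 * k) :
    p ^ k * (1 / 2) ^ k * (q / 2) ≤ ∑ X : G.edgeSet → ℤˣ, ∑ Z : V → ℤˣ,
      min (obsWeight G Y p q X Z) (obsWeight G (flipAt v Y) p q X Z) := by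
  obtain ⟨g, hg0, hg1, hgy, hgy'⟩ := exists_common_part (fun e : G.edgeSet => edgeSign Y e.1)
    (fun e : G.edgeSet => edgeSign (flipAt v Y) e.1) (Finset.univ.filter fun e => v ∈ e.1) k
    hp0 hp1 hv (fun e he => by
      rw [edgeSign_flipAt, if_pos (Finset.mem_filter.1 he).2]) (fun e he => by
      rw [edgeSign_flipAt, if_neg fun h => he (Finset.mem_filter.2 ⟨Finset.mem_univ _, h⟩)])
  -- The vertex measurements differ at `v` only. The one-element set is treated with exponent 1,
  -- which gives the mass q/2.
  obtain ⟨h, hh0, hh1, hhy, hhy'⟩ := exists_common_part Y (flipAt v Y) {v} 1 hq0 hq1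
    (by simp) (fun i hi => by
      rw [Finset.mem_singleton.1 hi]; simp [flipAt]) (fun i hi => by
      rw [flipAt, Function.update_of_ne (by simpa using hi)])
  have hc : 0 ≤ p ^ k * (1 / 2) ^ k := by positivity
  have hc' : 0 ≤ q ^ 1 * (1 / 2) ^ 1 := by positivity
  calc p ^ k * (1 / 2) ^ k * (q / 2)
      = ∑ X : G.edgeSet → ℤˣ, ∑ Z : V → ℤˣ,
          (p ^ k * (1 / 2) ^ k * g X) * (q ^ 1 * (1 / 2) ^ 1 * h Z) := by
        simp_rw [← Finset.mul_sum]
        rw [hh1, ← Finset.sum_mul, ← Finset.mul_sum, hg1]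
        ring
    _ ≤ _ := by
        refine Finset.sum_le_sum fun X _ => Finset.sum_le_sum fun Z _ => le_min ?_ ?_
        · rw [obsWeight_eq_noiseWeight]
          exact mul_le_mul (hgy X) (hhy Z) (mul_nonneg hc' (hh0 Z))
            (noiseWeight_nonneg _ hp0 (by linarith) X)
        · rw [obsWeight_eq_noiseWeight]
          exact mul_le_mul (hgy' X) (hhy' Z) (mul_nonneg hc' (hh0 Z))
            (noiseWeight_nonneg _ hp0 (by linarith) X)

theorem sum_pmf_toReal {α : Type*} [Fintype α] (μ : PMF α) : ∑ a, (μ a).toReal = 1 := by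
  have h := μ.tsum_coe
  rw [tsum_fintype] at h
  rw [← ENNReal.toReal_sum fun a _ => μ.apply_ne_top a, h]
  simp

open Classical in
/-- Every estimator errs on the vertices with at most `2 * k` edges. -/
theorem exists_le_expectedError (G : SimpleGraph V) {p q : ℝ} (k : ℕ) (hp0 : 0 ≤ p)
    (hp1 : p ≤ 1 / 2) (hq0 : 0 ≤ q) (hq1 : q ≤ 1 / 2) (U : Finset V)
    (hU : ∀ v ∈ U, (Finset.univ.filter fun e : G.edgeSet => v ∈ e.1).card ≤ 2 * k)
    (est : Estimator G) :
    ∃ Y : V → ℤˣ, p ^ k * (1 / 2) ^ k * (q / 4) * U.card ≤ expectedError G Y p q est := by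
  set c := p ^ k * (1 / 2) ^ k * (q / 2) with hc
  -- The probability that the estimator mislabels `v`.
  set err : V → (V → ℤˣ) → ℝ := fun v Y => ∑ X : G.edgeSet → ℤˣ, ∑ Z : V → ℤˣ,
    obsWeight G Y p q X Z * ∑ y : V → ℤˣ, (est X Z y).toReal * (if y v ≠ Y v then 1 else 0)
    with herr
  -- For each observation the chances of erring under `Y` and under its flip at `v` add up to 1. So
  -- the two error probabilities together are at least the sum of the pointwise minima of the two
  -- laws.
  have hpair : ∀ v ∈ U, ∀ Y, c ≤ err v Y + err v (flipAt v Y) := by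
    intro v hv Y
    refine (le_sum_min_obsWeight G Y k hp0 hp1 hq0 hq1 v (hU v hv)).trans ?_
    simp only [herr, ← Finset.sum_add_distrib]
    refine Finset.sum_le_sum fun X _ => Finset.sum_le_sum fun Z _ => ?_
    set a := ∑ y : V → ℤˣ, (est X Z y).toReal * (if y v ≠ Y v then (1 : ℝ) else 0) with ha
    set b := ∑ y : V → ℤˣ, (est X Z y).toReal * (if y v ≠ flipAt v Y v then (1 : ℝ) else 0)
      with hb
    have ha0 : 0 ≤ a := Finset.sum_nonneg fun y _ => by
      split_ifs <;> simp
    have hb0 : 0 ≤ b := Finset.sum_nonneg fun y _ => by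
      split_ifs <;> simp
    have hab : a + b = 1 := by
      rw [ha, hb, ← Finset.sum_add_distrib]
      refine (Finset.sum_congr rfl fun y _ => ?_).trans (sum_pmf_toReal (est X Z))
      have : flipAt v Y v = -Y v := by simp [flipAt]
      rw [this]
      by_cases h : y v = Y v
      · simp [h]
      · have h2 : y v = -Y v := ((neg_eq_iff_ne_sign _ _).2 (Ne.symm h)).symm
        simp [h2]
    set m := min (obsWeight G Y p q X Z) (obsWeight G (flipAt v Y) p q X Z)
    have h1 : m * a ≤ obsWeight G Y p q X Z * a := mul_le_mul_of_nonneg_right (min_le_left _ _) ha0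
    have h2 : m * b ≤ obsWeight G (flipAt v Y) p q X Z * b :=
      mul_le_mul_of_nonneg_right (min_le_right _ _) hb0
    calc m = m * a + m * b := by rw [← mul_add, hab, mul_one]
      _ ≤ _ := add_le_add h1 h2
  -- Flipping at `v` permutes all labellings, so each pair is met twice in the sum over `Y`; this is
  -- the factor 1/2.
  have hsum : ∀ v ∈ U, c / 2 * (Fintype.card (V → ℤˣ)) ≤ ∑ Y, err v Y := by
    intro v hv
    have h1 : ∑ Y, err v (flipAt v Y) = ∑ Y, err v Y :=
      Equiv.sum_comp (flipAt_involutive v).toPerm (fun Y => err v Y)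
    have h2 : ∑ _Y : V → ℤˣ, c ≤ ∑ Y, (err v Y + err v (flipAt v Y)) :=
      Finset.sum_le_sum fun Y _ => hpair v hv Y
    rw [Finset.sum_add_distrib, h1, Finset.sum_const, nsmul_eq_mul, Finset.card_univ] at h2
    linarith
  have hle : ∀ Y, ∑ v ∈ U, err v Y ≤ expectedError G Y p q est := by
    intro Y
    unfold expectedError
    simp only [herr]
    rw [Finset.sum_comm]
    refine Finset.sum_le_sum fun X _ => ?_
    rw [Finset.sum_comm]
    refine Finset.sum_le_sum fun Z _ => ?_
    rw [← Finset.mul_sum, Finset.sum_comm]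
    refine mul_le_mul_of_nonneg_left (Finset.sum_le_sum fun y _ => ?_)
      (obsWeight_nonneg G Y hp0 (by linarith) hq0 (by linarith) X Z)
    rw [← Finset.mul_sum]
    refine mul_le_mul_of_nonneg_left ?_ ENNReal.toReal_nonneg
    rw [Finset.sum_boole, hammingDist]
    exact_mod_cast Finset.card_le_card fun v hv =>
      Finset.mem_filter.2 ⟨Finset.mem_univ _, (Finset.mem_filter.1 hv).2⟩
  have htot : ∑ _Y : V → ℤˣ, p ^ k * (1 / 2) ^ k * (q / 4) * U.card ≤
      ∑ Y, expectedError G Y p q est := by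
    calc ∑ _Y : V → ℤˣ, p ^ k * (1 / 2) ^ k * (q / 4) * U.card
        = ∑ v ∈ U, c / 2 * (Fintype.card (V → ℤˣ)) := by
          rw [Finset.sum_const, Finset.sum_const, nsmul_eq_mul, nsmul_eq_mul, Finset.card_univ, hc]
          ring
      _ ≤ ∑ v ∈ U, ∑ Y, err v Y := Finset.sum_le_sum hsum
      _ = ∑ Y, ∑ v ∈ U, err v Y := Finset.sum_comm
      _ ≤ _ := Finset.sum_le_sum fun Y _ => hle Y
  -- Under a uniformly random truth the average error is large, hence it is large for some truth.
  obtain ⟨Y, -, hY⟩ := Finset.exists_le_of_sum_le Finset.univ_nonempty htot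
  exact ⟨Y, hY⟩

end Estimation

/-! ### The number of added edges -/

section AddedEdges

variable {V : Type} [Fintype V]

open Classical in
-- Supergraphs of `H` correspond to subsets of the edge set of the complement; the sum is the
-- expansion of a product of binomials.
theorem sum_supergraphs_prod {V : Type} [Fintype (SimpleGraph V)] (H : SimpleGraph V) [Fintype Hᶜ.edgeSet] (a b : ℝ) :
    ∑ G : SimpleGraph V, (if H ≤ G then
      ∏ e ∈ Hᶜ.edgeFinset, (if e ∈ G.edgeSet then a else b) else 0) =
      (a + b) ^ Hᶜ.edgeFinset.card := by
  rw [← Finset.prod_const, Finset.prod_add, ← Finset.sum_filter]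
  refine Finset.sum_bij' (fun G _ => Hᶜ.edgeFinset.filter fun e => e ∈ G.edgeSet)
    (fun t _ => H ⊔ SimpleGraph.fromEdgeSet (t : Set (Sym2 V))) ?_ ?_ ?_ ?_ ?_
  · intro G _
    exact Finset.mem_powerset.2 (Finset.filter_subset _ _)
  · intro t _
    exact Finset.mem_filter.2 ⟨Finset.mem_univ _, le_sup_left⟩
  · intro G hG
    have hHG := (Finset.mem_filter.1 hG).2
    ext u v
    simp only [SimpleGraph.sup_adj, SimpleGraph.fromEdgeSet_adj, Finset.coe_filter,
      SimpleGraph.mem_edgeFinset, Set.mem_ofPred_eq, SimpleGraph.mem_edgeSet,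
      SimpleGraph.compl_adj]
    constructor
    · rintro (h | ⟨⟨_, h⟩, _⟩)
      · exact hHG h
      · exact h
    · intro h
      by_cases h2 : H.Adj u v
      · exact Or.inl h2
      · exact Or.inr ⟨⟨⟨h.ne, h2⟩, h⟩, h.ne⟩
  · intro t ht
    have ht := Finset.mem_powerset.1 ht
    ext e
    induction e using Sym2.inductionOn with
    | _ u v =>
      simp only [Finset.mem_filter, SimpleGraph.mem_edgeFinset, SimpleGraph.mem_edgeSet,
        SimpleGraph.sup_adj, SimpleGraph.fromEdgeSet_adj, Finset.mem_coe, SimpleGraph.compl_adj]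
      constructor
      · rintro ⟨⟨_, h⟩, h' | ⟨h', _⟩⟩
        · exact absurd h' h
        · exact h'
      · intro h
        have h2 := ht h
        simp only [SimpleGraph.mem_edgeFinset, SimpleGraph.mem_edgeSet,
          SimpleGraph.compl_adj] at h2
        exact ⟨h2, Or.inr ⟨h, h2.1⟩⟩
  · intro G _
    rw [Finset.prod_ite, Finset.filter_not]

open Classical in
/-- The number of edges of `G` that do not belong to `H`. -/
noncomputable def addedEdges (H G : SimpleGraph V) : ℕ := (Hᶜ.edgeFinset.filter fun e => e ∈ G.edgeSet).card

end AddedEdges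

/-- The added edges are independent trials, so their number has the generating function of a
binomial law. Of the number of trials only an upper bound matters. Taking z = 1 gives total mass 1.
-/
theorem sum_graphWeight_mul_pow (n k : ℕ) (α z : ℝ) :
    ∃ M : ℕ, (M : ℝ) ≤ n * n / 2 ∧
      ∑ G : SimpleGraph (Fin n), graphWeight n k α G * z ^ addedEdges (ringLattice n k) G =
        (1 + α / n * (z - 1)) ^ M := by
  classical
  refine ⟨(ringLattice n k)ᶜ.edgeFinset.card, ?_, ?_⟩
  · have h := SimpleGraph.card_edgeFinset_le_card_choose_two (G := (ringLattice n k)ᶜ)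
    rw [Fintype.card_fin] at h
    have h2 : ((n.choose 2 : ℕ) : ℝ) ≤ n * n / 2 := by
      rw [Nat.cast_choose_two]
      have : (0 : ℝ) ≤ n := Nat.cast_nonneg n
      nlinarith
    exact le_trans (by exact_mod_cast h) h2
  · rw [show 1 + α / n * (z - 1) = α / n * z + (1 - α / n) by ring]
    refine Eq.trans ?_ (sum_supergraphs_prod (ringLattice n k) (α / n * z) (1 - α / n))
    refine Finset.sum_congr rfl fun G _ => ?_
    have hadd : addedEdges (ringLattice n k) G =
        ((ringLattice n k)ᶜ.edgeFinset.filter fun e => e ∈ G.edgeSet).card := by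
      unfold addedEdges
      congr!
    rw [hadd]
    unfold graphWeight
    by_cases h : ringLattice n k ≤ G
    · rw [if_pos h, if_pos h, Finset.prod_ite, Finset.prod_ite, Finset.prod_const,
        Finset.prod_const, Finset.prod_const, mul_pow]
      ring
    · rw [if_neg h, if_neg h, zero_mul]

theorem sum_graphWeight (n k : ℕ) (α : ℝ) :
    ∑ G : SimpleGraph (Fin n), graphWeight n k α G = 1 := by
  obtain ⟨M, -, h⟩ := sum_graphWeight_mul_pow n k α 1
  simpa using h

theorem graphWeight_nonneg {n : ℕ} (k : ℕ) {α : ℝ} (hα0 : 0 ≤ α) (hα1 : α ≤ 1) (G : SimpleGraph (Fin n)) :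
    0 ≤ graphWeight n k α G := by
  have h0 : 0 ≤ α / n := div_nonneg hα0 (Nat.cast_nonneg n)
  have h1 : α / n ≤ 1 := by
    rcases Nat.eq_zero_or_pos n with rfl | hn
    · simp
    · have : (1 : ℝ) ≤ n := by exact_mod_cast hn
      exact (div_le_one (by linarith)).2 (by linarith)
  unfold graphWeight
  split_ifs
  · refine Finset.prod_nonneg fun e _ => ?_
    split_ifs <;> linarith
  · exact le_rfl

open Classical in
-- Chernoff bound. Added edges touch on average at most αn vertices; the threshold lies midway
-- between αn and n.
theorem sum_graphWeight_many_added (n k : ℕ) {α : ℝ} (hα0 : 0 ≤ α) (hα1 : α < 1) :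
    ∑ G : SimpleGraph (Fin n),
      (if (1 + α) / 2 * n ≤ 2 * addedEdges (ringLattice n k) G then graphWeight n k α G else 0) ≤
        Real.exp (-((1 - α) ^ 2 / 32 * n)) := by
  set t := (1 - α) / 4 with ht
  have ht0 : 0 ≤ t := by rw [ht]; linarith
  have ht1 : t ≤ 1 := by rw [ht]; linarith
  have hn0 : (0 : ℝ) ≤ n := Nat.cast_nonneg n
  have hexp : Real.exp t - 1 ≤ t + t ^ 2 := by
    have := Real.abs_exp_sub_one_sub_id_le (x := t) (by rw [abs_of_nonneg ht0]; exact ht1)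
    have := (abs_le.1 this).2
    linarith
  have hexp0 : 0 ≤ Real.exp t - 1 := by linarith [Real.add_one_le_exp t]
  obtain ⟨M, hM, hsum⟩ := sum_graphWeight_mul_pow n k α (Real.exp t)
  set m : ℝ := (1 + α) / 4 * n with hm
  have h1 : ∀ G : SimpleGraph (Fin n),
      (if (1 + α) / 2 * n ≤ 2 * addedEdges (ringLattice n k) G then graphWeight n k α G else 0) ≤
        Real.exp (-(t * m)) *
          (graphWeight n k α G * Real.exp t ^ addedEdges (ringLattice n k) G) := by
    intro G
    have hw := graphWeight_nonneg k hα0 hα1.le G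
    split_ifs with h
    · rw [← Real.exp_nat_mul, mul_left_comm, ← Real.exp_add]
      refine le_mul_of_one_le_right hw (Real.one_le_exp ?_)
      have : m ≤ addedEdges (ringLattice n k) G := by rw [hm]; linarith
      nlinarith
    · positivity
  refine (Finset.sum_le_sum fun G _ => h1 G).trans ?_
  rw [← Finset.mul_sum, hsum]
  have h2 : (1 + α / n * (Real.exp t - 1)) ^ M ≤ Real.exp (n / 2 * α * (t + t ^ 2)) := by
    rcases Nat.eq_zero_or_pos n with hn | hn
    · subst hn
      have : M = 0 := by
        have : (M : ℝ) ≤ 0 := by simpa using hM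
        exact_mod_cast le_antisymm this (Nat.cast_nonneg _)
      simp [this]
    have hn1 : (0 : ℝ) < n := by exact_mod_cast hn
    have hpos : 0 ≤ α / n * (Real.exp t - 1) := mul_nonneg (div_nonneg hα0 hn0) hexp0
    calc (1 + α / n * (Real.exp t - 1)) ^ M
        ≤ Real.exp (α / n * (Real.exp t - 1)) ^ M := by
          refine pow_le_pow_left₀ (by linarith) ?_ M
          linarith [Real.add_one_le_exp (α / n * (Real.exp t - 1))]
      _ = Real.exp (M * (α / n * (Real.exp t - 1))) := by rw [Real.exp_nat_mul]
      _ ≤ _ := by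
          refine Real.exp_le_exp.2 ?_
          calc (M : ℝ) * (α / n * (Real.exp t - 1))
              ≤ (n * n / 2) * (α / n * (Real.exp t - 1)) := mul_le_mul_of_nonneg_right hM hpos
            _ = n / 2 * α * (Real.exp t - 1) := by field_simp
            _ ≤ _ := mul_le_mul_of_nonneg_left hexp (by positivity)
  refine (mul_le_mul_of_nonneg_left h2 (Real.exp_pos _).le).trans ?_
  rw [← Real.exp_add]
  refine Real.exp_le_exp.2 ?_
  have h3 : -(t * m) + n / 2 * α * (t + t ^ 2) = -(n * (t * (1 - α) / 4 - t ^ 2 * α / 2)) := by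
    rw [hm]; ring
  rw [h3, ht]
  -- With t = (1-α)/4 the exponent is -n((1-α)² + (1-α)³)/32, so the cubic term is the surplus.
  have h4 : 0 ≤ n * (1 - α) ^ 3 := mul_nonneg hn0 (pow_nonneg (by linarith) 3)
  nlinarith

/-! ### Degrees in the ring lattice -/

theorem ringLattice_adj_iff {n k : ℕ} {u v : Fin n} : (ringLattice n k).Adj u v ↔ u ≠ v ∧
    ((∃ d : ℕ, 1 ≤ d ∧ d ≤ k ∧ (u.val + d) % n = v.val) ∨
      ∃ d : ℕ, 1 ≤ d ∧ d ≤ k ∧ (v.val + d) % n = u.val) := by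
  rw [ringLattice, SimpleGraph.fromRel_adj]

open Classical in
theorem card_ringLattice_neighbors_le (n k : ℕ) (v : Fin n) :
    (Finset.univ.filter fun u => (ringLattice n k).Adj v u).card ≤ 2 * k := by
  have hn : 0 < n := v.pos
  -- The neighbours are v + d and v - d modulo n. The multiple n * d keeps the natural subtraction
  -- from being truncated.
  have hsub : (Finset.univ.filter fun u => (ringLattice n k).Adj v u) ⊆
      (Finset.Icc 1 k).image (fun d => (⟨(v.val + d) % n, Nat.mod_lt _ hn⟩ : Fin n)) ∪
      (Finset.Icc 1 k).image (fun d => (⟨(v.val + n * d - d) % n, Nat.mod_lt _ hn⟩ : Fin n)) := by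
    intro u hu
    have hu := (Finset.mem_filter.1 hu).2
    rw [ringLattice_adj_iff] at hu
    obtain ⟨-, ⟨d, h1, h2, h3⟩ | ⟨d, h1, h2, h3⟩⟩ := hu
    · exact Finset.mem_union_left _ (Finset.mem_image.2
        ⟨d, Finset.mem_Icc.2 ⟨h1, h2⟩, Fin.ext h3⟩)
    · refine Finset.mem_union_right _ (Finset.mem_image.2
        ⟨d, Finset.mem_Icc.2 ⟨h1, h2⟩, Fin.ext ?_⟩)
      have h4 : v.val + n * d - d + d ≡ u.val + d [MOD n] := by
        rw [Nat.sub_add_cancel ((Nat.le_mul_of_pos_left d hn).trans (Nat.le_add_left _ _))]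
        unfold Nat.ModEq
        rw [h3, Nat.add_mul_mod_self_left, Nat.mod_eq_of_lt v.isLt]
      exact Nat.mod_eq_of_modEq (Nat.ModEq.add_right_cancel' d h4) u.isLt
  refine (Finset.card_le_card hsub).trans ((Finset.card_union_le _ _).trans ?_)
  have h1 := Finset.card_image_le (s := Finset.Icc 1 k)
    (f := fun d => (⟨(v.val + d) % n, Nat.mod_lt _ hn⟩ : Fin n))
  have h2 := Finset.card_image_le (s := Finset.Icc 1 k)
    (f := fun d => (⟨(v.val + n * d - d) % n, Nat.mod_lt _ hn⟩ : Fin n))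
  rw [Nat.card_Icc] at h1 h2
  omega

open Classical in
/-- A vertex without added edges keeps its at most `2 * k` edges. -/
theorem card_incident_le {n k : ℕ} (G : SimpleGraph (Fin n)) (v : Fin n)
    (hv : ∀ u, G.Adj v u → (ringLattice n k).Adj v u) :
    (Finset.univ.filter fun e : G.edgeSet => v ∈ e.1).card ≤ 2 * k := by
  refine le_trans ?_ (card_ringLattice_neighbors_le n k v)
  rw [← Finset.card_image_of_injective _ (Subtype.val_injective (p := fun e => e ∈ G.edgeSet))]
  refine le_trans (Finset.card_le_card ?_)
    (Finset.card_image_le (f := fun u => s(v, u)))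
  intro e he
  obtain ⟨⟨e', he'⟩, h1, rfl⟩ := Finset.mem_image.1 he
  obtain ⟨u, rfl⟩ := (Finset.mem_filter.1 h1).2
  exact Finset.mem_image.2 ⟨u, Finset.mem_filter.2 ⟨Finset.mem_univ _, hv u he'⟩, rfl⟩

open Classical in
-- Every vertex that is not counted is an endpoint of an added edge, and an edge has at most two
-- endpoints.
theorem card_without_added {n : ℕ} (H G : SimpleGraph (Fin n)) :
    n ≤ (Finset.univ.filter fun v => ∀ u, G.Adj v u → H.Adj v u).card + 2 * addedEdges H G := by
  have hsub : (Finset.univ.filter fun v => ¬ ∀ u, G.Adj v u → H.Adj v u) ⊆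
      (Hᶜ.edgeFinset.filter fun e => e ∈ G.edgeSet).biUnion fun e => e.toFinset := by
    intro v hv
    have hv := (Finset.mem_filter.1 hv).2
    push Not at hv
    obtain ⟨u, h1, h2⟩ := hv
    refine Finset.mem_biUnion.2 ⟨s(v, u), Finset.mem_filter.2 ⟨?_, h1⟩, by simp⟩
    simp [h1.ne, h2]
  have h1 := (Finset.card_le_card hsub).trans Finset.card_biUnion_le
  have h2 : ∑ e ∈ Hᶜ.edgeFinset.filter (fun e => e ∈ G.edgeSet), e.toFinset.card ≤
      2 * addedEdges H G := by
    have hadd : addedEdges H G = (Hᶜ.edgeFinset.filter fun e => e ∈ G.edgeSet).card := by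
      unfold addedEdges
      congr!
    rw [mul_comm, hadd, ← smul_eq_mul, ← Finset.sum_const]
    refine Finset.sum_le_sum fun e _ => ?_
    rw [Sym2.card_toFinset]
    split_ifs <;> omega
  have h3 := Finset.card_filter_add_card_filter_not (s := (Finset.univ : Finset (Fin n)))
    (fun v => ∀ u, G.Adj v u → H.Adj v u)
  rw [Finset.card_univ, Fintype.card_fin] at h3
  omega

theorem lower_bound (k : ℕ) (α q : ℝ) (hα0 : 0 ≤ α) (hα1 : α < 1) (hq0 : 0 < q)
    (hq1 : q < 1 / 2) :
    ∃ c : ℝ, 0 < c ∧ Tendsto (fun n : ℕ => graphProb n k α (fun G =>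
      ∀ p : ℝ, 0 < p → p < q → ∀ est : Estimator G,
        ∃ Y : Fin n → ℤˣ, c * (p ^ k * n) ≤ expectedError G Y p q est)) atTop (𝓝 1) := by
  classical
  -- The last factor is the proportion of vertices without added edges, the others come from
  -- `exists_le_expectedError`.
  refine ⟨(1 / 2) ^ k * (q / 4) * ((1 - α) / 2), by
    have : 0 < 1 - α := by linarith
    positivity, ?_⟩
  set A : (n : ℕ) → SimpleGraph (Fin n) → Prop := fun n G =>
      ∀ p : ℝ, 0 < p → p < q → ∀ est : Estimator G,
        ∃ Y : Fin n → ℤˣ, (1 / 2) ^ k * (q / 4) * ((1 - α) / 2) * (p ^ k * n) ≤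
          expectedError G Y p q est with hA
  -- A deterministic implication: few added edges suffice for all noise levels and all estimators
  -- simultaneously.
  have hgood : ∀ n (G : SimpleGraph (Fin n)),
      ¬ ((1 + α) / 2 * n ≤ 2 * addedEdges (ringLattice n k) G) → A n G := by
    intro n G h p hp0 hpq est
    push Not at h
    obtain ⟨Y, hY⟩ := exists_le_expectedError G k hp0.le (by linarith) hq0.le (by linarith)
      (Finset.univ.filter fun v => ∀ u, G.Adj v u → (ringLattice n k).Adj v u)
      (fun v hv => by convert card_incident_le G v (Finset.mem_filter.1 hv).2) est
    refine ⟨Y, le_trans ?_ hY⟩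
    have h1 := card_without_added (ringLattice n k) G
    have h2 : (n : ℝ) ≤ (Finset.univ.filter fun v => ∀ u, G.Adj v u →
        (ringLattice n k).Adj v u).card + 2 * addedEdges (ringLattice n k) G := by
      exact_mod_cast h1
    have h3 : 0 ≤ p ^ k * (1 / 2) ^ k * (q / 4) := by positivity
    calc (1 / 2) ^ k * (q / 4) * ((1 - α) / 2) * (p ^ k * n)
        = p ^ k * (1 / 2) ^ k * (q / 4) * ((1 - α) / 2 * n) := by ring
      _ ≤ _ := mul_le_mul_of_nonneg_left (by linarith) h3
  have hlow : ∀ n : ℕ, 1 - Real.exp (-((1 - α) ^ 2 / 32 * n)) ≤ graphProb n k α (A n) := by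
    intro n
    have h1 := sum_graphWeight_many_added n k hα0 hα1
    have h2 : 1 ≤ graphProb n k α (A n) + ∑ G : SimpleGraph (Fin n),
        (if (1 + α) / 2 * n ≤ 2 * addedEdges (ringLattice n k) G then
          graphWeight n k α G else 0) := by
      rw [graphProb, ← Finset.sum_add_distrib]
      refine (sum_graphWeight n k α).symm.le.trans ?_
      refine Finset.sum_le_sum fun G _ => ?_
      have hw := graphWeight_nonneg k hα0 hα1.le G
      by_cases h : (1 + α) / 2 * n ≤ 2 * addedEdges (ringLattice n k) G
      · rw [if_pos h]
        split_ifs <;> linarith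
      · rw [if_neg h, if_pos (hgood n G h)]
        linarith
    linarith
  have hup : ∀ n, graphProb n k α (A n) ≤ 1 := by
    intro n
    refine le_trans ?_ (sum_graphWeight n k α).le
    refine Finset.sum_le_sum fun G _ => ?_
    have hw := graphWeight_nonneg k hα0 hα1.le G
    split_ifs <;> linarith
  have hlim : Tendsto (fun n : ℕ => 1 - Real.exp (-((1 - α) ^ 2 / 32 * n))) atTop (𝓝 1) := by
    have h1 : Tendsto (fun n : ℕ => (1 - α) ^ 2 / 32 * (n : ℝ)) atTop atTop :=
      tendsto_natCast_atTop_atTop.const_mul_atTop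
        (div_pos (pow_pos (by linarith) 2) (by norm_num))
    have h2 := Real.tendsto_exp_neg_atTop_nhds_zero.comp h1
    simpa using h2.const_sub 1
  exact tendsto_of_tendsto_of_tendsto_of_le_of_le hlim tendsto_const_nhds hlow hup

/-! ## Geometry of the ring lattice -/

/-- The vertex of the ring with number `x` modulo `n`. -/
def ringVertex {n : ℕ} (hn : 0 < n) (x : ℕ) : Fin n := ⟨x % n, Nat.mod_lt _ hn⟩

theorem ringVertex_eq_iff {n : ℕ} (hn : 0 < n) (x y : ℕ) :
    ringVertex hn x = ringVertex hn y ↔ x ≡ y [MOD n] := by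
  simp [ringVertex, Nat.ModEq, Fin.ext_iff]

theorem ringVertex_val {n : ℕ} (hn : 0 < n) (v : Fin n) : ringVertex hn v.val = v :=
  Fin.ext (Nat.mod_eq_of_lt v.isLt)

theorem modEq_eq_of_lt {n x y : ℕ} (h : x ≡ y [MOD n]) (h1 : x < y + n) (h2 : y < x + n) :
    x = y := by
  rcases le_total x y with hle | hle
  · obtain ⟨c, hc⟩ := (Nat.modEq_iff_dvd' hle).1 h
    have : c = 0 := by
      by_contra hne
      have := Nat.le_mul_of_pos_right n (Nat.pos_of_ne_zero hne)
      omega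
    subst this
    omega
  · obtain ⟨c, hc⟩ := (Nat.modEq_iff_dvd' hle).1 h.symm
    have : c = 0 := by
      by_contra hne
      have := Nat.le_mul_of_pos_right n (Nat.pos_of_ne_zero hne)
      omega
    subst this
    omega

theorem ringVertex_injective {n : ℕ} (hn : 0 < n) {x y : ℕ} (h1 : x < y + n) (h2 : y < x + n)
    (h : ringVertex hn x = ringVertex hn y) : x = y :=
  modEq_eq_of_lt ((ringVertex_eq_iff hn x y).1 h) h1 h2

/-- The condition y + k < x + n excludes adjacency the other way round the ring, so that adjacency
can be read off from the integers. -/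
theorem ringLattice_adj_ringVertex {n k : ℕ} (hn : 0 < n) {x y : ℕ} (hxy : x < y)
    (hy : y + k < x + n) :
    (ringLattice n k).Adj (ringVertex hn x) (ringVertex hn y) ↔ y ≤ x + k := by
  rw [ringLattice_adj_iff]
  constructor
  · rintro ⟨-, ⟨d, h1, h2, h3⟩ | ⟨d, h1, h2, h3⟩⟩
    · have h4 : x + d ≡ y [MOD n] := by
        unfold Nat.ModEq
        rw [← Nat.mod_add_mod]
        exact h3
      have := modEq_eq_of_lt h4 (by omega) (by omega)
      omega
    · have h4 : y + d ≡ x [MOD n] := by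
        unfold Nat.ModEq
        rw [← Nat.mod_add_mod]
        exact h3
      have := modEq_eq_of_lt h4 (by omega) (by omega)
      omega
  · intro h
    refine ⟨fun he => ?_, Or.inl ⟨y - x, by omega, by omega, ?_⟩⟩
    · have := ringVertex_injective hn (by omega) (by omega) he
      omega
    · simp only [ringVertex, Nat.mod_add_mod]
      congr 1
      omega

theorem exists_ringVertex_of_adj {n k : ℕ} (hn : 0 < n) {x : ℕ} (hx : k ≤ x) {v : Fin n}
    (h : (ringLattice n k).Adj (ringVertex hn x) v) :
    ∃ y, x ≤ y + k ∧ y ≤ x + k ∧ v = ringVertex hn y := by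
  rw [ringLattice_adj_iff] at h
  obtain ⟨-, ⟨d, h1, h2, h3⟩ | ⟨d, h1, h2, h3⟩⟩ := h
  · refine ⟨x + d, by omega, by omega, Fin.ext ?_⟩
    rw [← h3]
    simp [ringVertex]
  · refine ⟨x - d, by omega, by omega, ?_⟩
    rw [← ringVertex_val hn v, ringVertex_eq_iff]
    refine Nat.ModEq.add_right_cancel' d ?_
    rw [Nat.sub_add_cancel (by omega)]
    unfold Nat.ModEq
    rw [h3]
    simp [ringVertex]

/-- Vertex number `a` of the extended component number `i`, for `a ≤ 4 * k`; the centre is number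
`2 * k`. -/
def starVertex {n : ℕ} (hn : 0 < n) (k i a : ℕ) : Fin n :=
  -- Adding `n` prevents truncation for the first components.
  ringVertex hn (i * (k + 1) + n - 2 * k + a)

theorem center_lt {n k i : ℕ} (hi : i < numBags n k) : i * (k + 1) < n := by
  have h := (Nat.le_div_iff_mul_le (Nat.succ_pos k)).1 (Nat.succ_le_of_lt hi)
  simp only [Nat.succ_eq_add_one, add_mul] at h
  omega

theorem lt_numBags {n k i : ℕ} (h : i * (k + 1) < n) : i < numBags n k := by
  refine (Nat.le_div_iff_mul_le (Nat.succ_pos k)).2 ?_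
  simp only [Nat.succ_eq_add_one, add_mul]
  omega

theorem starVertex_center {n k : ℕ} (hn : 0 < n) (hk : 2 * k ≤ n) (i : Fin (numBags n k)) :
    (starVertex hn k i (2 * k)).val = i.val * (k + 1) := by
  have h1 : i.val * (k + 1) + n - 2 * k + 2 * k = i.val * (k + 1) + n := by omega
  rw [starVertex, h1]
  simp [ringVertex, Nat.mod_eq_of_lt (center_lt i.isLt)]

/-- In the coordinates of `starVertex` the component is the interval from k to 3k. Positions of an
extended component differ by at most 4k, so 5k < n rules out both coincidences and adjacencies
around the ring. -/
theorem mem_ringBag {n k : ℕ} (hn : 5 * k < n) (i : Fin (numBags n k)) (v : Fin n) :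
    v ∈ ringBag n k i ↔ ∃ a, k ≤ a ∧ a ≤ 3 * k ∧ v = starVertex (by omega) k i a := by
  have hn0 : 0 < n := by omega
  simp only [ringBag, Finset.mem_filter, Finset.mem_univ, true_and]
  constructor
  · rintro ⟨c, hc, h⟩
    have hc' : c = starVertex hn0 k i (2 * k) :=
      Fin.ext (by rw [hc, starVertex_center hn0 (by omega)])
    rcases h with rfl | h
    · exact ⟨2 * k, by omega, by omega, hc'⟩
    · rw [hc'] at h
      obtain ⟨y, h1, h2, h3⟩ := exists_ringVertex_of_adj hn0 (by omega) h
      refine ⟨y - (i.val * (k + 1) + n - 2 * k), by omega, by omega, ?_⟩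
      rw [h3, starVertex]
      congr 1
      omega
  · rintro ⟨a, h1, h2, rfl⟩
    refine ⟨starVertex hn0 k i (2 * k), starVertex_center hn0 (by omega) i, ?_⟩
    rcases lt_trichotomy a (2 * k) with h | h | h
    · exact Or.inr ((ringLattice_adj_ringVertex hn0 (by omega) (by omega)).2 (by omega)).symm
    · exact Or.inl (by rw [h])
    · exact Or.inr ((ringLattice_adj_ringVertex hn0 (by omega) (by omega)).2 (by omega))

theorem mem_ringStar {n k : ℕ} (hn : 5 * k < n) (i : Fin (numBags n k)) (v : Fin n) :
    v ∈ (ringDecomposition n k).star i ↔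
      ∃ a, a ≤ 4 * k ∧ v = starVertex (by omega) k i a := by
  have hn0 : 0 < n := by omega
  simp only [ringDecomposition, Finset.mem_union, Finset.mem_filter, Finset.mem_univ, true_and,
    mem_ringBag hn]
  constructor
  · rintro (⟨a, -, h2, h3⟩ | ⟨u, ⟨a, h1, h2, rfl⟩, h⟩)
    · exact ⟨a, by omega, h3⟩
    · obtain ⟨y, h3, h4, h5⟩ := exists_ringVertex_of_adj hn0 (by omega) h
      refine ⟨y - (i.val * (k + 1) + n - 2 * k), by omega, ?_⟩
      rw [h5, starVertex]
      congr 1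
      omega
  · rintro ⟨a, h1, rfl⟩
    rcases lt_or_ge a k with h | h
    · refine Or.inr ⟨starVertex hn0 k i (a + k), ⟨a + k, by omega, by omega, rfl⟩, ?_⟩
      exact ((ringLattice_adj_ringVertex hn0 (by omega) (by omega)).2 (by omega)).symm
    rcases le_or_gt a (3 * k) with h' | h'
    · exact Or.inl ⟨a, h, h', rfl⟩
    · refine Or.inr ⟨starVertex hn0 k i (a - k), ⟨a - k, by omega, by omega, rfl⟩, ?_⟩
      exact (ringLattice_adj_ringVertex hn0 (by omega) (by omega)).2 (by omega)

theorem starVertex_injective {n k : ℕ} (hn : 5 * k < n) (i : ℕ) {a b : ℕ} (ha : a ≤ 4 * k)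
    (hb : b ≤ 4 * k) (h : starVertex (n := n) (by omega) k i a = starVertex (by omega) k i b) :
    a = b := by
  have := ringVertex_injective (by omega) (by omega) (by omega) h
  omega

theorem starVertex_adj {n k : ℕ} (hn : 5 * k < n) (i : ℕ) {a b : ℕ} (hab : a < b)
    (hb : b ≤ 4 * k) : (ringLattice n k).Adj (starVertex (by omega) k i a)
      (starVertex (by omega) k i b) ↔ b ≤ a + k := by
  rw [starVertex, starVertex, ringLattice_adj_ringVertex (by omega) (by omega) (by omega)]
  omega

theorem card_ringBag_le {n k : ℕ} (hn : 5 * k < n) (i : Fin (numBags n k)) :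
    (ringBag n k i).card ≤ 2 * k + 1 := by
  have hsub : ringBag n k i ⊆
      (Finset.Icc k (3 * k)).image (starVertex (show 0 < n by omega) k i) := by
    intro v hv
    obtain ⟨a, h1, h2, rfl⟩ := (mem_ringBag hn i v).1 hv
    exact Finset.mem_image_of_mem _ (Finset.mem_Icc.2 ⟨h1, h2⟩)
  refine (Finset.card_le_card hsub).trans (Finset.card_image_le.trans ?_)
  rw [Nat.card_Icc]
  omega

theorem card_ringStar_le {n k : ℕ} (hn : 5 * k < n) (i : Fin (numBags n k)) :
    ((ringDecomposition n k).star i).card ≤ 4 * k + 1 := by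
  have hsub : (ringDecomposition n k).star i ⊆
      (Finset.range (4 * k + 1)).image (starVertex (show 0 < n by omega) k i) := by
    intro v hv
    obtain ⟨a, h1, rfl⟩ := (mem_ringStar hn i v).1 hv
    exact Finset.mem_image_of_mem _ (Finset.mem_range.2 (by omega))
  refine (Finset.card_le_card hsub).trans (Finset.card_image_le.trans ?_)
  rw [Finset.card_range]

theorem ringBag_nonempty {n k : ℕ} (hn : 5 * k < n) (i : Fin (numBags n k)) :
    (ringBag n k i).Nonempty :=
  ⟨_, (mem_ringBag hn i _).2 ⟨2 * k, by omega, by omega, rfl⟩⟩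

/-- The number of components that contain a given vertex is bounded. -/
theorem card_bags_le {n k : ℕ} (hn : 5 * k < n) (v : Fin n) :
    (Finset.univ.filter fun i : Fin (numBags n k) => v ∈ ringBag n k i).card ≤ 2 * k + 1 := by
  have hn0 : 0 < n := by omega
  have hsub : (Finset.univ.filter fun i : Fin (numBags n k) => v ∈ ringBag n k i) ⊆
      (Finset.Icc k (3 * k)).biUnion fun a =>
        Finset.univ.filter fun i : Fin (numBags n k) => v = starVertex hn0 k i a := by
    intro i hi
    obtain ⟨a, h1, h2, h3⟩ := (mem_ringBag hn i v).1 (Finset.mem_filter.1 hi).2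
    exact Finset.mem_biUnion.2 ⟨a, Finset.mem_Icc.2 ⟨h1, h2⟩,
      Finset.mem_filter.2 ⟨Finset.mem_univ _, h3⟩⟩
  refine (Finset.card_le_card hsub).trans (Finset.card_biUnion_le.trans ?_)
  -- For a fixed position the vertex determines the centre, hence the component.
  have h1 : ∀ a ∈ Finset.Icc k (3 * k), (Finset.univ.filter fun i : Fin (numBags n k) =>
      v = starVertex hn0 k i a).card ≤ 1 := by
    intro a _
    refine Finset.card_le_one.2 fun i hi j hj => ?_
    have h2 := (Finset.mem_filter.1 hi).2.symm.trans (Finset.mem_filter.1 hj).2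
    have hi' := center_lt i.isLt
    have hj' := center_lt j.isLt
    have h3 := ringVertex_injective hn0 (by omega) (by omega) h2
    have h4 : i.val * (k + 1) = j.val * (k + 1) := by omega
    exact Fin.ext (Nat.eq_of_mul_eq_mul_right (Nat.succ_pos k) h4)
  refine (Finset.sum_le_sum h1).trans ?_
  rw [Finset.sum_const, Nat.card_Icc, smul_eq_mul]
  omega

/-- Extended components of the same colour are disjoint. -/
def bagColour (n k i : ℕ) : ℕ := i % 5 + if i * (k + 1) + 4 * k < n then 0 else 5

theorem bagColour_lt (n k i : ℕ) : bagColour n k i < 10 := by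
  unfold bagColour
  split_ifs <;> omega

/-- Centres with equal residue modulo 5 are at least 5(k+1) apart, more than the length 4k of an
extended component, so overlaps can only arise around the ring. The last components, which may reach
the first ones that way, get five colours of their own; fewer than 5(k+1) numbers separate them, so
equal colours cannot occur twice there. -/
theorem ringStar_disjoint {n k : ℕ} (hn : 5 * k < n) {i j : Fin (numBags n k)} (hij : i ≠ j)
    (hc : bagColour n k i = bagColour n k j) :
    Disjoint ((ringDecomposition n k).star i) ((ringDecomposition n k).star j) := by
  wlog hlt : i.val < j.val generalizing i j
  · exact (this hij.symm hc.symm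
      (lt_of_le_of_ne (not_lt.1 hlt) fun h => hij (Fin.ext h.symm))).symm
  have hn0 : 0 < n := by omega
  refine Finset.disjoint_left.2 fun v hvi hvj => ?_
  obtain ⟨a, ha, rfl⟩ := (mem_ringStar hn i v).1 hvi
  obtain ⟨b, hb, h⟩ := (mem_ringStar hn j _).1 hvj
  have hi' := center_lt i.isLt
  have hj' := center_lt j.isLt
  have h5 : i.val + 5 ≤ j.val := by
    unfold bagColour at hc
    split_ifs at hc <;> omega
  have h6 : i.val * (k + 1) + 5 * (k + 1) ≤ j.val * (k + 1) := by
    rw [← add_mul]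
    exact Nat.mul_le_mul_right _ h5
  unfold bagColour at hc
  have hj4 : j.val * (k + 1) + 4 * k < n := by
    by_contra hcon
    rw [if_neg hcon] at hc
    split_ifs at hc <;> omega
  have := ringVertex_injective hn0 (by omega) (by omega) h
  omega

/-! ## The local estimator -/

open Classical in
/-- The number of flipped edge measurements inside the extended component number `i`. -/
noncomputable def flippedCount (n k : ℕ) (X : (ringLattice n k).edgeSet → ℤˣ) (Y : Fin n → ℤˣ)
    (i : Fin (numBags n k)) : ℕ :=
  (Finset.univ.filter fun e : (ringLattice n k).edgeSet =>
    (∀ v ∈ e.1, v ∈ (ringDecomposition n k).star i) ∧ X e ≠ edgeSign Y e.1).card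

theorem flippedCount_eq (n k : ℕ) (X : (ringLattice n k).edgeSet → ℤˣ) (Y : Fin n → ℤˣ)
    (i : Fin (numBags n k)) :
    disagreement (ringLattice n k) X ((ringDecomposition n k).star i) Y =
      flippedCount n k X Y i := by
  unfold disagreement flippedCount
  simp only [ne_comm]

/-- A sign pattern that separates two consecutive vertices of a component cuts at least
`2 * k - 1` edges of the extended component. -/
theorem card_cut_ge {n k : ℕ} (hk : 1 ≤ k) (hn : 5 * k < n) (i : Fin (numBags n k))
    (y : Fin n → ℤˣ) (a : ℕ) (ha : k ≤ a) (ha' : a < 3 * k)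
    (hne : y (starVertex (by omega) k i a) ≠ y (starVertex (by omega) k i (a + 1)))
    (δ : Finset (ringLattice n k).edgeSet)
    (hδ : ∀ e : (ringLattice n k).edgeSet, (∀ v ∈ e.1, v ∈ (ringDecomposition n k).star i) →
      edgeSign y e.1 = -1 → e ∈ δ) : 2 * k - 1 ≤ δ.card := by
  classical
  have hn0 : 0 < n := by omega
  set u : ℕ → Fin n := starVertex hn0 k i with hu
  -- The values at a and a + 1 differ, so every b is separated from at least one of the two; x b is
  -- such a partner.
  set x : ℕ → ℕ := fun b => if y (u b) ≠ y (u a) then a else a + 1 with hx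
  -- Each b in this window is within distance k of its partner. The position a is removed because b
  -- = a and b = a + 1 would both give the edge between a and a + 1.
  have hcard : ((Finset.Icc (a + 1 - k) (a + k)).erase a).card = 2 * k - 1 := by
    rw [Finset.card_erase_of_mem (Finset.mem_Icc.2 ⟨by omega, by omega⟩), Nat.card_Icc]
    omega
  rw [← hcard, ← Finset.card_image_of_injective δ
    (Subtype.val_injective (p := fun e => e ∈ (ringLattice n k).edgeSet))]
  have hxab : ∀ b, x b = a ∨ x b = a + 1 := fun b => by
    simp only [hx]; split_ifs <;> simp
  have hinj : ∀ b c, b ≤ 4 * k → c ≤ 4 * k → u b = u c → b = c := fun b c hb hc h =>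
    starVertex_injective hn i hb hc h
  have hmem : ∀ b, b ≤ 4 * k → u b ∈ (ringDecomposition n k).star i := fun b hb =>
    (mem_ringStar hn i _).2 ⟨b, hb, rfl⟩
  have hneg : ∀ s t : ℤˣ, s ≠ t → s * t = -1 := by decide
  have htri : ∀ r s t : ℤˣ, s ≠ t → r = s → r ≠ t := by decide
  refine Finset.card_le_card_of_injOn (fun b => s(u b, u (x b))) ?_ ?_
  · intro b hb
    obtain ⟨hba, hb⟩ := Finset.mem_erase.1 hb
    obtain ⟨hb1, hb2⟩ := Finset.mem_Icc.1 hb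
    have hsep : y (u b) ≠ y (u (x b)) := by
      simp only [hx]
      by_cases h : y (u b) = y (u a)
      · simp only [h, ne_eq, not_true_eq_false, if_false]
        exact hne
      · simp [h]
    have hbx : b ≠ x b := fun h => hsep (by rw [← h])
    have hadj : (ringLattice n k).Adj (u b) (u (x b)) := by
      have := hxab b
      rcases lt_or_gt_of_ne hbx with h | h
      · exact (starVertex_adj hn i h (by omega)).2 (by omega)
      · exact ((starVertex_adj hn i h (by omega)).2 (by omega)).symm
    refine Finset.mem_coe.2 (Finset.mem_image.2 ⟨⟨s(u b, u (x b)), hadj⟩, hδ _ ?_ (hneg _ _ hsep), rfl⟩)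
    intro v hv
    have := hxab b
    rcases Sym2.mem_iff.1 hv with rfl | rfl
    · exact hmem _ (by omega)
    · exact hmem _ (by omega)
  · intro b hb c hc h
    obtain ⟨hba, hb⟩ := Finset.mem_erase.1 hb
    obtain ⟨hb1, hb2⟩ := Finset.mem_Icc.1 hb
    obtain ⟨hca, hc⟩ := Finset.mem_erase.1 hc
    obtain ⟨hc1, hc2⟩ := Finset.mem_Icc.1 hc
    have h1 := hxab b
    have h2 := hxab c
    rcases Sym2.eq_iff.1 h with ⟨h3, -⟩ | ⟨h3, h4⟩
    · exact hinj b c (by omega) (by omega) h3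
    · have h5 := hinj b (x c) (by omega) (by omega) h3
      have h6 := hinj (x b) c (by omega) (by omega) h4
      omega

/-- With fewer than `k` flipped edges in the extended component, the local estimator is correct on
the component up to a global sign. -/
theorem localEstimator_correct {n k : ℕ} (hk : 1 ≤ k) (hn : 5 * k < n)
    (X : (ringLattice n k).edgeSet → ℤˣ) (Y : Fin n → ℤˣ) (i : Fin (numBags n k))
    (y : Fin n → ℤˣ)
    (hy : IsLocalEstimator (ringLattice n k) X ((ringDecomposition n k).star i) y)
    (hX : flippedCount n k X Y i < k) :
    ∃ σ : ℤˣ, ∀ v ∈ ringBag n k i, σ * y v = Y v := by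
  classical
  have hn0 : 0 < n := by omega
  set u : ℕ → Fin n := starVertex hn0 k i with hu
  have hmul : ∀ s t s' t' : ℤˣ, s * t * (s' * t') = (s * s') * (t * t') := by decide
  have hstep : ∀ a, k ≤ a → a < 3 * k →
      y (u a) * Y (u a) = y (u (a + 1)) * Y (u (a + 1)) := by
    intro a ha ha'
    by_contra hne
    set δ : Finset (ringLattice n k).edgeSet := Finset.univ.filter fun e =>
      (∀ v ∈ e.1, v ∈ (ringDecomposition n k).star i) ∧ edgeSign y e.1 ≠ edgeSign Y e.1
    have h1 := card_cut_ge hk hn i (fun v => y v * Y v) a ha ha' hne δ (fun e he he' => by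
      refine Finset.mem_filter.2 ⟨Finset.mem_univ _, he, ?_⟩
      obtain ⟨e, h⟩ := e
      induction e using Sym2.inductionOn with
      | _ b c =>
        simp only [edgeSign_mk] at he' ⊢
        rw [hmul] at he'
        generalize y b * y c = s at *
        generalize Y b * Y c = t at *
        revert s t; decide)
    have h2 := hy Y
    rw [flippedCount_eq n k X Y i] at h2
    -- An edge where `y` and `Y` have different signs is violated by `y` or has a flipped
    -- measurement. By minimality `y` violates at most as many edges as there are flips, so there
    -- are at most 2(k-1) such edges, one fewer than the cut requires.
    have h3 : δ.card ≤ disagreement (ringLattice n k) X ((ringDecomposition n k).star i) y +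
        flippedCount n k X Y i := by
      unfold disagreement flippedCount
      refine (Finset.card_le_card ?_).trans (Finset.card_union_le _ _)
      intro e he
      obtain ⟨h4, h5⟩ := (Finset.mem_filter.1 he).2
      simp only [Finset.mem_union, Finset.mem_filter, Finset.mem_univ, true_and]
      by_cases h6 : edgeSign y e.1 = X e
      · exact Or.inr ⟨h4, h6 ▸ h5⟩
      · exact Or.inl ⟨h4, h6⟩
    omega
  have hconst : ∀ d, d ≤ 2 * k → y (u (k + d)) * Y (u (k + d)) = y (u k) * Y (u k) := by
    intro d
    induction d with
    | zero => intro _; rfl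
    | succ d ih =>
      intro hd
      rw [← add_assoc, ← hstep (k + d) (by omega) (by omega)]
      exact ih (by omega)
  refine ⟨y (u k) * Y (u k), fun v hv => ?_⟩
  obtain ⟨a, h1, h2, rfl⟩ := (mem_ringBag hn i v).1 hv
  have h3 := hconst (a - k) (by omega)
  rw [show k + (a - k) = a by omega] at h3
  rw [← h3]
  have : ∀ s t : ℤˣ, s * t * s = t := by decide
  exact this _ _

/-! ## Analysis of the decoding on the path of components -/

open Classical in
/-- The components whose extended component contains at least `k` flipped edges. -/
noncomputable def badBags (n k : ℕ) (X : (ringLattice n k).edgeSet → ℤˣ) (Y : Fin n → ℤˣ) :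
    Finset (Fin (numBags n k)) :=
  Finset.univ.filter fun i => k ≤ flippedCount n k X Y i

open Classical in
/-- The components outside `B` at which the sign pattern `τ` is negative. -/
noncomputable def wrongBags {m : ℕ} (B : Finset (Fin m)) (τ : Fin m → ℤˣ) : Finset (Fin m) :=
  Finset.univ.filter fun i => i ∉ B ∧ τ i = -1

open Classical in
theorem card_pathGraph_incident_le {m : ℕ} (b : Fin m) :
    ((SimpleGraph.pathGraph m).edgeFinset.filter fun e => b ∈ e).card ≤ 2 := by
  -- A path edge at `b` is determined by whether it leads forwards or backwards.
  have hinj : Set.InjOn (fun e : Sym2 (Fin m) => if ∃ c : Fin m, b < c ∧ e = s(b, c) then 1 else 0)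
      ((SimpleGraph.pathGraph m).edgeFinset.filter fun e => b ∈ e : Finset (Sym2 (Fin m))) := by
    intro e he f hf hef
    obtain ⟨he1, c, rfl⟩ := Finset.mem_filter.1 he
    obtain ⟨hf1, d, rfl⟩ := Finset.mem_filter.1 hf
    simp only [SimpleGraph.mem_edgeFinset, SimpleGraph.mem_edgeSet,
      SimpleGraph.pathGraph_adj] at he1 hf1
    have hp : ∀ c : Fin m, (∃ c' : Fin m, b < c' ∧ s(b, c) = s(b, c')) ↔ b < c := by
      intro c
      constructor
      · rintro ⟨c', h1, h2⟩
        rw [Sym2.congr_right.1 h2]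
        exact h1
      · exact fun h => ⟨c, h, rfl⟩
    simp only [hp] at hef
    have : c = d := by
      apply Fin.ext
      simp only [Fin.lt_def] at hef
      split_ifs at hef <;> omega
    rw [this]
  have h := Finset.card_le_card_of_injOn (t := ({0, 1} : Finset ℕ)) _ (fun e _ => by
    split_ifs <;> simp) hinj
  simpa using h

theorem card_bool_filter {α : Type*} (W : Finset α) (P Q : α → Prop) [DecidablePred P]
    [DecidablePred Q] (f : α → ℤ) (h : ∀ v ∈ W, (if P v then (1 : ℤ) else 0) -
      (if Q v then 1 else 0) = f v) :
    ((W.filter P).card : ℤ) - (W.filter Q).card = ∑ v ∈ W, f v := by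
  rw [← Finset.sum_congr rfl h, Finset.sum_sub_distrib, Finset.sum_boole, Finset.sum_boole]

/-- The deterministic core: the decoded signs `s` are compared with the true relative signs `σ`, and
`τ` is their product. The true signs are feasible because only the at most two path edges at each
bad component can be violated. So `s` costs no more, and the bad components, at most 2k+1 each, are
the only ones that can compensate losses on the wrong ones. -/
theorem decoder_analysis {n k L : ℕ} (hk : 1 ≤ k) (hn : 5 * k < n)
    (X : (ringLattice n k).edgeSet → ℤˣ) (Y Z out : Fin n → ℤˣ)
    (hout : IsDecoderOutput (ringLattice n k) (ringDecomposition n k) L X Z out)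
    (hL : 2 * (badBags n k X Y).card ≤ L) :
    ∃ τ : Fin (numBags n k) → ℤˣ,
      violations (SimpleGraph.pathGraph (numBags n k)) (fun _ => 1) τ ≤
        L + 2 * (badBags n k X Y).card ∧
      hammingDist out Y ≤
        (2 * k + 1) * ((badBags n k X Y).card + (wrongBags (badBags n k X Y) τ).card) ∧
      ∑ i ∈ wrongBags (badBags n k X Y) τ, ∑ v ∈ ringBag n k i, ((Z v * Y v : ℤˣ) : ℤ) ≤
        (2 * k + 1) * (badBags n k X Y).card := by
  classical
  obtain ⟨loc, S, s, c, hloc, hS, ⟨hs1, hs2⟩, hc⟩ := hout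
  set B := badBags n k X Y with hB
  -- On a bad component the reference sign is arbitrary; the value 1 is a default.
  have hσ : ∀ i, ∃ σ : ℤˣ, i ∉ B → ∀ v ∈ ringBag n k i, σ * loc i v = Y v := by
    intro i
    by_cases hi : i ∈ B
    · exact ⟨1, fun h => absurd hi h⟩
    · have : flippedCount n k X Y i < k := by
        by_contra hcon
        exact hi (Finset.mem_filter.2 ⟨Finset.mem_univ _, not_lt.1 hcon⟩)
      obtain ⟨σ, h⟩ := localEstimator_correct hk hn X Y i (loc i) (hloc i) this
      exact ⟨σ, fun _ => h⟩
  choose σ hσ using hσ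
  have hsq : ∀ a b : ℤˣ, a * b * a = b := by decide
  have hvσ : violations (SimpleGraph.pathGraph (numBags n k)) S σ ≤ 2 * B.card := by
    have hsub : ((SimpleGraph.pathGraph (numBags n k)).edgeFinset.filter
        fun e => edgeSign σ e ≠ S e) ⊆ B.biUnion fun b =>
          (SimpleGraph.pathGraph (numBags n k)).edgeFinset.filter fun e => b ∈ e := by
      intro e he
      obtain ⟨he1, he2⟩ := Finset.mem_filter.1 he
      rw [Finset.mem_biUnion]
      by_contra hcon
      push Not at hcon
      apply he2
      induction e using Sym2.inductionOn with
      | _ i j =>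
        have hi : i ∉ B := fun h => hcon i h (Finset.mem_filter.2 ⟨he1, by simp⟩)
        have hj : j ∉ B := fun h => hcon j h (Finset.mem_filter.2 ⟨he1, by simp⟩)
        obtain ⟨v, hv1, hv2, hv3⟩ := hS i j (SimpleGraph.mem_edgeFinset.1 he1)
        rw [hv3, edgeSign_mk]
        have h1 := hσ i hi v hv1
        have h2 := hσ j hj v hv2
        revert h1 h2
        generalize σ i = a, σ j = b, loc i v = x, loc j v = z, Y v = w
        revert a b x z w
        decide
    refine (Finset.card_le_card hsub).trans (Finset.card_biUnion_le.trans ?_)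
    refine (Finset.sum_le_sum fun b _ => card_pathGraph_incident_le b).trans ?_
    rw [Finset.sum_const, smul_eq_mul, mul_comm]
  refine ⟨fun i => s i * σ i, ?_, ?_, ?_⟩
  -- Where `τ` changes sign, `s` or `σ` violates the path edge.
  · have h1 : violations (SimpleGraph.pathGraph (numBags n k)) (fun _ => 1)
        (fun i => s i * σ i) ≤ violations (SimpleGraph.pathGraph (numBags n k)) S s +
          violations (SimpleGraph.pathGraph (numBags n k)) S σ := by
      unfold violations
      refine (Finset.card_le_card ?_).trans (Finset.card_union_le _ _)
      intro e he
      obtain ⟨he1, he2⟩ := Finset.mem_filter.1 he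
      simp only [Finset.mem_union, Finset.mem_filter, he1, true_and]
      by_contra hcon
      push Not at hcon
      apply he2
      obtain ⟨h1, h2⟩ := hcon
      revert h1 h2
      generalize S e = t
      induction e using Sym2.inductionOn with
      | _ i j =>
        simp only [edgeSign_mk]
        generalize s i = a, s j = b, σ i = x, σ j = z
        revert a b x z t
        decide
    have hs1 : violations (SimpleGraph.pathGraph (numBags n k)) S s ≤ L := hs1
    omega
  · have hsub : (Finset.univ.filter fun v => out v ≠ Y v) ⊆
        (B ∪ wrongBags B fun i => s i * σ i).biUnion fun i => ringBag n k i := by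
      intro v hv
      have hv := (Finset.mem_filter.1 hv).2
      obtain ⟨h1, h2⟩ := hc v
      refine Finset.mem_biUnion.2 ⟨c v, ?_, h1⟩
      by_cases hb : c v ∈ B
      · exact Finset.mem_union_left _ hb
      · refine Finset.mem_union_right _ (Finset.mem_filter.2 ⟨Finset.mem_univ _, hb, ?_⟩)
        have h3 := hσ (c v) hb v h1
        rw [h2, ← h3] at hv
        revert hv
        simp only
        generalize s (c v) = a, σ (c v) = b, loc (c v) v = x
        revert a b x
        decide
    have h1 : hammingDist out Y = (Finset.univ.filter fun v => out v ≠ Y v).card := rfl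
    rw [h1]
    refine (Finset.card_le_card hsub).trans (Finset.card_biUnion_le.trans ?_)
    refine (Finset.sum_le_sum fun i _ => card_ringBag_le hn i).trans ?_
    rw [Finset.sum_const, smul_eq_mul, mul_comm]
    exact Nat.mul_le_mul_left _ (Finset.card_union_le _ _)
  · have hfeas := hs2 σ (hvσ.trans hL)
    set U := wrongBags B fun i => s i * σ i with hU
    -- On a wrong good component the cost difference is the sum of Z v * Y v; on a correct good one
    -- it vanishes; on a bad one it is only known to be at least -(2k+1).
    have hterm : ∀ i, (if i ∈ U then ∑ v ∈ ringBag n k i, ((Z v * Y v : ℤˣ) : ℤ) else 0) ≤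
        (bagCost (ringBag n k i) Z (loc i) (s i) : ℤ) - bagCost (ringBag n k i) Z (loc i) (σ i) +
          if i ∈ B then (2 * k + 1 : ℤ) else 0 := by
      intro i
      by_cases hiB : i ∈ B
      · have hiU : i ∉ U := fun h => (Finset.mem_filter.1 h).2.1 hiB
        rw [if_neg hiU, if_pos hiB]
        have h1 : bagCost (ringBag n k i) Z (loc i) (σ i) ≤ 2 * k + 1 :=
          (Finset.card_filter_le _ _).trans (card_ringBag_le hn i)
        have h2 : ((bagCost (ringBag n k i) Z (loc i) (σ i) : ℕ) : ℤ) ≤ 2 * k + 1 := by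
          exact_mod_cast h1
        have h3 : (0 : ℤ) ≤ bagCost (ringBag n k i) Z (loc i) (s i) := by positivity
        linarith
      · rw [if_neg hiB, add_zero]
        by_cases hiU : i ∈ U
        · rw [if_pos hiU]
          have hτ := (Finset.mem_filter.1 hiU).2.2
          have hsσ : s i = -σ i := by
            revert hτ
            simp only
            generalize s i = a, σ i = b
            revert a b
            decide
          unfold bagCost
          refine le_of_eq (card_bool_filter _ _ _ _ fun v hv => ?_).symm
          have h1 := hσ i hiB v hv
          rw [hsσ, neg_mul, h1]
          generalize Y v = a, Z v = b
          revert a b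
          decide
        · rw [if_neg hiU]
          have hsσ : s i = σ i := by
            have h1 : ¬ s i * σ i = -1 := fun h =>
              hiU (Finset.mem_filter.2 ⟨Finset.mem_univ _, hiB, h⟩)
            revert h1
            generalize s i = a, σ i = b
            revert a b
            decide
          rw [hsσ, sub_self]
    have hsum := Finset.sum_le_sum fun i (_ : i ∈ Finset.univ) => hterm i
    rw [Finset.sum_add_distrib, Finset.sum_sub_distrib, Finset.sum_ite_mem, Finset.sum_ite_mem,
      Finset.univ_inter, Finset.univ_inter, Finset.sum_const, nsmul_eq_mul] at hsum
    have hfeas' : (∑ i, (bagCost (ringBag n k i) Z (loc i) (s i) : ℤ)) ≤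
        ∑ i, (bagCost (ringBag n k i) Z (loc i) (σ i) : ℤ) := by
      exact_mod_cast hfeas
    linarith

/-! ### Counting sign patterns with few changes -/

theorem sum_choose_le_pow (m r : ℕ) : ∑ j ∈ Finset.range (r + 1), m.choose j ≤ (m + 1) ^ r := by
  induction r with
  | zero => simp
  | succ r ih =>
    rw [Finset.sum_range_succ]
    have h1 : m.choose (r + 1) ≤ m * (m + 1) ^ r := by
      refine (Nat.choose_le_pow m (r + 1)).trans ?_
      rw [pow_succ']
      exact Nat.mul_le_mul_left _ (Nat.pow_le_pow_left (Nat.le_succ m) r)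
    calc _ ≤ (m + 1) ^ r + m * (m + 1) ^ r := add_le_add ih h1
      _ = (m + 1) ^ (r + 1) := by ring

theorem pathGraph_pattern_eq {m : ℕ} (τ τ' : Fin (m + 1) → ℤˣ) (h0 : τ 0 = τ' 0)
    (h : ∀ j : Fin m, τ j.castSucc * τ j.succ = τ' j.castSucc * τ' j.succ) : τ = τ' := by
  funext i
  induction i using Fin.induction with
  | zero => exact h0
  | succ j ih =>
    have := h j
    rw [ih] at this
    exact mul_left_cancel this

open Classical in
-- A pattern is determined by its first value and the set of places where it changes, which has at
-- most r elements.
theorem card_patterns_le (m r : ℕ) :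
    (Finset.univ.filter fun τ : Fin m → ℤˣ =>
      violations (SimpleGraph.pathGraph m) (fun _ => 1) τ ≤ r).card ≤ 2 * (m + 1) ^ r := by
  rcases m with _ | m
  · refine (Finset.card_le_univ _).trans ?_
    simp
  have hle : ∀ τ : Fin (m + 1) → ℤˣ,
      (Finset.univ.filter fun j : Fin m => τ j.castSucc * τ j.succ ≠ 1).card ≤
        violations (SimpleGraph.pathGraph (m + 1)) (fun _ => 1) τ := by
    intro τ
    refine Finset.card_le_card_of_injOn (fun j => s(j.castSucc, j.succ)) ?_ ?_
    · intro j hj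
      have hj := (Finset.mem_filter.1 hj).2
      refine Finset.mem_coe.2 (Finset.mem_filter.2 ⟨?_, hj⟩)
      simp [SimpleGraph.pathGraph_adj]
    · intro i _ j _ h
      rcases Sym2.eq_iff.1 h with ⟨h1, -⟩ | ⟨h1, h2⟩
      · exact Fin.castSucc_injective m h1
      · have h1 := congrArg Fin.val h1
        have h2 := congrArg Fin.val h2
        simp at h1 h2
        omega
  have hcard : ((Finset.univ : Finset ℤˣ) ×ˢ
      ((Finset.univ : Finset (Finset (Fin m))).filter fun t => t.card ≤ r)).card ≤
        2 * (m + 1 + 1) ^ r := by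
    rw [Finset.card_product]
    refine Nat.mul_le_mul (by decide) ?_
    have h1 : ((Finset.univ : Finset (Finset (Fin m))).filter fun t => t.card ≤ r) ⊆
        (Finset.range (r + 1)).biUnion fun j => Finset.univ.powersetCard j := by
      intro t ht
      have ht := (Finset.mem_filter.1 ht).2
      exact Finset.mem_biUnion.2 ⟨t.card, Finset.mem_range.2 (by omega),
        Finset.mem_powersetCard.2 ⟨Finset.subset_univ _, rfl⟩⟩
    refine (Finset.card_le_card h1).trans (Finset.card_biUnion_le.trans ?_)
    simp only [Finset.card_powersetCard, Finset.card_univ, Fintype.card_fin]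
    exact (sum_choose_le_pow m r).trans (Nat.pow_le_pow_left (Nat.le_succ _) r)
  refine le_trans ?_ hcard
  refine Finset.card_le_card_of_injOn
    (fun τ => (τ 0, Finset.univ.filter fun j : Fin m => τ j.castSucc * τ j.succ ≠ 1)) ?_ ?_
  · intro τ hτ
    have hτ := (Finset.mem_filter.1 hτ).2
    refine Finset.mem_coe.2 (Finset.mem_product.2 ⟨Finset.mem_univ _,
      Finset.mem_filter.2 ⟨Finset.mem_univ _, (hle τ).trans hτ⟩⟩)
  · intro τ _ τ' _ h
    obtain ⟨h1, h2⟩ := Prod.mk.inj h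
    refine pathGraph_pattern_eq τ τ' h1 fun j => ?_
    have h3 := congrArg (fun t => j ∈ t) h2
    simp only [Finset.mem_filter, Finset.mem_univ, true_and, eq_iff_iff] at h3
    revert h3
    generalize τ j.castSucc * τ j.succ = a, τ' j.castSucc * τ' j.succ = b
    revert a b
    decide

theorem pattern_const_of_no_change {m : ℕ} (τ : Fin m → ℤˣ)
    (h : violations (SimpleGraph.pathGraph m) (fun _ => 1) τ = 0) (i j : Fin m) : τ i = τ j := by
  classical
  rcases m with _ | m
  · exact i.elim0
  have h1 : ∀ a : Fin m, τ a.castSucc * τ a.succ = 1 := by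
    intro a
    by_contra hne
    have : s(a.castSucc, a.succ) ∈ (SimpleGraph.pathGraph (m + 1)).edgeFinset.filter
        fun e => edgeSign τ e ≠ (fun _ => (1 : ℤˣ)) e :=
      Finset.mem_filter.2 ⟨by simp [SimpleGraph.pathGraph_adj], hne⟩
    unfold violations at h
    rw [Finset.card_eq_zero] at h
    rw [h] at this
    exact absurd this (Finset.notMem_empty _)
  have h2 := pathGraph_pattern_eq τ (fun _ => τ 0) rfl fun a => by
    rw [h1 a]
    generalize τ 0 = b
    revert b
    decide
  rw [h2]

/-! ## Failure probability of the decoder -/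

/-- Bounding each exponential by its linear part plus x², the left side is at most 1 - (1-2q)x + x².
For x up to (1-2q)/2 the square consumes at most half of the linear gain. -/
theorem two_point_exp_le {q x : ℝ} (hq0 : 0 ≤ q) (hq1 : q ≤ 1 / 2) (hx0 : 0 ≤ x)
    (hx : x ≤ (1 - 2 * q) / 2) :
    (1 - q) * Real.exp (-x) + q * Real.exp x ≤ Real.exp (-((1 - 2 * q) / 2 * x)) := by
  have hx1 : |x| ≤ 1 := by rw [abs_of_nonneg hx0]; linarith
  have h1 := (abs_le.1 (Real.abs_exp_sub_one_sub_id_le hx1)).2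
  have h2 := (abs_le.1 (Real.abs_exp_sub_one_sub_id_le (x := -x) (by rwa [abs_neg]))).2
  have h3 := Real.add_one_le_exp (-((1 - 2 * q) / 2 * x))
  nlinarith

/-- Exponential moment of the agreement of the vertex measurements with the ground truth, summed
over a set of components. -/
theorem sum_noiseWeight_exp_agreement {n k : ℕ} (hn : 5 * k < n) (Y : Fin n → ℤˣ) {q t : ℝ}
    (hq0 : 0 ≤ q) (hq1 : q ≤ 1 / 2) (ht0 : 0 ≤ t) (ht : t * (2 * k + 1) ≤ (1 - 2 * q) / 2)
    (U : Finset (Fin (numBags n k))) :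
    ∑ Z, noiseWeight Y q Z *
        Real.exp (-(t * ((∑ i ∈ U, ∑ v ∈ ringBag n k i, ((Z v * Y v : ℤˣ) : ℤ) : ℤ) : ℝ))) ≤
      Real.exp (-((1 - 2 * q) / 2 * t * U.card)) := by
  classical
  -- Components overlap, so a vertex enters with a multiplicity. It is at most 2k+1, which keeps t *
  -- mult v in the range of `two_point_exp_le`.
  set mult : Fin n → ℕ := fun v => (U.filter fun i => v ∈ ringBag n k i).card with hmult
  have hswap : ∀ f : Fin n → ℝ, ∑ i ∈ U, ∑ v ∈ ringBag n k i, f v = ∑ v, mult v * f v := by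
    intro f
    have h1 : ∀ i, ∑ v ∈ ringBag n k i, f v = ∑ v, if v ∈ ringBag n k i then f v else 0 :=
      fun i => by rw [Finset.sum_ite_mem, Finset.univ_inter]
    simp only [h1]
    rw [Finset.sum_comm]
    refine Finset.sum_congr rfl fun v _ => ?_
    rw [← Finset.sum_filter, Finset.sum_const, nsmul_eq_mul]
  have hprod : ∀ Z : Fin n → ℤˣ, Real.exp (-(t * ((∑ i ∈ U, ∑ v ∈ ringBag n k i,
      ((Z v * Y v : ℤˣ) : ℤ) : ℤ) : ℝ))) =
        ∏ v, Real.exp (-(t * (mult v * (((Z v * Y v : ℤˣ) : ℤ) : ℝ)))) := by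
    intro Z
    push_cast
    have := hswap fun v => (((Z v : ℤˣ) : ℤ) : ℝ) * (((Y v : ℤˣ) : ℤ) : ℝ)
    rw [this, ← Real.exp_sum, Finset.mul_sum, Finset.sum_neg_distrib]
  simp only [hprod]
  rw [sum_noiseWeight_mul_prod Y q
    (fun v s => Real.exp (-(t * (mult v * (((s * Y v : ℤˣ) : ℤ) : ℝ)))))]
  -- Each component of `U` contributes at least one to the total multiplicity, since it is
  -- non-empty.
  have hcard : (U.card : ℝ) ≤ ∑ v, (mult v : ℝ) := by
    have h1 := hswap fun _ => 1
    simp only [Finset.sum_const, nsmul_eq_mul, mul_one] at h1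
    rw [← h1]
    calc (U.card : ℝ) = ∑ _i ∈ U, (1 : ℝ) := by simp
      _ ≤ _ := Finset.sum_le_sum fun i _ => by
        exact_mod_cast (ringBag_nonempty hn i).card_pos
  have hfac : ∀ v, (1 - q) * Real.exp (-(t * (mult v * (((Y v * Y v : ℤˣ) : ℤ) : ℝ)))) +
      q * Real.exp (-(t * (mult v * (((-Y v * Y v : ℤˣ) : ℤ) : ℝ)))) ≤
        Real.exp (-((1 - 2 * q) / 2 * (t * mult v))) := by
    intro v
    have h1 : Y v * Y v = 1 := Int.units_mul_self _
    have h2 : -Y v * Y v = -1 := by rw [neg_mul, h1]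
    rw [h1, h2]
    have hm : (mult v : ℝ) ≤ 2 * k + 1 := by
      have : mult v ≤ 2 * k + 1 :=
        (Finset.card_le_card (Finset.filter_subset_filter _ (Finset.subset_univ U))).trans
          (card_bags_le hn v)
      exact_mod_cast this
    have h3 := two_point_exp_le hq0 hq1 (x := t * mult v) (by positivity)
      ((mul_le_mul_of_nonneg_left hm ht0).trans ht)
    simpa using h3
  refine (Finset.prod_le_prod (fun v _ => ?_) fun v _ => hfac v).trans ?_
  · have : 0 ≤ 1 - q := by linarith
    positivity
  · rw [← Real.exp_sum]
    refine Real.exp_le_exp.2 ?_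
    rw [Finset.sum_neg_distrib, ← Finset.mul_sum, ← Finset.mul_sum]
    have h4 : 0 ≤ (1 - 2 * q) / 2 * t := mul_nonneg (by linarith) ht0
    nlinarith

open Classical in
-- A union bound over the patterns with few changes, with an exponential Markov bound for each. The
-- set `B` is fixed here, which is legitimate because the bad components depend on the edge
-- measurements only.
theorem sum_noiseWeight_bad_pattern {n k : ℕ} (hn : 5 * k < n) (Y : Fin n → ℤˣ) {q t : ℝ}
    (hq0 : 0 ≤ q) (hq1 : q ≤ 1 / 2) (ht0 : 0 ≤ t) (ht : t * (2 * k + 1) ≤ (1 - 2 * q) / 2)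
    (B : Finset (Fin (numBags n k))) (r : ℕ) (w a : ℝ) :
    ∑ Z, noiseWeight Y q Z * (if ∃ τ : Fin (numBags n k) → ℤˣ,
        violations (SimpleGraph.pathGraph (numBags n k)) (fun _ => 1) τ ≤ r ∧
        w ≤ (wrongBags B τ).card ∧
        ((∑ i ∈ wrongBags B τ, ∑ v ∈ ringBag n k i, ((Z v * Y v : ℤˣ) : ℤ) : ℤ) : ℝ) ≤ a
        then 1 else 0) ≤
      2 * (numBags n k + 1) ^ r * Real.exp (t * a - (1 - 2 * q) / 2 * t * w) := by
  set P : Finset (Fin (numBags n k) → ℤˣ) := Finset.univ.filter fun τ =>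
    violations (SimpleGraph.pathGraph (numBags n k)) (fun _ => 1) τ ≤ r ∧
      w ≤ (wrongBags B τ).card with hP
  set F : (Fin (numBags n k) → ℤˣ) → (Fin n → ℤˣ) → ℝ := fun τ Z =>
    ((∑ i ∈ wrongBags B τ, ∑ v ∈ ringBag n k i, ((Z v * Y v : ℤˣ) : ℤ) : ℤ) : ℝ) with hF
  have hcardP : (P.card : ℝ) ≤ 2 * (numBags n k + 1) ^ r := by
    have h1 : P.card ≤ 2 * (numBags n k + 1) ^ r :=
      (Finset.card_le_card fun τ hτ => Finset.mem_filter.2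
        ⟨Finset.mem_univ _, (Finset.mem_filter.1 hτ).2.1⟩).trans (card_patterns_le _ r)
    exact_mod_cast h1
  have hind : ∀ Z : Fin n → ℤˣ, (if ∃ τ : Fin (numBags n k) → ℤˣ,
        violations (SimpleGraph.pathGraph (numBags n k)) (fun _ => 1) τ ≤ r ∧
        w ≤ (wrongBags B τ).card ∧ F τ Z ≤ a then (1 : ℝ) else 0) ≤
      ∑ τ ∈ P, Real.exp (t * a) * Real.exp (-(t * F τ Z)) := by
    intro Z
    split_ifs with h
    · obtain ⟨τ, h1, h2, h3⟩ := h
      refine le_trans ?_ (Finset.single_le_sum (fun τ _ => by positivity)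
        (Finset.mem_filter.2 ⟨Finset.mem_univ τ, h1, h2⟩))
      rw [← Real.exp_add]
      refine Real.one_le_exp ?_
      nlinarith
    · exact Finset.sum_nonneg fun τ _ => by positivity
  calc _ ≤ ∑ Z, noiseWeight Y q Z * ∑ τ ∈ P, Real.exp (t * a) * Real.exp (-(t * F τ Z)) :=
        Finset.sum_le_sum fun Z _ => mul_le_mul_of_nonneg_left (hind Z)
          (noiseWeight_nonneg Y hq0 (by linarith) Z)
    _ = ∑ τ ∈ P, Real.exp (t * a) * ∑ Z, noiseWeight Y q Z * Real.exp (-(t * F τ Z)) := by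
        simp only [Finset.mul_sum]
        rw [Finset.sum_comm]
        refine Finset.sum_congr rfl fun τ _ => Finset.sum_congr rfl fun Z _ => ?_
        ring
    _ ≤ ∑ τ ∈ P, Real.exp (t * a - (1 - 2 * q) / 2 * t * w) := by
        refine Finset.sum_le_sum fun τ hτ => ?_
        rw [sub_eq_add_neg, Real.exp_add]
        refine mul_le_mul_of_nonneg_left ?_ (Real.exp_pos _).le
        refine (sum_noiseWeight_exp_agreement hn Y hq0 hq1 ht0 ht _).trans
          (Real.exp_le_exp.2 (neg_le_neg ?_))
        exact mul_le_mul_of_nonneg_left (Finset.mem_filter.1 hτ).2.2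
          (mul_nonneg (by linarith) ht0)
    _ = P.card * Real.exp (t * a - (1 - 2 * q) / 2 * t * w) := by
        rw [Finset.sum_const, nsmul_eq_mul]
    _ ≤ _ := mul_le_mul_of_nonneg_right hcardP (Real.exp_pos _).le

/-! ### The number of bad components -/

/-- A bound for the number of edges of an extended component. -/
def starEdgeBound (k : ℕ) : ℕ := (4 * k + 2).choose 2

theorem numBags_le {n : ℕ} (k : ℕ) (hn : 0 < n) : numBags n k ≤ n := by
  refine Nat.div_le_of_le_mul ?_
  nlinarith

open Classical in
-- The noise law lives on the edges of `G`; this form makes the flips of one extended component a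
-- block of coordinates of that law.
theorem flippedCount_discard {n k : ℕ} {G : SimpleGraph (Fin n)} (hG : ringLattice n k ≤ G)
    (X : G.edgeSet → ℤˣ) (Y : Fin n → ℤˣ) (i : Fin (numBags n k)) :
    flippedCount n k (discard (ringLattice n k) G X) Y i =
      ((Finset.univ.filter fun e : G.edgeSet => e.1 ∈ (ringLattice n k).edgeSet ∧
        ∀ v ∈ e.1, v ∈ (ringDecomposition n k).star i).filter
          fun e => X e ≠ edgeSign Y e.1).card := by
  unfold flippedCount
  refine Finset.card_bij (fun e _ => ⟨e.1, SimpleGraph.edgeSet_mono hG e.2⟩) ?_ ?_ ?_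
  · intro e he
    obtain ⟨h1, h2⟩ := (Finset.mem_filter.1 he).2
    rw [discard, dif_pos (SimpleGraph.edgeSet_mono hG e.2)] at h2
    exact Finset.mem_filter.2 ⟨Finset.mem_filter.2 ⟨Finset.mem_univ _, e.2, h1⟩, h2⟩
  · intro e _ f _ h
    exact Subtype.ext (congrArg (fun x : G.edgeSet => x.1) h)
  · intro e he
    obtain ⟨h1, h2⟩ := Finset.mem_filter.1 he
    obtain ⟨-, h3, h4⟩ := Finset.mem_filter.1 h1
    refine ⟨⟨e.1, h3⟩, Finset.mem_filter.2 ⟨Finset.mem_univ _, h4, ?_⟩, rfl⟩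
    rw [discard, dif_pos (SimpleGraph.edgeSet_mono hG h3)]
    exact h2

open Classical in
-- More than 10b bad components put more than b of them into one of the ten colour classes, where
-- the blocks are disjoint. Markov's inequality is applied to 2^N - 1 instead of 2^N, so that the
-- bound tends to 0 with p^k n even for b = 0.
theorem sum_noiseWeight_many_bad {n k : ℕ} (hk : 1 ≤ k) (hn : 5 * k < n)
    {G : SimpleGraph (Fin n)} (hG : ringLattice n k ≤ G) (Y : Fin n → ℤˣ) {p : ℝ}
    (hp0 : 0 ≤ p) (hp1 : p ≤ 1) (b : ℕ) :
    ∑ X : G.edgeSet → ℤˣ, noiseWeight (fun e : G.edgeSet => edgeSign Y e.1) p X *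
        (if 10 * b < (badBags n k (discard (ringLattice n k) G X) Y).card then 1 else 0) ≤
      10 * (Real.exp (2 ^ starEdgeBound k * (p ^ k * n)) - 1) / 2 ^ b := by
  set E : Fin (numBags n k) → Finset G.edgeSet := fun i => Finset.univ.filter fun e =>
    e.1 ∈ (ringLattice n k).edgeSet ∧ ∀ v ∈ e.1, v ∈ (ringDecomposition n k).star i with hE
  set I : ℕ → Finset (Fin (numBags n k)) := fun c =>
    Finset.univ.filter fun i => bagColour n k i = c with hI
  set W : (G.edgeSet → ℤˣ) → ℝ := noiseWeight (fun e : G.edgeSet => edgeSign Y e.1) p with hW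
  set N : ℕ → (G.edgeSet → ℤˣ) → ℕ := fun c X =>
    ((I c).filter fun i => k ≤ ((E i).filter fun e => X e ≠ edgeSign Y e.1).card).card with hN
  have hW0 : ∀ X, 0 ≤ W X := noiseWeight_nonneg _ hp0 hp1
  have hmom : ∀ c, ∑ X, W X * (2 : ℝ) ^ N c X ≤
      Real.exp (2 ^ starEdgeBound k * (p ^ k * n)) := by
    intro c
    refine (sum_noiseWeight_two_pow_blocks (fun e : G.edgeSet => edgeSign Y e.1) hp0 hp1 k
      (starEdgeBound k) E (I c) ?_ ?_).trans ?_
    · intro i hi j hj hij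
      have hd := ringStar_disjoint hn hij
        ((Finset.mem_filter.1 hi).2.trans (Finset.mem_filter.1 hj).2.symm)
      refine Finset.disjoint_left.2 fun e hei hej => ?_
      obtain ⟨e, he⟩ := e
      induction e using Sym2.inductionOn with
      | _ u v =>
        exact Finset.disjoint_left.1 hd ((Finset.mem_filter.1 hei).2.2 u (by simp))
          ((Finset.mem_filter.1 hej).2.2 u (by simp))
    · intro i _
      rw [← Finset.card_image_of_injective (E i)
        (Subtype.val_injective (p := fun e => e ∈ G.edgeSet))]
      have hsub : (E i).image Subtype.val ⊆ ((ringDecomposition n k).star i).sym2 := by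
        intro e he
        obtain ⟨e', he', rfl⟩ := Finset.mem_image.1 he
        exact Finset.mem_sym2_iff.2 (Finset.mem_filter.1 he').2.2
      refine (Finset.card_le_card hsub).trans ?_
      rw [Finset.card_sym2]
      exact Nat.choose_le_choose 2 (Nat.succ_le_succ (card_ringStar_le hn i))
    · have hx : 0 ≤ 2 ^ starEdgeBound k * p ^ k := by positivity
      have hcard : ((I c).card : ℝ) ≤ n := by
        have : (I c).card ≤ n := (Finset.card_le_univ _).trans (by
          rw [Fintype.card_fin]; exact numBags_le k (by omega))
        exact_mod_cast this
      calc (1 + 2 ^ starEdgeBound k * p ^ k) ^ (I c).card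
          ≤ Real.exp (2 ^ starEdgeBound k * p ^ k) ^ (I c).card := by
            refine pow_le_pow_left₀ (by linarith) ?_ _
            linarith [Real.add_one_le_exp (2 ^ starEdgeBound k * p ^ k)]
        _ = Real.exp ((I c).card * (2 ^ starEdgeBound k * p ^ k)) := by rw [Real.exp_nat_mul]
        _ ≤ _ := by
            refine Real.exp_le_exp.2 ?_
            nlinarith
  have hone : ∑ X, W X = 1 := sum_noiseWeight _ p
  have hcover : ∀ X : G.edgeSet → ℤˣ,
      (badBags n k (discard (ringLattice n k) G X) Y).card ≤ ∑ c ∈ Finset.range 10, N c X := by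
    intro X
    refine (Finset.card_le_card ?_).trans Finset.card_biUnion_le
    intro i hi
    have hi := (Finset.mem_filter.1 hi).2
    rw [flippedCount_discard hG] at hi
    exact Finset.mem_biUnion.2 ⟨bagColour n k i, Finset.mem_range.2 (bagColour_lt n k i),
      Finset.mem_filter.2 ⟨Finset.mem_filter.2 ⟨Finset.mem_univ _, rfl⟩, hi⟩⟩
  have hind : ∀ X : G.edgeSet → ℤˣ,
      (if 10 * b < (badBags n k (discard (ringLattice n k) G X) Y).card then (1 : ℝ) else 0) ≤
        (∑ c ∈ Finset.range 10, ((2 : ℝ) ^ N c X - 1)) / 2 ^ b := by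
    intro X
    have hnn : ∀ c ∈ Finset.range 10, (0 : ℝ) ≤ (2 : ℝ) ^ N c X - 1 := fun c _ => by
      have : (1 : ℝ) ≤ 2 ^ N c X := one_le_pow₀ (by norm_num)
      linarith
    split_ifs with h
    · have h1 : ∃ c ∈ Finset.range 10, b + 1 ≤ N c X := by
        by_contra hcon
        push Not at hcon
        have h2 := Finset.sum_le_sum fun c hc => Nat.le_of_lt_succ (hcon c hc)
        rw [Finset.sum_const, Finset.card_range, smul_eq_mul] at h2
        have := hcover X
        omega
      obtain ⟨c, hc, h2⟩ := h1
      -- More than b bad components of one colour suffice: 2^(b+1) - 1 is at least 2^b.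
      rw [le_div_iff₀ (by positivity), one_mul]
      refine le_trans ?_ (Finset.single_le_sum hnn hc)
      have h3 : (2 : ℝ) ^ (b + 1) ≤ 2 ^ N c X := pow_le_pow_right₀ (by norm_num) h2
      have h4 : (1 : ℝ) ≤ 2 ^ b := one_le_pow₀ (by norm_num)
      rw [pow_succ] at h3
      linarith
    · exact div_nonneg (Finset.sum_nonneg hnn) (by positivity)
  calc _ ≤ ∑ X, W X * ((∑ c ∈ Finset.range 10, ((2 : ℝ) ^ N c X - 1)) / 2 ^ b) :=
        Finset.sum_le_sum fun X _ => mul_le_mul_of_nonneg_left (hind X) (hW0 X)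
    _ = (∑ c ∈ Finset.range 10, (∑ X, W X * (2 : ℝ) ^ N c X - ∑ X, W X)) / 2 ^ b := by
        simp only [← mul_div_assoc, ← Finset.sum_div, Finset.mul_sum]
        rw [Finset.sum_comm]
        congr 1
        refine Finset.sum_congr rfl fun c _ => ?_
        rw [← Finset.sum_sub_distrib]
        exact Finset.sum_congr rfl fun X _ => by ring
    _ ≤ _ := by
        refine div_le_div_of_nonneg_right ?_ (by positivity)
        refine (Finset.sum_le_sum fun c _ => sub_le_sub_right (hmom c) _).trans ?_
        rw [hone, Finset.sum_const, Finset.card_range, nsmul_eq_mul]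
        norm_num

open Classical in
/-- An event whose failure forces many bad components or an improbable sign pattern. -/
theorem le_obsProb_of_pattern {n k : ℕ} (hk : 1 ≤ k) (hn : 5 * k < n)
    {G : SimpleGraph (Fin n)} (hG : ringLattice n k ≤ G) (Y : Fin n → ℤˣ) {p q t : ℝ}
    (hp0 : 0 ≤ p) (hp1 : p ≤ 1) (hq0 : 0 ≤ q) (hq1 : q ≤ 1 / 2) (ht0 : 0 ≤ t)
    (ht : t * (2 * k + 1) ≤ (1 - 2 * q) / 2) (b r : ℕ) (w a : ℝ)
    (A : (G.edgeSet → ℤˣ) → (Fin n → ℤˣ) → Prop)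
    (hA : ∀ X Z, (badBags n k (discard (ringLattice n k) G X) Y).card ≤ 10 * b → ¬ A X Z →
      ∃ τ : Fin (numBags n k) → ℤˣ,
        violations (SimpleGraph.pathGraph (numBags n k)) (fun _ => 1) τ ≤ r ∧
        w ≤ (wrongBags (badBags n k (discard (ringLattice n k) G X) Y) τ).card ∧
        ((∑ i ∈ wrongBags (badBags n k (discard (ringLattice n k) G X) Y) τ,
          ∑ v ∈ ringBag n k i, ((Z v * Y v : ℤˣ) : ℤ) : ℤ) : ℝ) ≤ a) :
    1 - 10 * (Real.exp (2 ^ starEdgeBound k * (p ^ k * n)) - 1) / 2 ^ b -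
      2 * (numBags n k + 1) ^ r * Real.exp (t * a - (1 - 2 * q) / 2 * t * w) ≤
        obsProb G Y p q A := by
  set WX : (G.edgeSet → ℤˣ) → ℝ := noiseWeight (fun e : G.edgeSet => edgeSign Y e.1) p with hWX
  set WZ : (Fin n → ℤˣ) → ℝ := noiseWeight Y q with hWZ
  have hX0 : ∀ X, 0 ≤ WX X := noiseWeight_nonneg _ hp0 hp1
  have hZ0 : ∀ Z, 0 ≤ WZ Z := noiseWeight_nonneg _ hq0 (by linarith)
  have hX1 : ∑ X, WX X = 1 := sum_noiseWeight _ p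
  have hZ1 : ∑ Z, WZ Z = 1 := sum_noiseWeight _ q
  set f : (G.edgeSet → ℤˣ) → ℝ := fun X =>
    if 10 * b < (badBags n k (discard (ringLattice n k) G X) Y).card then 1 else 0 with hf
  set g : (G.edgeSet → ℤˣ) → (Fin n → ℤˣ) → ℝ := fun X Z =>
    if ∃ τ : Fin (numBags n k) → ℤˣ,
        violations (SimpleGraph.pathGraph (numBags n k)) (fun _ => 1) τ ≤ r ∧
        w ≤ (wrongBags (badBags n k (discard (ringLattice n k) G X) Y) τ).card ∧
        ((∑ i ∈ wrongBags (badBags n k (discard (ringLattice n k) G X) Y) τ,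
          ∑ v ∈ ringBag n k i, ((Z v * Y v : ℤˣ) : ℤ) : ℤ) : ℝ) ≤ a then 1 else 0 with hg
  -- Pointwise, 1 is at most the indicator of `A` plus those of the two failures.
  have hpt : ∀ X Z, WX X * WZ Z ≤ (if A X Z then obsWeight G Y p q X Z else 0) +
      (WX X * f X * WZ Z + WX X * (WZ Z * g X Z)) := by
    intro X Z
    rw [obsWeight_eq_noiseWeight]
    have h0 : 0 ≤ WX X * WZ Z := mul_nonneg (hX0 X) (hZ0 Z)
    have hf0 : 0 ≤ f X := by simp only [hf]; split_ifs <;> norm_num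
    have hg0 : 0 ≤ g X Z := by simp only [hg]; split_ifs <;> norm_num
    have e1 : WX X * f X * WZ Z = WX X * WZ Z * f X := by ring
    have e2 : WX X * (WZ Z * g X Z) = WX X * WZ Z * g X Z := by ring
    rw [e1, e2]
    by_cases h : A X Z
    · rw [if_pos h]
      nlinarith [mul_nonneg h0 hf0, mul_nonneg h0 hg0]
    · rw [if_neg h]
      by_cases hb : 10 * b < (badBags n k (discard (ringLattice n k) G X) Y).card
      · have : f X = 1 := if_pos hb
        rw [this]
        nlinarith [mul_nonneg h0 hg0]
      · have : g X Z = 1 := if_pos (hA X Z (not_lt.1 hb) h)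
        rw [this]
        nlinarith [mul_nonneg h0 hf0]
  have hsum := Finset.sum_le_sum fun X (_ : X ∈ Finset.univ) =>
    Finset.sum_le_sum fun Z (_ : Z ∈ Finset.univ) => hpt X Z
  simp only [Finset.sum_add_distrib, ← Finset.mul_sum] at hsum
  rw [hZ1] at hsum
  simp only [mul_one] at hsum
  rw [hX1] at hsum
  have h1 : ∑ X, WX X * f X ≤ 10 * (Real.exp (2 ^ starEdgeBound k * (p ^ k * n)) - 1) / 2 ^ b :=
    sum_noiseWeight_many_bad hk hn hG Y hp0 hp1 b
  -- The inner bound is uniform in the set of bad components, so it can be applied for each `X` and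
  -- then averaged.
  have h2 : ∑ X, WX X * ∑ Z, WZ Z * g X Z ≤
      2 * (numBags n k + 1) ^ r * Real.exp (t * a - (1 - 2 * q) / 2 * t * w) := by
    calc _ ≤ ∑ X, WX X *
          (2 * (numBags n k + 1) ^ r * Real.exp (t * a - (1 - 2 * q) / 2 * t * w)) :=
          Finset.sum_le_sum fun X _ => mul_le_mul_of_nonneg_left
            (sum_noiseWeight_bad_pattern hn Y hq0 hq1 ht0 ht _ r w a) (hX0 X)
      _ = _ := by rw [← Finset.sum_mul, hX1, one_mul]
  have h3 : obsProb G Y p q A =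
      ∑ X, ∑ Z, if A X Z then obsWeight G Y p q X Z else 0 := by
    unfold obsProb
    congr!
  rw [h3]
  linarith

/-! ### Error bounds -/

/-- With b = L/20 there are at most L/2 bad components, so the true signs fit the budget, and L plus
twice their number is at most 2L sign changes. -/
theorem le_obsProb_error {n k : ℕ} (hk : 1 ≤ k) (hn : 5 * k < n)
    {G : SimpleGraph (Fin n)} (hG : ringLattice n k ≤ G) (Y : Fin n → ℤˣ) {p q t : ℝ}
    (hp0 : 0 ≤ p) (hp1 : p ≤ 1) (hq0 : 0 ≤ q) (hq1 : q ≤ 1 / 2) (ht0 : 0 ≤ t)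
    (ht : t * (2 * k + 1) ≤ (1 - 2 * q) / 2) (L : ℕ) (w : ℝ) :
    1 - 10 * (Real.exp (2 ^ starEdgeBound k * (p ^ k * n)) - 1) / 2 ^ (L / 20) -
      2 * (numBags n k + 1) ^ (2 * L) *
        Real.exp (t * ((2 * k + 1) * L) - (1 - 2 * q) / 2 * t * w) ≤
        obsProb G Y p q fun X Z => ∀ out, IsRingDecoderOutput n k L G X Z out →
          (hammingDist out Y : ℝ) ≤ (2 * k + 1) * (L + w) := by
  refine le_obsProb_of_pattern hk hn hG Y hp0 hp1 hq0 hq1 ht0 ht _ _ _ _ _ fun X Z hb hA => ?_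
  push Not at hA
  obtain ⟨out, hout, herr⟩ := hA
  set B := badBags n k (discard (ringLattice n k) G X) Y with hB
  have hBL : 2 * B.card ≤ L := by omega
  obtain ⟨τ, h1, h2, h3⟩ := decoder_analysis hk hn _ Y Z out hout hBL
  rw [← hB] at h1 h2 h3
  have hBL' : (B.card : ℝ) ≤ L := by
    have : B.card ≤ L := by omega
    exact_mod_cast this
  refine ⟨τ, h1.trans (by omega), ?_, ?_⟩
  · have h2' : (hammingDist out Y : ℝ) ≤ (2 * k + 1) * (B.card + (wrongBags B τ).card) := by
      exact_mod_cast h2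
    have hlt := lt_of_lt_of_le herr h2'
    have := lt_of_mul_lt_mul_left hlt (by positivity)
    linarith
  · have h3' : ((∑ i ∈ wrongBags B τ, ∑ v ∈ ringBag n k i, ((Z v * Y v : ℤˣ) : ℤ) : ℤ) : ℝ) ≤
        (2 * k + 1) * B.card := by
      exact_mod_cast h3
    exact h3'.trans (mul_le_mul_of_nonneg_left hBL' (by positivity))

/-- Without bad components and with budget 0 the pattern cannot change sign. So any error means that
the sign is wrong on all components simultaneously, an event exponentially unlikely in their number.
-/
theorem le_obsProb_exact {n k : ℕ} (hk : 1 ≤ k) (hn : 5 * k < n)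
    {G : SimpleGraph (Fin n)} (hG : ringLattice n k ≤ G) (Y : Fin n → ℤˣ) {p q t : ℝ}
    (hp0 : 0 ≤ p) (hp1 : p ≤ 1) (hq0 : 0 ≤ q) (hq1 : q ≤ 1 / 2) (ht0 : 0 ≤ t)
    (ht : t * (2 * k + 1) ≤ (1 - 2 * q) / 2) :
    1 - 10 * (Real.exp (2 ^ starEdgeBound k * (p ^ k * n)) - 1) -
      2 * Real.exp (-((1 - 2 * q) / 2 * t * numBags n k)) ≤
        obsProb G Y p q fun X Z => ∀ out, IsRingDecoderOutput n k 0 G X Z out →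
          hammingDist out Y = 0 := by
  have h := le_obsProb_of_pattern hk hn hG Y hp0 hp1 hq0 hq1 ht0 ht 0 0 (numBags n k) 0
    (fun X Z => ∀ out, IsRingDecoderOutput n k 0 G X Z out → hammingDist out Y = 0)
    fun X Z hb hA => ?_
  · simpa using h
  push Not at hA
  obtain ⟨out, hout, herr⟩ := hA
  set B := badBags n k (discard (ringLattice n k) G X) Y with hB
  have hB0 : B.card = 0 := by omega
  obtain ⟨τ, h1, h2, h3⟩ := decoder_analysis hk hn _ Y Z out hout
    (show 2 * B.card ≤ 0 by omega)
  rw [← hB, hB0] at h1 h2 h3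
  refine ⟨τ, h1, ?_, by exact_mod_cast h3⟩
  have hpos : 0 < (wrongBags B τ).card := by
    by_contra hcon
    rw [Nat.eq_zero_of_not_pos hcon] at h2
    omega
  obtain ⟨i, hi⟩ := Finset.card_pos.1 hpos
  have hτ := (Finset.mem_filter.1 hi).2.2
  have huniv : wrongBags B τ = Finset.univ := by
    refine Finset.eq_univ_iff_forall.2 fun j => Finset.mem_filter.2 ⟨Finset.mem_univ _, ?_, ?_⟩
    · rw [Finset.card_eq_zero.1 hB0]
      exact Finset.notMem_empty _
    · rw [pattern_const_of_no_change τ (by simpa using h1) j i, hτ]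
  rw [huniv, Finset.card_univ, Fintype.card_fin]

theorem obsProb_mono {n : ℕ} (G : SimpleGraph (Fin n)) (Y : Fin n → ℤˣ) {p q : ℝ}
    (hp0 : 0 ≤ p) (hp1 : p ≤ 1) (hq0 : 0 ≤ q) (hq1 : q ≤ 1)
    {A B : (G.edgeSet → ℤˣ) → (Fin n → ℤˣ) → Prop} (h : ∀ X Z, A X Z → B X Z) :
    obsProb G Y p q A ≤ obsProb G Y p q B := by
  unfold obsProb
  refine Finset.sum_le_sum fun X _ => Finset.sum_le_sum fun Z _ => ?_
  have := obsWeight_nonneg G Y hp0 hp1 hq0 hq1 X Z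
  by_cases h1 : A X Z
  · rw [if_pos h1, if_pos (h X Z h1)]
  · rw [if_neg h1]
    split_ifs <;> linarith

theorem half_le_log_two : (1 : ℝ) / 2 ≤ Real.log 2 := by linarith [Real.log_two_gt_d9]

theorem one_le_log_of_three_le {n : ℕ} (hn : 3 ≤ n) : 1 ≤ Real.log n := by
  rw [Real.le_log_iff_exp_le (by positivity)]
  have h : (3 : ℝ) ≤ n := by exact_mod_cast hn
  linarith [Real.exp_one_lt_d9]

theorem decoder_error_bound (k : ℕ) (hk : 1 ≤ k) (q : ℝ) (hq0 : 0 < q) (hq1 : q < 1 / 2) :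
    ∃ A C : ℝ, 0 < A ∧ 0 < C ∧ ∀ n : ℕ, 5 * k + 3 ≤ n → ∀ p δ : ℝ, 0 < p → p < q → 0 < δ →
      δ < 1 → ∀ G : SimpleGraph (Fin n), ringLattice n k ≤ G → ∀ Y : Fin n → ℤˣ,
        1 - δ ≤ obsProb G Y p q (fun X Z => ∀ out : Fin n → ℤˣ,
          IsRingDecoderOutput n k (ringBudget n k A p δ) G X Z out →
            (hammingDist out Y : ℝ) ≤ C * (p ^ k * n + Real.log (2 / δ)) * Real.log n) := by
  set K : ℝ := 2 ^ starEdgeBound k with hK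
  have hK0 : 0 < K := by positivity
  -- The division by 20 comes from the budget split. The term 4 absorbs rounding, as Q is at least
  -- 1/2. The doubled 5 + K absorbs log 2 ≥ 1/2 and beats 5 log(2/δ) + K p^k n.
  set A : ℝ := 20 * (4 + 2 * (5 + K)) with hA
  have hA0 : 0 < A := by positivity
  set t : ℝ := (1 - 2 * q) / 2 / (2 * k + 1) with ht
  have hs : 0 < (1 - 2 * q) / 2 := by linarith
  have ht0 : 0 < t := by positivity
  have htk : t * (2 * k + 1) = (1 - 2 * q) / 2 := div_mul_cancel₀ _ (by positivity)
  set κ : ℝ := (1 - 2 * q) / 2 * t with hκ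
  have hκ0 : 0 < κ := by positivity
  refine ⟨A, (2 * k + 1) * (A + (3 + 5 * A) / κ), hA0, by positivity, ?_⟩
  intro n hn p δ hp0 hpq hδ0 hδ1 G hG Y
  set Q : ℝ := p ^ k * n + Real.log (2 / δ) with hQ
  set l : ℝ := Real.log (2 / δ) with hl
  have hl2 : Real.log 2 ≤ l := by
    refine Real.log_le_log (by norm_num) ?_
    rw [le_div_iff₀ hδ0]
    linarith
  have hlhalf := half_le_log_two
  have hP0 : 0 ≤ p ^ k * (n : ℝ) := by positivity
  have hlQ : l ≤ Q := by linarith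
  have hQhalf : 1 / 2 ≤ Q := by linarith
  have hδl : δ / 2 = Real.exp (-l) := by
    rw [hl, Real.exp_neg, Real.exp_log (by positivity), inv_div]
  have hlog := one_le_log_of_three_le (show 3 ≤ n by omega)
  set L : ℕ := ringBudget n k A p δ with hL
  have hLle : (L : ℝ) ≤ A * Q := Nat.floor_le (by positivity)
  have hLge : A * Q < L + 1 := Nat.lt_floor_add_one _
  -- The 5A pays for the number of patterns (4L log n) and the bad components (L log n). The 3 pays
  -- for the factor 2, bounded by exp(2Q), and for the target exp(-l).
  set w : ℝ := (3 + 5 * A) / κ * (Q * Real.log n) with hw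
  have main := le_obsProb_error hk (show 5 * k < n by omega) hG Y hp0.le (by linarith) hq0.le
    hq1.le ht0.le htk.le L w
  have first : 10 * (Real.exp (K * (p ^ k * n)) - 1) / 2 ^ (L / 20) ≤ δ / 2 := by
    have hb : (L : ℝ) < 20 * ((L / 20 : ℕ) : ℝ) + 20 := by
      have : L < 20 * (L / 20) + 20 := by omega
      exact_mod_cast this
    have hbB : 2 * (5 + K) * Q ≤ ((L / 20 : ℕ) : ℝ) := by
      rw [hA] at hLge
      nlinarith
    rw [div_le_iff₀ (by positivity), hδl]
    -- Since l is at least log 2, exp(4l) is at least 16.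
    have h10 : (10 : ℝ) ≤ Real.exp (4 * l) := by
      calc (10 : ℝ) ≤ Real.exp (Real.log 2) ^ 4 := by
            rw [Real.exp_log (by norm_num)]; norm_num
        _ = Real.exp (4 * Real.log 2) := by rw [← Real.exp_nat_mul]; norm_num
        _ ≤ _ := Real.exp_le_exp.2 (by linarith)
    have h2 : (2 : ℝ) ^ (L / 20) = Real.exp (((L / 20 : ℕ) : ℝ) * Real.log 2) := by
      rw [Real.exp_nat_mul, Real.exp_log (by norm_num)]
    calc 10 * (Real.exp (K * (p ^ k * n)) - 1) ≤ Real.exp (4 * l) * Real.exp (K * (p ^ k * n)) := by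
          refine mul_le_mul h10 (by linarith) ?_ (Real.exp_pos _).le
          linarith [Real.add_one_le_exp (K * (p ^ k * n)), mul_nonneg hK0.le hP0]
      _ = Real.exp (4 * l + K * (p ^ k * n)) := (Real.exp_add _ _).symm
      _ ≤ Real.exp (-l + ((L / 20 : ℕ) : ℝ) * Real.log 2) := by
          refine Real.exp_le_exp.2 ?_
          have h3 : (5 + K) * Q ≤ ((L / 20 : ℕ) : ℝ) * Real.log 2 := by nlinarith
          have h4 : K * (p ^ k * n) ≤ K * Q := mul_le_mul_of_nonneg_left (by linarith) hK0.le
          linarith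
      _ = _ := by rw [Real.exp_add, h2]
  have second : 2 * ((numBags n k : ℝ) + 1) ^ (2 * L) *
      Real.exp (t * ((2 * k + 1) * L) - κ * w) ≤ δ / 2 := by
    rw [hδl]
    have hn0 : (0 : ℝ) < n := by
      have : 0 < n := by omega
      exact_mod_cast this
    have hm : ((numBags n k : ℝ) + 1) ≤ Real.exp (2 * Real.log n) := by
      have h1 : numBags n k + 1 ≤ n * n := by
        have := numBags_le k (show 0 < n by omega)
        nlinarith
      have h2 : Real.exp (2 * Real.log n) = n * n := by
        rw [two_mul, Real.exp_add, Real.exp_log hn0]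
      rw [h2]
      exact_mod_cast h1
    have h2 : (2 : ℝ) ≤ Real.exp (2 * Q) := by
      linarith [Real.add_one_le_exp (2 * Q)]
    calc 2 * ((numBags n k : ℝ) + 1) ^ (2 * L) * Real.exp (t * ((2 * k + 1) * L) - κ * w)
        ≤ Real.exp (2 * Q) * Real.exp (2 * Real.log n) ^ (2 * L) *
            Real.exp (t * ((2 * k + 1) * L) - κ * w) := by
          gcongr
      _ = Real.exp (2 * Q + 4 * L * Real.log n + (t * ((2 * k + 1) * L) - κ * w)) := by
          rw [← Real.exp_nat_mul, ← Real.exp_add, ← Real.exp_add]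
          push_cast
          ring_nf
      _ ≤ _ := by
          refine Real.exp_le_exp.2 ?_
          have h3 : t * ((2 * k + 1) * L) ≤ L * Real.log n := by
            rw [← mul_assoc, htk, mul_comm]
            have : (1 - 2 * q) / 2 ≤ Real.log n := by linarith
            exact mul_le_mul_of_nonneg_left this (Nat.cast_nonneg _)
          have h4 : κ * w = (3 + 5 * A) * (Q * Real.log n) := by
            rw [hw]; field_simp
          have h5 : L * Real.log n ≤ A * Q * Real.log n :=
            mul_le_mul_of_nonneg_right hLle (by linarith)
          have h6 : Q ≤ Q * Real.log n := le_mul_of_one_le_right (by linarith) hlog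
          have h7 : (3 + 5 * A) * (Q * Real.log n) =
              3 * (Q * Real.log n) + 5 * (A * Q * Real.log n) := by ring
          have h8 : 4 * (L : ℝ) * Real.log n = 4 * (L * Real.log n) := by ring
          rw [h4, h7, h8]
          linarith
  refine le_trans (by linarith) (main.trans (obsProb_mono G Y hp0.le
    (by linarith) hq0.le (by linarith) fun X Z h out hout => (h out hout).trans ?_))
  rw [mul_assoc, mul_assoc]
  refine mul_le_mul_of_nonneg_left ?_ (by positivity)
  rw [add_mul, hw]
  refine add_le_add ?_ le_rfl
  refine hLle.trans (mul_le_mul_of_nonneg_left ?_ hA0.le)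
  exact le_mul_of_one_le_right (by linarith) hlog

/-! ### Sequences of noise levels -/

theorem obsProb_le_one {n : ℕ} (G : SimpleGraph (Fin n)) (Y : Fin n → ℤˣ) {p q : ℝ}
    (hp0 : 0 ≤ p) (hp1 : p ≤ 1) (hq0 : 0 ≤ q) (hq1 : q ≤ 1)
    (A : (G.edgeSet → ℤˣ) → (Fin n → ℤˣ) → Prop) : obsProb G Y p q A ≤ 1 := by
  classical
  have h1 : ∑ X : G.edgeSet → ℤˣ, ∑ Z, obsWeight G Y p q X Z = 1 := by
    simp only [obsWeight_eq_noiseWeight, ← Finset.mul_sum, sum_noiseWeight, mul_one]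
  refine le_trans (le_of_eq_of_le ?_ (Finset.sum_le_sum fun X _ => Finset.sum_le_sum fun Z _ =>
    ?_ : (∑ X, ∑ Z, if A X Z then obsWeight G Y p q X Z else 0) ≤ _)) h1.le
  · unfold obsProb
    congr!
  · have := obsWeight_nonneg G Y hp0 hp1 hq0 hq1 X Z
    split_ifs <;> linarith

theorem modelProb_le_one {n : ℕ} (k : ℕ) {α p q : ℝ} (hα0 : 0 ≤ α) (hα1 : α ≤ 1)
    (hp0 : 0 ≤ p) (hp1 : p ≤ 1) (hq0 : 0 ≤ q) (hq1 : q ≤ 1) (Y : Fin n → ℤˣ)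
    (A : (G : SimpleGraph (Fin n)) → (G.edgeSet → ℤˣ) → (Fin n → ℤˣ) → Prop) :
    modelProb n k α p q Y A ≤ 1 := by
  refine le_trans (Finset.sum_le_sum fun G _ => ?_) (sum_graphWeight n k α).le
  exact mul_le_of_le_one_right (graphWeight_nonneg k hα0 hα1 G)
    (obsProb_le_one G Y hp0 hp1 hq0 hq1 _)

theorem le_modelProb {n : ℕ} (k : ℕ) {α p q x : ℝ} (hα0 : 0 ≤ α) (hα1 : α ≤ 1) (Y : Fin n → ℤˣ)
    (A : (G : SimpleGraph (Fin n)) → (G.edgeSet → ℤˣ) → (Fin n → ℤˣ) → Prop)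
    (h : ∀ G, ringLattice n k ≤ G → x ≤ obsProb G Y p q (A G)) :
    x ≤ modelProb n k α p q Y A := by
  have h1 : ∑ G : SimpleGraph (Fin n), graphWeight n k α G * x = x := by
    rw [← Finset.sum_mul, sum_graphWeight, one_mul]
  rw [← h1]
  refine Finset.sum_le_sum fun G _ => ?_
  by_cases hG : ringLattice n k ≤ G
  · exact mul_le_mul_of_nonneg_left (h G hG) (graphWeight_nonneg k hα0 hα1 G)
  · simp [graphWeight, hG]

theorem tendsto_numBags (k : ℕ) : Tendsto (fun n : ℕ => (numBags n k : ℝ)) atTop atTop := by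
  refine tendsto_natCast_atTop_atTop.comp (tendsto_atTop.2 fun b => ?_)
  filter_upwards [eventually_ge_atTop (b * (k + 1))] with n hn
  exact (Nat.le_div_iff_mul_le (Nat.succ_pos k)).2 (hn.trans (Nat.le_add_right n k))

theorem tendsto_log_natCast : Tendsto (fun n : ℕ => Real.log n) atTop atTop :=
  Real.tendsto_log_atTop.comp tendsto_natCast_atTop_atTop

theorem tendsto_exact_failure {K κ : ℝ} (hκ : 0 < κ) (k : ℕ) {u : ℕ → ℝ}
    (hu : Tendsto u atTop (𝓝 0)) :
    Tendsto (fun n => 1 - 10 * (Real.exp (K * u n) - 1) - 2 * Real.exp (-(κ * numBags n k)))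
      atTop (𝓝 1) := by
  have h1 : Tendsto (fun n => Real.exp (K * u n)) atTop (𝓝 1) := by
    have h := (Real.continuous_exp.tendsto (K * 0)).comp (hu.const_mul K)
    rw [mul_zero, Real.exp_zero] at h
    exact h
  have h2 : Tendsto (fun n => Real.exp (-(κ * numBags n k))) atTop (𝓝 0) :=
    Real.tendsto_exp_neg_atTop_nhds_zero.comp ((tendsto_numBags k).const_mul_atTop hκ)
  have h3 := (((h1.sub_const 1).const_mul 10).const_sub 1).sub (h2.const_mul 2)
  simpa using h3

/-- The choice of the budgets for a sequence of noise levels. -/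
theorem exists_budgets (k : ℕ) (hk : 1 ≤ k) (α q : ℝ) (hα0 : 0 ≤ α) (hα1 : α < 1)
    (hq0 : 0 < q) (hq1 : q < 1 / 2) {A C : ℝ} (hA0 : 0 < A) (hC0 : 0 < C)
    (hAC : ∀ n : ℕ, 5 * k + 3 ≤ n → ∀ p δ : ℝ, 0 < p → p < q → 0 < δ →
      δ < 1 → ∀ G : SimpleGraph (Fin n), ringLattice n k ≤ G → ∀ Y : Fin n → ℤˣ,
        1 - δ ≤ obsProb G Y p q (fun X Z => ∀ out : Fin n → ℤˣ,
          IsRingDecoderOutput n k (ringBudget n k A p δ) G X Z out →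
            (hammingDist out Y : ℝ) ≤ C * (p ^ k * n + Real.log (2 / δ)) * Real.log n))
    (p : ℕ → ℝ) (hp : ∀ n, 0 < p n ∧ p n < q) :
    ∃ L : ℕ → ℕ,
      (∀ Y : (n : ℕ) → Fin n → ℤˣ,
        Tendsto (fun n : ℕ => modelProb n k α (p n) q (Y n) (fun G X Z =>
          ∀ out : Fin n → ℤˣ, IsRingDecoderOutput n k (L n) G X Z out →
            (hammingDist out (Y n) : ℝ) ≤ 3 * C * (p n ^ k * n) * Real.log n ^ 3))
          atTop (𝓝 1)) ∧
      (∀ᶠ n : ℕ in atTop, (L n : ℝ) + 1 ≤ (3 * A + 1) * ⌈p n ^ k * n⌉₊ * Real.log n) ∧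
      (Tendsto (fun n : ℕ => p n ^ k * n) atTop atTop ∨
          Tendsto (fun n : ℕ => p n ^ k * n) atTop (𝓝 0) →
        ∀ᶠ n : ℕ in atTop, (L n : ℝ) + 1 ≤ (3 * A + 1) * ⌈p n ^ k * n⌉₊) := by
  set P : ℕ → ℝ := fun n => p n ^ k * n with hP
  set K : ℝ := 2 ^ starEdgeBound k with hK
  set t : ℝ := (1 - 2 * q) / 2 / (2 * k + 1) with ht
  have hs : 0 < (1 - 2 * q) / 2 := by linarith
  have ht0 : 0 < t := by positivity
  have htk : t * (2 * k + 1) = (1 - 2 * q) / 2 := div_mul_cancel₀ _ (by positivity)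
  set κ : ℝ := (1 - 2 * q) / 2 * t with hκ
  have hκ0 : 0 < κ := by positivity
  have hbig : ∀ᶠ n : ℕ in atTop, 5 * k + 3 ≤ n := eventually_ge_atTop _
  have hPpos : ∀ n, 5 * k + 3 ≤ n → 0 < P n := fun n hn => by
    have h1 : (0 : ℝ) < n := by
      have : 0 < n := by omega
      exact_mod_cast this
    have h2 := (hp n).1
    simp only [hP]
    positivity
  have hceil : ∀ n, 5 * k + 3 ≤ n → (1 : ℝ) ≤ ⌈P n⌉₊ := fun n hn => by
    exact_mod_cast Nat.ceil_pos.2 (hPpos n hn)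
  have hlog : ∀ n, 5 * k + 3 ≤ n → 1 ≤ Real.log n := fun n hn =>
    one_le_log_of_three_le (by omega)
  have hle1 : ∀ (n : ℕ) (Y : Fin n → ℤˣ)
      (E : (G : SimpleGraph (Fin n)) → (G.edgeSet → ℤˣ) → (Fin n → ℤˣ) → Prop),
      modelProb n k α (p n) q Y E ≤ 1 := fun n Y E =>
    modelProb_le_one k hα0 hα1.le (hp n).1.le (by linarith [(hp n).2]) hq0.le (by linarith) Y E
  have hexact : ∀ n, 5 * k + 3 ≤ n → ∀ Y : Fin n → ℤˣ,
      1 - 10 * (Real.exp (K * P n) - 1) - 2 * Real.exp (-(κ * numBags n k)) ≤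
        modelProb n k α (p n) q Y (fun G X Z =>
          ∀ out : Fin n → ℤˣ, IsRingDecoderOutput n k 0 G X Z out →
            (hammingDist out Y : ℝ) ≤ 3 * C * P n * Real.log n ^ 3) := by
    intro n hn Y
    refine le_modelProb k hα0 hα1.le Y _ fun G hG => ?_
    refine (le_obsProb_exact hk (by omega) hG Y (hp n).1.le (by linarith [(hp n).2]) hq0.le
      hq1.le ht0.le htk.le).trans (obsProb_mono G Y (hp n).1.le (by linarith [(hp n).2]) hq0.le
      (by linarith) fun X Z h out hout => ?_)
    rw [h out hout]
    have := hPpos n hn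
    have := hlog n hn
    push_cast
    positivity
  have hrandom : ∀ n, 5 * k + 3 ≤ n → ∀ Y : Fin n → ℤˣ, ∀ δ : ℝ, 0 < δ → δ < 1 →
      P n + Real.log (2 / δ) ≤ 3 * P n * Real.log n ^ 2 →
      1 - δ ≤ modelProb n k α (p n) q Y (fun G X Z =>
          ∀ out : Fin n → ℤˣ, IsRingDecoderOutput n k (ringBudget n k A (p n) δ) G X Z out →
            (hammingDist out Y : ℝ) ≤ 3 * C * P n * Real.log n ^ 3) := by
    intro n hn Y δ hδ0 hδ1 hQ
    refine le_modelProb k hα0 hα1.le Y _ fun G hG => ?_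
    refine (hAC n hn (p n) δ (hp n).1 (hp n).2 hδ0 hδ1 G hG Y).trans
      (obsProb_mono G Y (hp n).1.le (by linarith [(hp n).2]) hq0.le
      (by linarith) fun X Z h out hout => (h out hout).trans ?_)
    have h1 := hlog n hn
    calc C * (P n + Real.log (2 / δ)) * Real.log n
        ≤ C * (3 * P n * Real.log n ^ 2) * Real.log n := by gcongr
      _ = _ := by ring
  have hbudget : ∀ n δ, 0 < δ → δ < 1 → (ringBudget n k A (p n) δ : ℝ) ≤
      A * (P n + Real.log (2 / δ)) := by
    intro n δ hδ0 hδ1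
    refine Nat.floor_le (mul_nonneg hA0.le (add_nonneg ?_ (Real.log_nonneg ?_)))
    · have := (hp n).1
      positivity
    · rw [le_div_iff₀ hδ0]
      linarith
  -- If p^k n tends to 0, bad components are unlikely altogether and budget 0 recovers the truth
  -- exactly with high probability.
  by_cases h0 : Tendsto P atTop (𝓝 0)
  · refine ⟨fun _ => 0, fun Y => ?_, ?_, fun _ => ?_⟩
    · refine tendsto_of_tendsto_of_tendsto_of_le_of_le' (tendsto_exact_failure (K := K) hκ0 k h0)
        tendsto_const_nhds ?_ (Eventually.of_forall fun n => hle1 n _ _)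
      filter_upwards [hbig] with n hn using hexact n hn (Y n)
    · filter_upwards [hbig] with n hn
      have h1 := hceil n hn
      have h2 := hlog n hn
      have h3 : (1 : ℝ) ≤ ⌈P n⌉₊ * Real.log n := one_le_mul_of_one_le_of_one_le h1 h2
      push_cast
      nlinarith
    · filter_upwards [hbig] with n hn
      have h1 := hceil n hn
      push_cast
      nlinarith
  by_cases hinf : Tendsto P atTop atTop
  -- This choice makes log(2/δ) equal to P + 1: δ tends to 0 while the budget remains of order P,
  -- without a logarithm.
  · set δ : ℕ → ℝ := fun n => 2 * Real.exp (-(P n + 1)) with hδ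
    have hδ0 : ∀ n, 0 < δ n := fun n => by positivity
    have hδl : ∀ n, Real.log (2 / δ n) = P n + 1 := fun n => by
      simp only [hδ]
      rw [Real.exp_neg, ← div_div, div_self two_ne_zero, one_div, inv_inv, Real.log_exp]
    have hδ1 : ∀ n, 0 ≤ P n → δ n < 1 := fun n hn => by
      have h1 : Real.exp (-(P n + 1)) ≤ Real.exp (-1) := Real.exp_le_exp.2 (by linarith)
      have h2 : Real.exp (-1) < 1 / 2 := by linarith [Real.exp_neg_one_lt_d9]
      simp only [hδ]
      linarith
    have hP1 : ∀ᶠ n in atTop, 1 ≤ P n := hinf.eventually_ge_atTop 1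
    have hL : ∀ᶠ n in atTop, (ringBudget n k A (p n) (δ n) : ℝ) + 1 ≤ (3 * A + 1) * ⌈P n⌉₊ := by
      filter_upwards [hP1] with n h1
      have h2 := hbudget n (δ n) (hδ0 n) (hδ1 n (by linarith))
      rw [hδl] at h2
      have h3 := Nat.le_ceil (P n)
      nlinarith
    refine ⟨fun n => ringBudget n k A (p n) (δ n), fun Y => ?_, ?_, fun _ => hL⟩
    · have hlim : Tendsto (fun n => 1 - δ n) atTop (𝓝 1) := by
        have h1 := Real.tendsto_exp_neg_atTop_nhds_zero.comp (tendsto_atTop_add_const_right _ 1 hinf)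
        have h2 := (h1.const_mul 2).const_sub 1
        rw [mul_zero, sub_zero] at h2
        exact h2
      refine tendsto_of_tendsto_of_tendsto_of_le_of_le' hlim
        tendsto_const_nhds ?_ (Eventually.of_forall fun n => hle1 n _ _)
      filter_upwards [hbig, hP1] with n hn h1
      refine hrandom n hn (Y n) (δ n) (hδ0 n) (hδ1 n (by linarith)) ?_
      rw [hδl]
      have h2 := hlog n hn
      have h3 : 1 ≤ Real.log n ^ 2 := one_le_pow₀ h2
      nlinarith
    · filter_upwards [hL, hbig] with n h1 hn
      refine h1.trans (le_mul_of_one_le_right ?_ (hlog n hn))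
      positivity
  · classical
    -- Without a limit both regimes may alternate. If P ≤ 1/log n, exact recovery applies uniformly.
    -- Otherwise log n is less than P (log n)², so δ = 1/n is affordable; this is the origin of the
    -- third logarithm in the error.
    set L : ℕ → ℕ := fun n => if P n * Real.log n ≤ 1 then 0 else
      ringBudget n k A (p n) (1 / n) with hL
    have hδ : ∀ n : ℕ, 5 * k + 3 ≤ n → (0 : ℝ) < 1 / n ∧ (1 : ℝ) / n < 1 ∧
        Real.log (2 / (1 / n)) ≤ 2 * Real.log n := by
      intro n hn
      have h1 : (3 : ℝ) ≤ n := by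
        have : 3 ≤ n := by omega
        exact_mod_cast this
      refine ⟨by positivity, (div_lt_one (by linarith)).2 (by linarith), ?_⟩
      rw [two_mul, ← Real.log_mul (by positivity) (by positivity)]
      refine Real.log_le_log (by positivity) ?_
      rw [div_div_eq_mul_div, div_one]
      nlinarith
    refine ⟨L, fun Y => ?_, ?_, fun h => absurd h (by tauto)⟩
    · have hu : Tendsto (fun n : ℕ => 1 / Real.log n) atTop (𝓝 0) := by
        simp only [one_div]
        exact tendsto_log_natCast.inv_tendsto_atTop
      have hlim := (tendsto_exact_failure (K := K) hκ0 k hu).sub tendsto_one_div_atTop_nhds_zero_nat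
      rw [sub_zero] at hlim
      refine tendsto_of_tendsto_of_tendsto_of_le_of_le' hlim
        tendsto_const_nhds ?_ (Eventually.of_forall fun n => hle1 n _ _)
      filter_upwards [hbig] with n hn
      have h1 := hlog n hn
      obtain ⟨hd0, hd1, hd2⟩ := hδ n hn
      by_cases h : P n * Real.log n ≤ 1
      · have h2 : P n ≤ 1 / Real.log n := by rwa [le_div_iff₀ (by linarith)]
        have h3 : Real.exp (K * P n) ≤ Real.exp (K * (1 / Real.log n)) :=
          Real.exp_le_exp.2 (mul_le_mul_of_nonneg_left h2 (by positivity))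
        simp only [hL, if_pos h]
        refine le_trans ?_ (hexact n hn (Y n))
        linarith
      · simp only [hL, if_neg h]
        have h3 : 1 ≤ Real.exp (K * (1 / Real.log n)) := Real.one_le_exp (by positivity)
        have h4 := Real.exp_pos (-(κ * numBags n k))
        refine le_trans ?_ (hrandom n hn (Y n) (1 / n) hd0 hd1 ?_)
        · linarith
        · have h5 : Real.log n ≤ P n * Real.log n ^ 2 := by
            push Not at h
            nlinarith
          have h6 : P n ≤ P n * Real.log n ^ 2 :=
            le_mul_of_one_le_right (hPpos n hn).le (one_le_pow₀ h1)
          linarith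
    · filter_upwards [hbig] with n hn
      have h1 := hceil n hn
      have h2 := hlog n hn
      have h3 : (1 : ℝ) ≤ ⌈P n⌉₊ * Real.log n := one_le_mul_of_one_le_of_one_le h1 h2
      obtain ⟨hd0, hd1, hd2⟩ := hδ n hn
      by_cases h : P n * Real.log n ≤ 1
      · simp only [hL, if_pos h]
        push_cast
        nlinarith
      · simp only [hL, if_neg h]
        have h4 := hbudget n (1 / n) hd0 hd1
        have h5 : P n ≤ ⌈P n⌉₊ * Real.log n :=
          (Nat.le_ceil (P n)).trans (le_mul_of_one_le_right (by linarith) h2)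
        have h6 : Real.log n ≤ ⌈P n⌉₊ * Real.log n := le_mul_of_one_le_left (by linarith) h1
        have h7 : A * (P n + Real.log (2 / (1 / n))) ≤ A * (3 * (⌈P n⌉₊ * Real.log n)) :=
          mul_le_mul_of_nonneg_left (by linarith) hA0.le
        linarith

/-! ## Structured programs for the word RAM -/

/-- Arithmetic expressions over the eight registers that hold variables. -/
inductive Expr
  | const (c : ℕ)
  | reg (r : Fin 8)
  | op (o : Op) (a b : Expr)
  | load (a : Expr)
  | readX (a b : Expr)
  | readZ (a : Expr)

/-- The part of the machine state that is visible to expressions. -/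
structure View where
  reg : Fin 8 → ℕ
  mem : ℕ → ℕ

/-- The visible part of a state. -/
def State.view (σ : State) : View := ⟨fun r => σ.reg r, σ.mem⟩

/-- Write a visible register. -/
def View.setReg (s : View) (x : Fin 8) (a : ℕ) : View := ⟨Function.update s.reg x a, s.mem⟩

/-- Write a memory cell. -/
def View.setMem (s : View) (a b : ℕ) : View := ⟨s.reg, Function.update s.mem a b⟩

/-- All visible registers and all memory cells hold numbers that are at most `M`. -/
def View.BoundedBy (s : View) (M : ℕ) : Prop := (∀ r, s.reg r ≤ M) ∧ ∀ a, s.mem a ≤ M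

theorem View.BoundedBy.setReg {s : View} {M : ℕ} (h : s.BoundedBy M) (x : Fin 8) {a : ℕ}
    (ha : a ≤ M) : (s.setReg x a).BoundedBy M := by
  refine ⟨fun r => ?_, h.2⟩
  by_cases hr : r = x
  · subst hr; simpa [View.setReg] using ha
  · simpa [View.setReg, Function.update_of_ne hr] using h.1 r

theorem View.BoundedBy.setMem {s : View} {M : ℕ} (h : s.BoundedBy M) (a : ℕ) {b : ℕ}
    (hb : b ≤ M) : (s.setMem a b).BoundedBy M := by
  refine ⟨h.1, fun r => ?_⟩
  by_cases hr : r = a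
  · subst hr; simpa [View.setMem] using hb
  · simpa [View.setMem, Function.update_of_ne hr] using h.2 r

namespace Expr

instance : Add Expr := ⟨op .add⟩
instance : Sub Expr := ⟨op .sub⟩
instance : Mul Expr := ⟨op .mul⟩
instance : Div Expr := ⟨op .div⟩
instance : Mod Expr := ⟨op .mod⟩

/-- The value of an expression. -/
def val (inX : ℕ → ℕ → ℕ) (inZ : ℕ → ℕ) (s : View) : Expr → ℕ
  | const c => c
  | reg r => s.reg r
  | op o a b => o.eval (a.val inX inZ s) (b.val inX inZ s)
  | load a => s.mem (a.val inX inZ s)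
  | readX a b => inX (a.val inX inZ s) (b.val inX inZ s)
  | readZ a => inZ (a.val inX inZ s)

/-- The program that puts the value of an expression into the register `d`, using registers from
`d` on for intermediate results. -/
def compile : Expr → ℕ → Program
  | const c, d => .const d c
  -- A register is copied by adding it to zero.
  | reg r, d => .seq (.const d 0) (.op .add d r d)
  | op o a b, d => .seq (a.compile d) (.seq (b.compile (d + 1)) (.op o d d (d + 1)))
  | load a, d => .seq (a.compile d) (.load d d)
  | readX a b, d => .seq (a.compile d) (.seq (b.compile (d + 1)) (.readX d d (d + 1)))
  | readZ a, d => .seq (a.compile d) (.readZ d d)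

/-- The running time of the compiled expression. -/
def cost : Expr → ℕ
  | const _ => 1
  | reg _ => 2
  | op _ a b => a.cost + (b.cost + 1)
  | load a => a.cost + 1
  | readX a b => a.cost + (b.cost + 1)
  | readZ a => a.cost + 1

/-- All intermediate values are at most `M ^ growth`. -/
def growth : Expr → ℕ
  -- Sufficient because c < M^c for M at least 2.
  | const c => c
  | reg _ => 1
  | op _ a b => a.growth + b.growth + 1
  | load a => a.growth + 1
  | readX a b => a.growth + b.growth + 1
  | readZ a => a.growth + 1

variable {inX : ℕ → ℕ → ℕ} {inZ : ℕ → ℕ}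

@[simp] theorem val_const (s : View) (c : ℕ) : (const c).val inX inZ s = c := rfl
@[simp] theorem val_reg (s : View) (r : Fin 8) : (reg r).val inX inZ s = s.reg r := rfl
@[simp] theorem val_load (s : View) (a : Expr) :
    (load a).val inX inZ s = s.mem (a.val inX inZ s) := rfl
@[simp] theorem val_readX (s : View) (a b : Expr) :
    (readX a b).val inX inZ s = inX (a.val inX inZ s) (b.val inX inZ s) := rfl
@[simp] theorem val_readZ (s : View) (a : Expr) :
    (readZ a).val inX inZ s = inZ (a.val inX inZ s) := rfl
@[simp] theorem val_add (s : View) (a b : Expr) :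
    (a + b).val inX inZ s = a.val inX inZ s + b.val inX inZ s := rfl
@[simp] theorem val_sub (s : View) (a b : Expr) :
    (a - b).val inX inZ s = a.val inX inZ s - b.val inX inZ s := rfl
@[simp] theorem val_mul (s : View) (a b : Expr) :
    (a * b).val inX inZ s = a.val inX inZ s * b.val inX inZ s := rfl
@[simp] theorem val_div (s : View) (a b : Expr) :
    (a / b).val inX inZ s = a.val inX inZ s / b.val inX inZ s := rfl
@[simp] theorem val_mod (s : View) (a b : Expr) :
    (a % b).val inX inZ s = a.val inX inZ s % b.val inX inZ s := rfl
@[simp] theorem val_lt (s : View) (a b : Expr) : (op .lt a b).val inX inZ s =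
    if a.val inX inZ s < b.val inX inZ s then 1 else 0 := rfl
@[simp] theorem val_eq (s : View) (a b : Expr) : (op .eq a b).val inX inZ s =
    if a.val inX inZ s = b.val inX inZ s then 1 else 0 := rfl

theorem op_eval_le {M x y g h : ℕ} (hM : 2 ≤ M) (o : Op) (hx : x ≤ M ^ g) (hy : y ≤ M ^ h) :
    o.eval x y ≤ M ^ (g + h + 1) := by
  have h1 : 1 ≤ M ^ g := Nat.one_le_pow _ _ (by omega)
  have h2 : 1 ≤ M ^ h := Nat.one_le_pow _ _ (by omega)
  have h3 : M ^ (g + h + 1) = M ^ g * M ^ h * M := by rw [pow_succ, pow_add]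
  have h4 : 1 ≤ M ^ g * M ^ h := Nat.mul_pos h1 h2
  have h5 : M ^ g * M ^ h * 2 ≤ M ^ (g + h + 1) := by
    rw [h3]; exact Nat.mul_le_mul_left _ hM
  have h6 : x ≤ M ^ g * M ^ h := hx.trans (Nat.le_mul_of_pos_right _ h2)
  have h7 : y ≤ M ^ g * M ^ h := hy.trans (Nat.le_mul_of_pos_left _ h1)
  have h8 : x * y ≤ M ^ g * M ^ h := Nat.mul_le_mul hx hy
  cases o with
  | add => simp only [Op.eval]; omega
  | sub => simp only [Op.eval]; omega
  | mul => simp only [Op.eval]; omega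
  | div => have := Nat.div_le_self x y; simp only [Op.eval]; omega
  | mod => have := Nat.mod_le x y; simp only [Op.eval]; omega
  | lt => simp only [Op.eval]; split_ifs <;> omega
  | eq => simp only [Op.eval]; split_ifs <;> omega

theorem val_le {M : ℕ} (hM : 2 ≤ M) (hX : ∀ a b, inX a b ≤ 2) (hZ : ∀ a, inZ a ≤ 2) {s : View}
    (hs : s.BoundedBy M) (e : Expr) : e.val inX inZ s ≤ M ^ e.growth := by
  have hself : ∀ g, M ≤ M ^ (g + 1) := fun g => Nat.le_self_pow (Nat.succ_ne_zero g) M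
  induction e with
  | const c => exact (Nat.lt_pow_self (by omega)).le
  | reg r => simpa [growth] using hs.1 r
  | op o a b iha ihb => exact op_eval_le hM o iha ihb
  | load a _ => exact (hs.2 _).trans (hself _)
  | readX a b _ _ => exact ((hX _ _).trans hM).trans (hself _)
  | readZ a _ => exact ((hZ _).trans hM).trans (hself _)

/-- Stack discipline: the first operand is left in `d` and the second is computed from `d + 1` on,
so lower registers survive. Since d is at least 8, the variables and hence the visible state are
untouched. -/
theorem exec_compile {M B : ℕ} (hM : 2 ≤ M) (hX : ∀ a b, inX a b ≤ 2) (hZ : ∀ a, inZ a ≤ 2)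
    {s : View} (hs : s.BoundedBy M) (e : Expr) (hB : M ^ e.growth ≤ B) (d : ℕ) (hd : 8 ≤ d)
    (σ : State) (hσ : σ.view = s) :
    ∃ τ, Exec inX inZ B (e.compile d) σ τ e.cost ∧ τ.mem = σ.mem ∧
      (∀ r < d, τ.reg r = σ.reg r) ∧ τ.reg d = e.val inX inZ s := by
  have hM1 : 1 ≤ M := by omega
  have hmono : ∀ {g h : ℕ}, g ≤ h → M ^ g ≤ M ^ h := fun h => Nat.pow_le_pow_right hM1 h
  have hval : ∀ e : Expr, e.val inX inZ s ≤ M ^ e.growth := val_le hM hX hZ hs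
  have hview : ∀ (d : ℕ) (σ τ : State), 8 ≤ d → τ.mem = σ.mem → (∀ r < d, τ.reg r = σ.reg r) →
      τ.view = σ.view := by
    intro d σ τ hd h1 h2
    unfold State.view
    rw [h1]
    congr 1
    funext r
    exact h2 r (by omega)
  have hset : ∀ (τ : State) (d x : ℕ), ∀ r < d, (τ.setReg d x).reg r = τ.reg r :=
    fun τ d x r hr => Function.update_of_ne (ne_of_lt hr) _ _
  have hset' : ∀ (τ : State) (d x : ℕ), (τ.setReg d x).reg d = x :=
    fun τ d x => Function.update_self _ _ _
  induction e generalizing d σ with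
  | const c =>
    exact ⟨_, .const σ d c ((hval (const c)).trans hB), rfl, hset σ d c, hset' σ d c⟩
  | reg r =>
    have hr : σ.reg r = s.reg r := by rw [← hσ]; rfl
    have h1 : ((σ.setReg d 0).reg r : ℕ) = s.reg r := by rw [hset σ d 0 r (by omega), hr]
    have h2 : Op.add.eval ((σ.setReg d 0).reg r) ((σ.setReg d 0).reg d) = s.reg r := by
      rw [h1, hset']; rfl
    refine ⟨_, .seq (.const σ d 0 (Nat.zero_le _)) (.op _ .add d r d ?_), rfl, fun r' hr' => ?_, ?_⟩
    · rw [h2]; exact (hval (reg r)).trans hB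
    · rw [hset _ _ _ _ hr', hset _ _ _ _ hr']
    · rw [hset', h2]; rfl
  | op o a b iha ihb =>
    simp only [growth] at hB
    obtain ⟨τ, h1, h2, h3, h4⟩ := iha ((hmono (by omega)).trans hB) d hd σ hσ
    obtain ⟨ρ, h5, h6, h7, h8⟩ := ihb ((hmono (by omega)).trans hB) (d + 1) (by omega) τ
      ((hview d σ τ hd h2 h3).trans hσ)
    have h9 : o.eval (ρ.reg d) (ρ.reg (d + 1)) = (op o a b).val inX inZ s := by
      rw [h8, h7 d (by omega), h4]; rfl
    refine ⟨_, .seq h1 (.seq h5 (.op ρ o d d (d + 1) ?_)), h6.trans h2, fun r hr => ?_, ?_⟩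
    · rw [h9]; exact (hval _).trans hB
    · rw [hset _ _ _ _ hr, h7 r (by omega), h3 r hr]
    · rw [hset', h9]
  | load a iha =>
    simp only [growth] at hB
    obtain ⟨τ, h1, h2, h3, h4⟩ := iha ((hmono (by omega)).trans hB) d hd σ hσ
    refine ⟨_, .seq h1 (.load τ d d), h2, fun r hr => ?_, ?_⟩
    · rw [hset _ _ _ _ hr, h3 r hr]
    · rw [hset', h4, h2, ← hσ]; rfl
  | readX a b iha ihb =>
    simp only [growth] at hB
    obtain ⟨τ, h1, h2, h3, h4⟩ := iha ((hmono (by omega)).trans hB) d hd σ hσ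
    obtain ⟨ρ, h5, h6, h7, h8⟩ := ihb ((hmono (by omega)).trans hB) (d + 1) (by omega) τ
      ((hview d σ τ hd h2 h3).trans hσ)
    have h9 : inX (ρ.reg d) (ρ.reg (d + 1)) = (readX a b).val inX inZ s := by
      rw [h8, h7 d (by omega), h4]; rfl
    refine ⟨_, .seq h1 (.seq h5 (.readX ρ d d (d + 1) ?_)), h6.trans h2, fun r hr => ?_, ?_⟩
    · rw [h9]; exact (hval _).trans hB
    · rw [hset _ _ _ _ hr, h7 r (by omega), h3 r hr]
    · rw [hset', h9]
  | readZ a iha =>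
    simp only [growth] at hB
    obtain ⟨τ, h1, h2, h3, h4⟩ := iha ((hmono (by omega)).trans hB) d hd σ hσ
    have h9 : inZ (τ.reg d) = (readZ a).val inX inZ s := by rw [h4]; rfl
    refine ⟨_, .seq h1 (.readZ τ d d ?_), h2, fun r hr => ?_, ?_⟩
    · rw [h9]; exact (hval _).trans hB
    · rw [hset _ _ _ _ hr, h3 r hr]
    · rw [hset', h9]

end Expr

/-- Started in a state with visible part `s`, the program halts within `T` steps in a state whose
visible part satisfies `Q`. -/
def Runs (inX : ℕ → ℕ → ℕ) (inZ : ℕ → ℕ) (B : ℕ) (P : Program) (s : View) (T : ℕ)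
    (Q : View → Prop) : Prop :=
  ∀ σ : State, σ.view = s → ∃ τ t, Exec inX inZ B P σ τ t ∧ t ≤ T ∧ Q τ.view

/-- Assign the value of an expression to a variable. -/
def Program.assign (x : Fin 8) (e : Expr) : Program :=
  .seq (e.compile 8) (.seq (.const x 0) (.op .add x x 8))

/-- Store the value of an expression at the address given by an expression. -/
def Program.storeAt (a e : Expr) : Program :=
  .seq (a.compile 8) (.seq (e.compile 9) (.store 8 9))

/-- Repeat while the value of an expression is non-zero. -/
def Program.whileNonzero (e : Expr) (P : Program) : Program :=
  .seq (e.compile 8) (.loop 8 (.seq P (e.compile 8)))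

/-! ### Composition rules with time bounds -/

section Rules

variable {inX : ℕ → ℕ → ℕ} {inZ : ℕ → ℕ} {M B : ℕ}

theorem view_eq_of_agree {d : ℕ} {σ τ : State} (hd : 8 ≤ d) (h1 : τ.mem = σ.mem)
    (h2 : ∀ r < d, τ.reg r = σ.reg r) : τ.view = σ.view := by
  unfold State.view
  rw [h1]
  congr 1
  funext r
  exact h2 r (by omega)

theorem Runs.seq {P P' : Program} {s : View} {T T' : ℕ} {Q Q' : View → Prop}
    (h : Runs inX inZ B P s T Q) (h' : ∀ s', Q s' → Runs inX inZ B P' s' T' Q') :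
    Runs inX inZ B (.seq P P') s (T + T') Q' := by
  intro σ hσ
  obtain ⟨τ, t, h1, h2, h3⟩ := h σ hσ
  obtain ⟨ρ, u, h4, h5, h6⟩ := h' _ h3 τ rfl
  exact ⟨ρ, t + u, .seq h1 h4, by omega, h6⟩

theorem runs_assign (hM : 2 ≤ M) (hX : ∀ a b, inX a b ≤ 2) (hZ : ∀ a, inZ a ≤ 2) {s : View}
    (hs : s.BoundedBy M) (x : Fin 8) (e : Expr) (hB : M ^ e.growth ≤ B) :
    Runs inX inZ B (.assign x e) s (e.cost + 2)
      (fun s' => s' = s.setReg x (e.val inX inZ s)) := by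
  intro σ hσ
  obtain ⟨τ, h1, h2, h3, h4⟩ := e.exec_compile hM hX hZ hs hB 8 le_rfl σ hσ
  have hx8 : (8 : ℕ) ≠ x := by omega
  have h5 : Op.add.eval ((τ.setReg x 0).reg x) ((τ.setReg x 0).reg 8) = e.val inX inZ s := by
    simp only [State.setReg, Op.eval, Function.update_self, Function.update_of_ne hx8, h4, zero_add]
  refine ⟨_, _, .seq h1 (.seq (.const τ x 0 (Nat.zero_le _)) (.op _ .add x x 8 ?_)), le_rfl, ?_⟩
  · rw [h5]; exact (Expr.val_le hM hX hZ hs e).trans hB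
  · rw [h5]
    have hview := (view_eq_of_agree le_rfl h2 h3).trans hσ
    rw [← hview]
    unfold State.view State.setReg View.setReg
    congr 1
    funext r
    by_cases hr : r = x
    · subst hr; simp
    · have hr' : (r : ℕ) ≠ x := fun h => hr (Fin.ext h)
      simp [Function.update_of_ne hr, Function.update_of_ne hr']

theorem runs_storeAt (hM : 2 ≤ M) (hX : ∀ a b, inX a b ≤ 2) (hZ : ∀ a, inZ a ≤ 2) {s : View}
    (hs : s.BoundedBy M) (a e : Expr) (ha : M ^ a.growth ≤ B) (hB : M ^ e.growth ≤ B) :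
    Runs inX inZ B (.storeAt a e) s (a.cost + (e.cost + 1))
      (fun s' => s' = s.setMem (a.val inX inZ s) (e.val inX inZ s)) := by
  intro σ hσ
  obtain ⟨τ, h1, h2, h3, h4⟩ := a.exec_compile hM hX hZ hs ha 8 le_rfl σ hσ
  have hview := (view_eq_of_agree le_rfl h2 h3).trans hσ
  obtain ⟨ρ, h5, h6, h7, h8⟩ := e.exec_compile hM hX hZ hs hB 9 (by omega) τ hview
  have hview' := (view_eq_of_agree (by omega) h6 h7).trans hview
  refine ⟨_, _, .seq h1 (.seq h5 (.store ρ 8 9)), le_rfl, ?_⟩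
  rw [h8, h7 8 (by omega), h4, ← hview']
  rfl

/-- The indexed invariant serves also as the variant: the guard is non-zero before stage `N` and
zero at it. The body may destroy the scratch register of the guard, so the guard is recomputed after
each round. -/
theorem runs_whileNonzero (hM : 2 ≤ M) (hX : ∀ a b, inX a b ≤ 2) (hZ : ∀ a, inZ a ≤ 2)
    (e : Expr) (hB : M ^ e.growth ≤ B) (P : Program) (T N : ℕ) (I : ℕ → View → Prop)
    (hI : ∀ i s, I i s → s.BoundedBy M)
    (hstep : ∀ i < N, ∀ s, I i s → e.val inX inZ s ≠ 0 ∧ Runs inX inZ B P s T (I (i + 1)))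
    (hend : ∀ s, I N s → e.val inX inZ s = 0) {s : View} (h0 : I 0 s) :
    Runs inX inZ B (.whileNonzero e P) s (e.cost + (N * (T + e.cost + 1) + 1)) (I N) := by
  have hloop : ∀ m i, i + m = N → ∀ σ : State, I i σ.view → σ.reg 8 = e.val inX inZ σ.view →
      ∃ τ t, Exec inX inZ B (.loop 8 (.seq P (e.compile 8))) σ τ t ∧
        t ≤ m * (T + e.cost + 1) + 1 ∧ I N τ.view := by
    intro m
    induction m with
    | zero =>
      intro i hi σ hσ hr
      rw [add_zero] at hi
      subst hi
      exact ⟨σ, 1, .loopStop (by rw [hr, hend _ hσ]), by omega, hσ⟩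
    | succ m ih =>
      intro i hi σ hσ hr
      obtain ⟨hne, hrun⟩ := hstep i (by omega) _ hσ
      obtain ⟨τ, t, h1, h2, h3⟩ := hrun σ rfl
      obtain ⟨ρ, h4, h5, h6, h7⟩ := e.exec_compile hM hX hZ (hI _ _ h3) hB 8 le_rfl τ rfl
      have hview := view_eq_of_agree le_rfl h5 h6
      obtain ⟨π, u, h8, h9, h10⟩ := ih (i + 1) (by omega) ρ (by rw [hview]; exact h3)
        (by rw [h7, hview])
      refine ⟨π, _, .loopStep (by rw [hr]; exact hne) (.seq h1 h4) h8, ?_, h10⟩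
      rw [Nat.succ_mul]
      omega
  intro σ hσ
  subst hσ
  obtain ⟨τ, h1, h2, h3, h4⟩ := e.exec_compile hM hX hZ (hI _ _ h0) hB 8 le_rfl σ rfl
  have hview := view_eq_of_agree le_rfl h2 h3
  obtain ⟨ρ, t, h5, h6, h7⟩ := hloop N 0 (zero_add N) τ (by rw [hview]; exact h0)
    (by rw [h4, hview])
  exact ⟨ρ, _, .seq h1 h5, by omega, h7⟩

end Rules

/-! ## The decoding program: the functions it computes -/

/-- Bit number `a` of `x`. -/
def bitAt (x a : ℕ) : ℕ := x / 2 ^ a % 2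

/-- The number of the vertex `a` of the extended component `i`. -/
def starNumber (n k i a : ℕ) : ℕ := (i * (k + 1) + n - 2 * k + a) % n

/-- The positions of the edges of an extended component. -/
noncomputable def starPairs (k : ℕ) : List (ℕ × ℕ) :=
  ((Finset.range (4 * k + 1) ×ˢ Finset.range (4 * k + 1)).filter
    fun ab => ab.1 < ab.2 ∧ ab.2 ≤ ab.1 + k).toList

section Functions

variable (inX : ℕ → ℕ → ℕ) (inZ : ℕ → ℕ) (n k L : ℕ)

/-- The number of measurements inside the extended component `i` that disagree with the labelling
encoded by the bits of `x`. -/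
noncomputable def mismatches (i x : ℕ) : ℕ :=
  -- With signs coded by 1 and 2, one plus the parity of two label bits is the code of their
  -- product.
  ((starPairs k).map fun ab =>
    1 - if inX (starNumber n k i ab.1) (starNumber n k i ab.2) =
      1 + (bitAt x ab.1 + bitAt x ab.2) % 2 then 1 else 0).sum

/-- The number of mismatches and the labelling, encoded in one number. -/
noncomputable def maskKey (i x : ℕ) : ℕ := mismatches inX n k i x * 2 ^ (4 * k + 1) + x

/-- The least key. -/
noncomputable def bestKey (i : ℕ) : ℕ :=
  ((List.range (2 ^ (4 * k + 1))).map (maskKey inX n k i)).foldr min (maskKey inX n k i 0)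

/-- A labelling of the extended component `i` with the least number of mismatches. -/
noncomputable def bestMask (i : ℕ) : ℕ := bestKey inX n k i % 2 ^ (4 * k + 1)

/-- The cost of the component `i` for the sign with code `s`. -/
noncomputable def maskCost (i s : ℕ) : ℕ :=
  ((List.range (2 * k + 1)).map fun a =>
    1 - if inZ (starNumber n k i (k + a)) = 1 + (s + bitAt (bestMask inX n k i) (k + a)) % 2
      then 1 else 0).sum

/-- The code of the sign on the tree edge between the components `i - 1` and `i`. -/
noncomputable def turn (i : ℕ) : ℕ :=
  -- Position 3k of component i-1 and position 2k-1 of component i are the same vertex, with number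
  -- i(k+1) - 1.
  (bitAt (bestMask inX n k (i - 1)) (3 * k) + bitAt (bestMask inX n k i) (2 * k - 1)) % 2

/-- The dynamic program: the minimal cost of the components `0, …, i` with at most `j` violated
edges among them when the component `i` has the sign `s`. -/
noncomputable def minCost : ℕ → ℕ → ℕ → ℕ
  | 0, _, s => maskCost inX inZ n k 0 s
  | i + 1, j, s => maskCost inX inZ n k (i + 1) s +
      -- For j = 0 the truncated j - 1 would allow a violation for free.
      if j = 0 then minCost i j ((s + turn inX n k (i + 1)) % 2)
      else min (minCost i j ((s + turn inX n k (i + 1)) % 2))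
        (minCost i (j - 1) (((s + turn inX n k (i + 1)) % 2 + 1) % 2))

/-- Whether the optimum for the component `i` with budget `j` and sign `s` violates the edge to the
component `i - 1`. -/
noncomputable def violated (i j s : ℕ) : ℕ :=
  if j ≠ 0 ∧ minCost inX inZ n k (i - 1) (j - 1) (((s + turn inX n k i) % 2 + 1) % 2) <
    minCost inX inZ n k (i - 1) j ((s + turn inX n k i) % 2) then 1 else 0

/-- The remaining budget and the sign of the component `numBags n k - 1 - d` in the optimum. -/
noncomputable def backtrack : ℕ → ℕ × ℕ
  | 0 => (L, if minCost inX inZ n k (numBags n k - 1) L 1 <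
      minCost inX inZ n k (numBags n k - 1) L 0 then 1 else 0)
  | d + 1 =>
      ((backtrack d).1 -
        violated inX inZ n k (numBags n k - 1 - d) (backtrack d).1 (backtrack d).2,
      (((backtrack d).2 + turn inX n k (numBags n k - 1 - d)) % 2 +
        violated inX inZ n k (numBags n k - 1 - d) (backtrack d).1 (backtrack d).2) % 2)

/-- The remaining budget and the sign of the component `i` in the optimum. -/
noncomputable def optState (i : ℕ) : ℕ × ℕ := backtrack inX inZ n k L (numBags n k - 1 - i)

/-- The code of the output label of the vertex `v`. -/
noncomputable def outputCode (v : ℕ) : ℕ :=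
  1 + ((optState inX inZ n k L (v / (k + 1))).2 +
    -- The centre has position 2k, so each vertex is labelled by the component whose centre is the
    -- last one not after it.
    bitAt (bestMask inX n k (v / (k + 1))) (v % (k + 1) + 2 * k)) % 2

theorem maskCost_le (i s : ℕ) : maskCost inX inZ n k i s ≤ 2 * k + 1 := by
  unfold maskCost
  refine (List.sum_le_card_nsmul _ 1 ?_).trans (by simp)
  intro x hx
  obtain ⟨a, -, rfl⟩ := List.mem_map.1 hx
  omega

/-- Guarantees that the table entries fit into machine words. -/
theorem minCost_le (i j s : ℕ) : minCost inX inZ n k i j s ≤ (2 * k + 1) * (i + 1) := by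
  induction i generalizing j s with
  | zero => simpa [minCost] using maskCost_le inX inZ n k 0 s
  | succ i ih =>
    have h1 := maskCost_le inX inZ n k (i + 1) s
    have h2 := ih j ((s + turn inX n k (i + 1)) % 2)
    have h3 : (2 * k + 1) * (i + 1 + 1) = (2 * k + 1) * (i + 1) + (2 * k + 1) := by ring
    rw [minCost, h3]
    split_ifs
    · omega
    · have := min_le_left (minCost inX inZ n k i j ((s + turn inX n k (i + 1)) % 2))
        (minCost inX inZ n k i (j - 1) (((s + turn inX n k (i + 1)) % 2 + 1) % 2))
      omega

theorem backtrack_le (d : ℕ) : (backtrack inX inZ n k L d).1 ≤ L ∧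
    (backtrack inX inZ n k L d).2 < 2 := by
  induction d with
  | zero =>
    refine ⟨le_rfl, ?_⟩
    simp only [backtrack]
    split_ifs <;> omega
  | succ d ih => exact ⟨(Nat.sub_le _ _).trans ih.1, Nat.mod_lt _ (by omega)⟩

end Functions

/-! ## The decoding program: expressions -/

namespace Expr

variable {inX : ℕ → ℕ → ℕ} {inZ : ℕ → ℕ}

/-- The sum of a list of expressions. -/
def sum (l : List Expr) : Expr := l.foldr (fun a b => a + b) (const 0)

theorem val_sum (s : View) (l : List Expr) :
    (sum l).val inX inZ s = (l.map fun e => e.val inX inZ s).sum := by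
  induction l with
  | nil => rfl
  | cons a l ih => rw [List.map_cons, List.sum_cons, ← ih]; rfl

/-- The minimum of an expression and a list of expressions. -/
def minimum (a : Expr) (l : List Expr) : Expr := l.foldr (fun e m => e - (e - m)) a

theorem val_minimum (s : View) (a : Expr) (l : List Expr) :
    (minimum a l).val inX inZ s = (l.map fun e => e.val inX inZ s).foldr min (a.val inX inZ s) := by
  induction l with
  | nil => rfl
  | cons e l ih =>
    rw [List.map_cons, List.foldr_cons, ← ih]
    -- With truncated subtraction, x - (x - y) is the minimum of x and y.
    change e.val inX inZ s - (e.val inX inZ s - (minimum a l).val inX inZ s) = _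
    omega

/-- Bit number `a` of the value of an expression. -/
def bit (e : Expr) (a : ℕ) : Expr := e / const (2 ^ a) % const 2

/-- The number of the vertex with position `a` in an extended component. -/
def star (k : ℕ) (i a : Expr) : Expr :=
  (i * const (k + 1) + reg 0 - const (2 * k) + a) % reg 0

/-- The key of the labelling `x`. -/
noncomputable def key (k : ℕ) (i : Expr) (x : ℕ) : Expr :=
  sum ((starPairs k).map fun ab => const 1 -
    op .eq (readX (star k i (const ab.1)) (star k i (const ab.2)))
      (const (1 + (bitAt x ab.1 + bitAt x ab.2) % 2))) * const (2 ^ (4 * k + 1)) + const x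

/-- A labelling with the least number of mismatches. -/
noncomputable def mask (k : ℕ) (i : Expr) : Expr :=
  minimum (key k i 0) ((List.range (2 ^ (4 * k + 1))).map (key k i)) % const (2 ^ (4 * k + 1))

/-- The cost of a component. -/
noncomputable def bagCost (k : ℕ) (i : Expr) (s : ℕ) : Expr :=
  sum ((List.range (2 * k + 1)).map fun a => const 1 -
    op .eq (readZ (star k i (const (k + a))))
      (const 1 + (const s + bit (mask k i) (k + a)) % const 2))

/-- The sign on the tree edge before a component. -/
noncomputable def turn (k : ℕ) (i : Expr) : Expr :=
  (bit (mask k (i - const 1)) (3 * k) + bit (mask k i) (2 * k - 1)) % const 2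

/-- The entry of the table of the dynamic program with index `t` and sign `u`. -/
def cell (t u : Expr) : Expr := load (reg 0 + const 2 * t + u)

/-- The next entry of the table, for the sign `s`. -/
noncomputable def entry (k s : ℕ) : Expr :=
  let i := reg 2 / (reg 1 + const 1)
  let j := reg 2 % (reg 1 + const 1)
  let u := (const s + turn k i) % const 2
  let t := reg 2 - (reg 1 + const 1)
  let a := cell t u
  let b := cell (t - const 1) ((u + const 1) % const 2)
  -- Branches are replaced by 0-1 factors. For i = 0 or j = 0 the reads of `a` or `b` may hit
  -- meaningless cells, but they are multiplied by 0.
  bagCost k i s + (const 1 - op .eq i (const 0)) *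
    (op .eq j (const 0) * a + (const 1 - op .eq j (const 0)) * (a - (a - b)))

/-- The number of components. -/
def bags (k : ℕ) : Expr := (reg 0 + const k) / const (k + 1)

/-- The sign of the last component. -/
def lastSign (k : ℕ) : Expr :=
  let t := (bags k - const 1) * (reg 1 + const 1) + reg 1
  op .lt (cell t (const 1)) (cell t (const 0))

/-- The output at the current vertex. -/
noncomputable def output (k : ℕ) : Expr :=
  let m := mask k (reg 5 / const (k + 1))
  const 1 + (reg 4 + m / powTwo (reg 5 % const (k + 1)) k % const 2) % const 2
where
  /-- The power of two with exponent `r + 2 * k`, for `r ≤ k`. -/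
  powTwo (r : Expr) (k : ℕ) : Expr :=
    sum ((List.range (k + 1)).map fun a => op .eq r (const a) * const (2 ^ (a + 2 * k)))

/-- Whether the current vertex is the first one of a component other than the first. -/
def boundary (k : ℕ) : Expr :=
  op .eq (reg 5 % const (k + 1)) (const 0) * (const 1 - op .eq (reg 5) (const 0))

/-- The sign of the preceding component if there is no violation. -/
noncomputable def prevSign (k : ℕ) : Expr :=
  (reg 4 + turn k (reg 5 / const (k + 1))) % const 2

/-- Whether the edge before the current component is violated. -/
noncomputable def violation (k : ℕ) : Expr :=
  let t := (reg 5 / const (k + 1) - const 1) * (reg 1 + const 1) + reg 3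
  boundary k * ((const 1 - op .eq (reg 3) (const 0)) *
    op .lt (cell (t - const 1) ((prevSign k + const 1) % const 2)) (cell t (prevSign k)))

/-- The sign for the next vertex. -/
noncomputable def nextSign (k : ℕ) : Expr :=
  boundary k * ((prevSign k + reg 6) % const 2) + (const 1 - boundary k) * reg 4

variable {s : View} {n k L : ℕ}

theorem val_bit (e : Expr) (a : ℕ) : (bit e a).val inX inZ s = bitAt (e.val inX inZ s) a := rfl

theorem val_star (h0 : s.reg 0 = n) (i a : Expr) :
    (star k i a).val inX inZ s = starNumber n k (i.val inX inZ s) (a.val inX inZ s) := by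
  simp [star, starNumber, h0]

theorem val_key (h0 : s.reg 0 = n) (i : Expr) (x : ℕ) :
    (key k i x).val inX inZ s = maskKey inX n k (i.val inX inZ s) x := by
  simp [key, maskKey, mismatches, val_sum, val_star h0, Function.comp_def]

theorem val_mask (h0 : s.reg 0 = n) (i : Expr) :
    (mask k i).val inX inZ s = bestMask inX n k (i.val inX inZ s) := by
  rw [mask, val_mod, val_minimum, bestMask, bestKey, val_key h0, List.map_map]
  have : ((fun e => e.val inX inZ s) ∘ key k i) = maskKey inX n k (i.val inX inZ s) :=
    funext fun x => val_key h0 i x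
  rw [this]
  rfl

theorem val_bagCost (h0 : s.reg 0 = n) (i : Expr) (u : ℕ) :
    (bagCost k i u).val inX inZ s = maskCost inX inZ n k (i.val inX inZ s) u := by
  simp [bagCost, maskCost, val_sum, val_star h0, val_mask h0, val_bit, Function.comp_def]

theorem val_turn (h0 : s.reg 0 = n) (i : Expr) :
    (turn k i).val inX inZ s = NewmanWatts.turn inX n k (i.val inX inZ s) := by
  simp [turn, NewmanWatts.turn, val_mask h0, val_bit]

theorem val_cell (h0 : s.reg 0 = n) (t u : Expr) : (cell t u).val inX inZ s =
    s.mem (n + 2 * t.val inX inZ s + u.val inX inZ s) := by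
  simp [cell, h0]

theorem val_bags (h0 : s.reg 0 = n) : (bags k).val inX inZ s = numBags n k := by
  simp [bags, h0, numBags]

theorem val_boundary (v : ℕ) (h5 : s.reg 5 = v) : (boundary k).val inX inZ s =
    if v % (k + 1) = 0 ∧ v ≠ 0 then 1 else 0 := by
  simp only [boundary, val_mul, val_eq, val_mod, val_reg, val_const, val_sub, h5]
  by_cases h1 : v % (k + 1) = 0 <;> by_cases h2 : v = 0 <;> simp [h1, h2]

theorem val_prevSign (h0 : s.reg 0 = n) (v u : ℕ) (h5 : s.reg 5 = v) (h4 : s.reg 4 = u) :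
    (prevSign k).val inX inZ s = (u + NewmanWatts.turn inX n k (v / (k + 1))) % 2 := by
  simp [prevSign, val_turn h0, h5, h4]

theorem val_output (h0 : s.reg 0 = n) (v : ℕ) (h5 : s.reg 5 = v)
    (h4 : s.reg 4 = (optState inX inZ n k L (v / (k + 1))).2) :
    (output k).val inX inZ s = outputCode inX inZ n k L v := by
  have hpow : (output.powTwo (reg 5 % const (k + 1)) k).val inX inZ s =
      2 ^ (v % (k + 1) + 2 * k) := by
    have hlt : v % (k + 1) < k + 1 := Nat.mod_lt _ (Nat.succ_pos k)
    simp only [output.powTwo, val_sum, List.map_map, Function.comp_def, val_mul, val_eq, val_mod,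
      val_reg, val_const, h5]
    rw [← List.sum_toFinset _ (List.nodup_range), List.toFinset_range,
      Finset.sum_eq_single (v % (k + 1))]
    · simp
    · intro b _ hb
      rw [if_neg hb.symm, zero_mul]
    · intro h
      exact absurd (Finset.mem_range.2 hlt) h
  simp only [output, val_add, val_mod, val_div, val_const, val_reg, hpow, val_mask h0, h5, h4]
  rfl

end Expr

/-! ## The decoding program: execution -/

section Execution

variable (inX : ℕ → ℕ → ℕ) (inZ : ℕ → ℕ) (n k L : ℕ)

/-- The memory holds the first `t` entries of the table of the dynamic program. -/
def HasTable (t : ℕ) (mem : ℕ → ℕ) : Prop :=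
  ∀ i j u, j ≤ L → u < 2 → i * (L + 1) + j < t →
    -- The cells below `n` are kept free for the output.
    mem (n + 2 * (i * (L + 1) + j) + u) = minCost inX inZ n k i j u

variable {inX inZ n k L}

theorem HasTable.update_of_ge {t : ℕ} {mem : ℕ → ℕ} (h : HasTable inX inZ n k L t mem) {a : ℕ}
    (ha : n + 2 * t ≤ a) (x : ℕ) : HasTable inX inZ n k L t (Function.update mem a x) := by
  intro i j u hj hu ht
  rw [Function.update_of_ne (by omega)]
  exact h i j u hj hu ht

theorem HasTable.update_of_lt {t : ℕ} {mem : ℕ → ℕ} (h : HasTable inX inZ n k L t mem) {a : ℕ}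
    (ha : a < n) (x : ℕ) : HasTable inX inZ n k L t (Function.update mem a x) := by
  intro i j u hj hu ht
  rw [Function.update_of_ne (by omega)]
  exact h i j u hj hu ht

theorem table_index (i j : ℕ) (hj : j ≤ L) :
    (i * (L + 1) + j) / (L + 1) = i ∧ (i * (L + 1) + j) % (L + 1) = j := by
  constructor
  · rw [mul_comm, Nat.mul_add_div (Nat.succ_pos L), Nat.div_eq_of_lt (by omega), add_zero]
  · rw [mul_comm, Nat.mul_add_mod, Nat.mod_eq_of_lt (by omega)]

theorem HasTable.succ {t : ℕ} {mem : ℕ → ℕ} (h : HasTable inX inZ n k L t mem)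
    (h0 : mem (n + 2 * t) = minCost inX inZ n k (t / (L + 1)) (t % (L + 1)) 0)
    (h1 : mem (n + 2 * t + 1) = minCost inX inZ n k (t / (L + 1)) (t % (L + 1)) 1) :
    HasTable inX inZ n k L (t + 1) mem := by
  intro i j u hj hu ht
  rcases Nat.lt_succ_iff_lt_or_eq.1 ht with hlt | rfl
  · exact h i j u hj hu hlt
  · obtain ⟨h2, h3⟩ := table_index (L := L) i j hj
    rw [h2, h3] at h0 h1
    have hu' : u = 0 ∨ u = 1 := by omega
    rcases hu' with rfl | rfl
    · exact h0
    · exact h1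

/-- The recursion refers to indices L + 1 and L + 2 earlier, which are filled already. -/
theorem val_entry {s : View} {t : ℕ} (h0 : s.reg 0 = n) (h1 : s.reg 1 = L) (h2 : s.reg 2 = t)
    (ht : HasTable inX inZ n k L t s.mem) (u : ℕ) :
    (Expr.entry k u).val inX inZ s = minCost inX inZ n k (t / (L + 1)) (t % (L + 1)) u := by
  simp only [Expr.entry, Expr.val_add, Expr.val_mul, Expr.val_sub, Expr.val_eq, Expr.val_div,
    Expr.val_mod, Expr.val_reg, Expr.val_const, Expr.val_bagCost h0, Expr.val_cell h0,
    Expr.val_turn h0, h1, h2]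
  obtain ⟨i, j, hj, rfl⟩ : ∃ i j, j ≤ L ∧ t = i * (L + 1) + j :=
    ⟨t / (L + 1), t % (L + 1), Nat.le_of_lt_succ (Nat.mod_lt t (Nat.succ_pos L)),
      by rw [mul_comm]; exact (Nat.div_add_mod t (L + 1)).symm⟩
  obtain ⟨e1, e2⟩ := table_index (L := L) i j hj
  simp only [e1, e2]
  rcases i with _ | i
  · simp [minCost]
  · have e3 : (i + 1) * (L + 1) + j - (L + 1) = i * (L + 1) + j := by
      rw [Nat.succ_mul]; omega
    have e4 : (i + 1) * (L + 1) + j = i * (L + 1) + j + (L + 1) := by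
      rw [Nat.succ_mul]; omega
    have hc := ht i j ((u + turn inX n k (i + 1)) % 2) hj (Nat.mod_lt _ (by omega)) (by omega)
    rw [e3, hc, minCost]
    by_cases hj0 : j = 0
    · simp [hj0]
    · have e5 : i * (L + 1) + j - 1 = i * (L + 1) + (j - 1) := by omega
      have hc' := ht i (j - 1) (((u + turn inX n k (i + 1)) % 2 + 1) % 2) (by omega)
        (Nat.mod_lt _ (by omega)) (by omega)
      rw [e5, hc']
      simp only [if_neg hj0, Nat.succ_ne_zero, if_false]
      omega

end Execution

/-- Filling the table of the dynamic program. -/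
noncomputable def tableBody (k : ℕ) : Program :=
  .seq (.storeAt (.reg 0 + .const 2 * .reg 2) (Expr.entry k 0))
    (.seq (.storeAt (.reg 0 + .const 2 * .reg 2 + .const 1) (Expr.entry k 1))
      (.assign 2 (.reg 2 + .const 1)))

/-- The condition for filling the table. -/
def tableCond (k : ℕ) : Expr := .op .lt (.reg 2) (Expr.bags k * (.reg 1 + .const 1))

/-- Writing the output and following the optimum backwards. -/
noncomputable def outputBody (k : ℕ) : Program :=
  .seq (.assign 5 (.reg 5 - .const 1))
    (.seq (.storeAt (.reg 5) (Expr.output k))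
      -- The violation is computed from the old sign and budget, and the new sign uses it, so
      -- registers 6, 4, 3 are updated in this order.
      (.seq (.assign 6 (Expr.violation k))
        (.seq (.assign 4 (Expr.nextSign k)) (.assign 3 (.reg 3 - .reg 6)))))

/-- The decoding program. -/
noncomputable def ringProgram (k : ℕ) : Program :=
  -- Registers: 0 holds n, 1 the budget, 2 the table index, 3 the remaining budget, 4 the current
  -- sign, 5 the vertex counter, 6 the violation.
  .seq (.whileNonzero (tableCond k) (tableBody k))
    (.seq (.assign 3 (.reg 1))
      (.seq (.assign 4 (Expr.lastSign k))
        (.seq (.assign 5 (.reg 0)) (.whileNonzero (.reg 5) (outputBody k)))))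

/-- A bound for the growth of all expressions of the program. -/
noncomputable def programGrowth (k : ℕ) : ℕ :=
  (Expr.entry k 0).growth + (Expr.entry k 1).growth + (tableCond k).growth +
    (Expr.output k).growth + (Expr.violation k).growth + (Expr.nextSign k).growth +
    (Expr.lastSign k).growth + 20

/-- The running time of the body of the first loop. -/
noncomputable def tableBodyCost (k : ℕ) : ℕ :=
  (.reg 0 + .const 2 * .reg 2 : Expr).cost + ((Expr.entry k 0).cost + 1) +
    ((.reg 0 + .const 2 * .reg 2 + .const 1 : Expr).cost + ((Expr.entry k 1).cost + 1) +
      ((.reg 2 + .const 1 : Expr).cost + 2))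

/-- The running time of the body of the second loop. -/
noncomputable def outputBodyCost (k : ℕ) : ℕ :=
  (.reg 5 - .const 1 : Expr).cost + 2 +
    ((Expr.reg 5).cost + ((Expr.output k).cost + 1) +
      ((Expr.violation k).cost + 2 +
        ((Expr.nextSign k).cost + 2 + ((.reg 3 - .reg 6 : Expr).cost + 2))))

/-! ### Loop invariants and the total running time -/

section Loops

variable {inX : ℕ → ℕ → ℕ} {inZ : ℕ → ℕ} {n k L M B : ℕ}

/-- The invariant of the first loop. -/
def TableInv (inX : ℕ → ℕ → ℕ) (inZ : ℕ → ℕ) (n k L M t : ℕ) (s : View) : Prop :=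
  s.BoundedBy M ∧ s.reg 0 = n ∧ s.reg 1 = L ∧ s.reg 2 = t ∧ HasTable inX inZ n k L t s.mem

/-- The invariant of the second loop, when the vertices from `v` on have been labelled. -/
def OutputInv (inX : ℕ → ℕ → ℕ) (inZ : ℕ → ℕ) (n k L M v : ℕ) (s : View) : Prop :=
  s.BoundedBy M ∧ s.reg 0 = n ∧ s.reg 1 = L ∧ s.reg 5 = v ∧
    -- The quotient is the component of the next vertex to be labelled; at v = 0 the truncated value
    -- is harmless.
    s.reg 3 = (optState inX inZ n k L ((v - 1) / (k + 1))).1 ∧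
    s.reg 4 = (optState inX inZ n k L ((v - 1) / (k + 1))).2 ∧
    HasTable inX inZ n k L (numBags n k * (L + 1)) s.mem ∧
    ∀ v', v ≤ v' → v' < n → s.mem v' = outputCode inX inZ n k L v'

theorem View.setReg_reg (s : View) (x : Fin 8) (a : ℕ) (r : Fin 8) :
    (s.setReg x a).reg r = if r = x then a else s.reg r := by
  by_cases h : r = x
  · subst h; simp [View.setReg]
  · simp [View.setReg, h]

theorem View.setReg_mem (s : View) (x : Fin 8) (a : ℕ) : (s.setReg x a).mem = s.mem := rfl

theorem View.setMem_reg (s : View) (a b : ℕ) : (s.setMem a b).reg = s.reg := rfl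

theorem View.setMem_mem (s : View) (a b : ℕ) : (s.setMem a b).mem = Function.update s.mem a b := rfl

theorem growth_add (a b : Expr) : (a + b).growth = a.growth + b.growth + 1 := rfl

theorem growth_sub (a b : Expr) : (a - b).growth = a.growth + b.growth + 1 := rfl

theorem growth_mul (a b : Expr) : (a * b).growth = a.growth + b.growth + 1 := rfl

theorem growth_const (c : ℕ) : (Expr.const c).growth = c := rfl

theorem growth_reg (r : Fin 8) : (Expr.reg r).growth = 1 := rfl

theorem minCost_le_of_lt {i : ℕ} (hi : i < numBags n k) (hn : 2 * k + 1 ≤ n)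
    (hM : n * n ≤ M) (j u : ℕ) : minCost inX inZ n k i j u ≤ M := by
  refine (minCost_le inX inZ n k i j u).trans (le_trans ?_ hM)
  exact Nat.mul_le_mul hn ((Nat.succ_le_of_lt hi).trans (numBags_le k (by omega)))

theorem runs_tableBody (hn : 2 * k + 1 ≤ n) (hM : n * n ≤ M) (hM' : n * (L + 1) ≤ M)
    (hM2 : 2 ≤ M) (hX : ∀ a b, inX a b ≤ 2) (hZ : ∀ a, inZ a ≤ 2)
    (hB : M ^ programGrowth k ≤ B) {t : ℕ} (ht : t < numBags n k * (L + 1)) {s : View}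
    (hs : TableInv inX inZ n k L M t s) :
    Runs inX inZ B (tableBody k) s (tableBodyCost k) (TableInv inX inZ n k L M (t + 1)) := by
  have hg : ∀ g, g ≤ programGrowth k → M ^ g ≤ B := fun g hg =>
    (Nat.pow_le_pow_right (by omega) hg).trans hB
  obtain ⟨hb, h0, h1, h2, htab⟩ := hs
  have hti : t / (L + 1) < numBags n k := Nat.div_lt_of_lt_mul (by rwa [mul_comm])
  have hnb : numBags n k * (L + 1) ≤ n * (L + 1) := Nat.mul_le_mul_right _ (numBags_le k (by omega))
  unfold tableBody tableBodyCost
  refine Runs.seq (runs_storeAt hM2 hX hZ hb _ _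
    (hg _ (by simp only [programGrowth, growth_add, growth_mul, growth_const, growth_reg]; omega))
    (hg _ (by simp only [programGrowth]; omega))) fun s₁ hs₁ => ?_
  have ha₁ : (.reg 0 + .const 2 * .reg 2 : Expr).val inX inZ s = n + 2 * t := by simp [h0, h2]
  rw [ha₁, val_entry h0 h1 h2 htab] at hs₁
  have hb₁ : s₁.BoundedBy M := by
    rw [hs₁]; exact hb.setMem _ (minCost_le_of_lt hti hn hM _ _)
  have hm₁ : s₁.mem = Function.update s.mem (n + 2 * t)
      (minCost inX inZ n k (t / (L + 1)) (t % (L + 1)) 0) := by rw [hs₁, View.setMem_mem]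
  have hr₁ : s₁.reg = s.reg := by rw [hs₁, View.setMem_reg]
  -- The first store hits a cell beyond the filled part of the table, so the second entry is still
  -- computed from correct values.
  have htab₁ : HasTable inX inZ n k L t s₁.mem := by
    rw [hm₁]; exact htab.update_of_ge le_rfl _
  refine Runs.seq (runs_storeAt hM2 hX hZ hb₁ _ _
    (hg _ (by simp only [programGrowth, growth_add, growth_mul, growth_const, growth_reg]; omega))
    (hg _ (by simp only [programGrowth]; omega))) fun s₂ hs₂ => ?_
  have ha₂ : (.reg 0 + .const 2 * .reg 2 + .const 1 : Expr).val inX inZ s₁ = n + 2 * t + 1 := by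
    simp [hr₁, h0, h2]
  rw [ha₂, val_entry (by rw [hr₁, h0]) (by rw [hr₁, h1]) (by rw [hr₁, h2]) htab₁] at hs₂
  have hb₂ : s₂.BoundedBy M := by
    rw [hs₂]; exact hb₁.setMem _ (minCost_le_of_lt hti hn hM _ _)
  have hm₂ : s₂.mem = Function.update s₁.mem (n + 2 * t + 1)
      (minCost inX inZ n k (t / (L + 1)) (t % (L + 1)) 1) := by rw [hs₂, View.setMem_mem]
  have hr₂ : s₂.reg = s.reg := by rw [hs₂, View.setMem_reg, hr₁]
  have htab₂ : HasTable inX inZ n k L (t + 1) s₂.mem := by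
    refine HasTable.succ ?_ ?_ ?_
    · rw [hm₂]; exact htab₁.update_of_ge (by omega) _
    · rw [hm₂, Function.update_of_ne (by omega), hm₁, Function.update_self]
    · rw [hm₂, Function.update_self]
  intro σ hσ
  obtain ⟨τ, c, h3, h4, h5⟩ := runs_assign hM2 hX hZ hb₂ 2 (.reg 2 + .const 1)
    (hg _ (by simp only [programGrowth, growth_add, growth_const, growth_reg]; omega)) σ hσ
  refine ⟨τ, c, h3, h4, ?_⟩
  have hv : (.reg 2 + .const 1 : Expr).val inX inZ s₂ = t + 1 := by simp [hr₂, h2]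
  rw [h5, hv]
  refine ⟨hb₂.setReg _ (by omega), ?_, ?_, ?_, htab₂⟩ <;>
    simp [View.setReg_reg, hr₂, h0, h1]

/-- Going down through the vertices, the component changes exactly after a non-zero multiple of k+1.
-/
theorem boundary_cases (k v : ℕ) :
    (v % (k + 1) = 0 ∧ v ≠ 0 ∧ (v - 1) / (k + 1) + 1 = v / (k + 1)) ∨
      (¬ (v % (k + 1) = 0 ∧ v ≠ 0) ∧ (v - 1) / (k + 1) = v / (k + 1)) := by
  have hv := Nat.div_add_mod v (k + 1)
  have hr : v % (k + 1) < k + 1 := Nat.mod_lt v (Nat.succ_pos k)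
  generalize v / (k + 1) = i at *
  generalize v % (k + 1) = r at *
  rcases Nat.eq_zero_or_pos r with rfl | hr0
  · rcases i with _ | i
    · right
      have : v = 0 := by simpa using hv.symm
      subst this
      simp
    · left
      have h1 : (k + 1) * (i + 1) = (k + 1) * i + (k + 1) := by ring
      refine ⟨rfl, by omega, ?_⟩
      have h2 : v - 1 = (k + 1) * i + k := by omega
      rw [h2, Nat.mul_add_div (Nat.succ_pos k), Nat.div_eq_of_lt (Nat.lt_succ_self k), add_zero]
  · right
    refine ⟨by omega, ?_⟩
    have h2 : v - 1 = (k + 1) * i + (r - 1) := by omega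
    rw [h2, Nat.mul_add_div (Nat.succ_pos k), Nat.div_eq_of_lt (by omega), add_zero]

theorem optState_pred {i : ℕ} (hi : i + 1 < numBags n k) :
    optState inX inZ n k L i =
      ((optState inX inZ n k L (i + 1)).1 - violated inX inZ n k (i + 1)
        (optState inX inZ n k L (i + 1)).1 (optState inX inZ n k L (i + 1)).2,
      (((optState inX inZ n k L (i + 1)).2 + turn inX n k (i + 1)) % 2 +
        violated inX inZ n k (i + 1)
        (optState inX inZ n k L (i + 1)).1 (optState inX inZ n k L (i + 1)).2) % 2) := by
  have h1 : numBags n k - 1 - i = (numBags n k - 1 - (i + 1)) + 1 := by omega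
  have h2 : numBags n k - 1 - (numBags n k - 1 - (i + 1)) = i + 1 := by omega
  unfold optState
  rw [h1, backtrack, h2]

theorem val_violation {s : View} {v j u : ℕ} (h0 : s.reg 0 = n) (h1 : s.reg 1 = L)
    (h5 : s.reg 5 = v) (h3 : s.reg 3 = j) (h4 : s.reg 4 = u) (hj : j ≤ L)
    (hv : v / (k + 1) < numBags n k)
    (ht : HasTable inX inZ n k L (numBags n k * (L + 1)) s.mem) :
    (Expr.violation k).val inX inZ s =
      if v % (k + 1) = 0 ∧ v ≠ 0 then violated inX inZ n k (v / (k + 1)) j u else 0 := by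
  simp only [Expr.violation, Expr.val_mul, Expr.val_boundary v h5, Expr.val_sub, Expr.val_const,
    Expr.val_eq, Expr.val_lt, Expr.val_cell h0, Expr.val_add, Expr.val_div, Expr.val_reg, Expr.val_mod,
    Expr.val_prevSign h0 v u h5 h4, h1, h5, h3]
  by_cases hbd : v % (k + 1) = 0 ∧ v ≠ 0
  · simp only [if_pos hbd, one_mul]
    rcases boundary_cases k v with ⟨-, -, hi⟩ | ⟨h, -⟩
    swap
    · exact absurd hbd h
    rw [← hi] at hv ⊢
    generalize (v - 1) / (k + 1) = i at *
    have hlt : ∀ j ≤ L, i * (L + 1) + j < numBags n k * (L + 1) := by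
      intro j hj
      have : (i + 1) * (L + 1) ≤ numBags n k * (L + 1) := Nat.mul_le_mul_right _ hv.le
      rw [Nat.succ_mul] at this
      omega
    rw [Nat.add_sub_cancel, ht i j _ hj (Nat.mod_lt _ (by omega)) (hlt j hj), violated,
      Nat.add_sub_cancel]
    by_cases hj0 : j = 0
    · simp [hj0]
    · have e5 : i * (L + 1) + j - 1 = i * (L + 1) + (j - 1) := by omega
      rw [e5, ht i (j - 1) _ (by omega) (Nat.mod_lt _ (by omega)) (hlt _ (by omega))]
      simp [hj0]
  · simp only [if_neg hbd, zero_mul]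

theorem runs_outputBody (hn : 0 < n) (hM' : n * (L + 1) ≤ M)
    (hM2 : 2 ≤ M) (hX : ∀ a b, inX a b ≤ 2) (hZ : ∀ a, inZ a ≤ 2)
    (hB : M ^ programGrowth k ≤ B) {v : ℕ} (hvn : v < n) {s : View}
    (hs : OutputInv inX inZ n k L M (v + 1) s) :
    Runs inX inZ B (outputBody k) s (outputBodyCost k) (OutputInv inX inZ n k L M v) := by
  have hg : ∀ g, g ≤ programGrowth k → M ^ g ≤ B := fun g hg =>
    (Nat.pow_le_pow_right (by omega) hg).trans hB
  have hnM : n ≤ M := (Nat.le_mul_of_pos_right n (Nat.succ_pos L)).trans hM'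
  have hLM : L ≤ M := le_trans (by nlinarith) hM'
  obtain ⟨hb, h0, h1, h5, h3, h4, htab, hout⟩ := hs
  rw [Nat.add_sub_cancel] at h3 h4
  set i := v / (k + 1) with hi
  have him : i < numBags n k := lt_numBags (lt_of_le_of_lt (Nat.div_mul_le_self v (k + 1)) hvn)
  set j := (optState inX inZ n k L i).1 with hj
  set u := (optState inX inZ n k L i).2 with hu
  have hjL : j ≤ L := (backtrack_le inX inZ n k L _).1
  have hu2 : u < 2 := (backtrack_le inX inZ n k L _).2
  unfold outputBody outputBodyCost
  refine Runs.seq (runs_assign hM2 hX hZ hb _ _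
    (hg _ (by simp only [programGrowth, growth_sub, growth_const, growth_reg]; omega)))
    fun s₁ hs₁ => ?_
  have hv₁ : (.reg 5 - .const 1 : Expr).val inX inZ s = v := by simp [h5]
  rw [hv₁] at hs₁
  have hb₁ : s₁.BoundedBy M := by rw [hs₁]; exact hb.setReg _ (by omega)
  have hm₁ : s₁.mem = s.mem := by rw [hs₁, View.setReg_mem]
  have hr₁ : s₁.reg 0 = n ∧ s₁.reg 1 = L ∧ s₁.reg 5 = v ∧ s₁.reg 3 = j ∧ s₁.reg 4 = u := by
    rw [hs₁]; simp [View.setReg_reg, h0, h1, h3, h4]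
  obtain ⟨h0₁, h1₁, h5₁, h3₁, h4₁⟩ := hr₁
  refine Runs.seq (runs_storeAt hM2 hX hZ hb₁ _ _
    (hg _ (by simp only [programGrowth, growth_reg]; omega))
    (hg _ (by simp only [programGrowth]; omega))) fun s₂ hs₂ => ?_
  rw [Expr.val_output h0₁ v h5₁ h4₁, Expr.val_reg, h5₁] at hs₂
  have hb₂ : s₂.BoundedBy M := by
    rw [hs₂]
    refine hb₁.setMem _ ?_
    unfold outputCode
    omega
  have hm₂ : s₂.mem = Function.update s.mem v (outputCode inX inZ n k L v) := by
    rw [hs₂, View.setMem_mem, hm₁]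
  have hr₂ : s₂.reg = s₁.reg := by rw [hs₂, View.setMem_reg]
  have htab₂ : HasTable inX inZ n k L (numBags n k * (L + 1)) s₂.mem := by
    rw [hm₂]; exact htab.update_of_lt hvn _
  refine Runs.seq (runs_assign hM2 hX hZ hb₂ _ _
    (hg _ (by simp only [programGrowth]; omega))) fun s₃ hs₃ => ?_
  rw [val_violation (by rw [hr₂, h0₁]) (by rw [hr₂, h1₁]) (by rw [hr₂, h5₁]) (by rw [hr₂, h3₁])
    (by rw [hr₂, h4₁]) hjL him htab₂] at hs₃
  set x := if v % (k + 1) = 0 ∧ v ≠ 0 then violated inX inZ n k (v / (k + 1)) j u else 0 with hx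
  have hx1 : x ≤ 1 := by
    rw [hx]; unfold violated; split_ifs <;> omega
  have hb₃ : s₃.BoundedBy M := by rw [hs₃]; exact hb₂.setReg _ (by omega)
  have hm₃ : s₃.mem = s₂.mem := by rw [hs₃, View.setReg_mem]
  have hr₃ : s₃.reg 0 = n ∧ s₃.reg 1 = L ∧ s₃.reg 5 = v ∧ s₃.reg 3 = j ∧ s₃.reg 4 = u ∧
      s₃.reg 6 = x := by
    rw [hs₃]; simp [View.setReg_reg, hr₂, h0₁, h1₁, h3₁, h4₁, h5₁]
  obtain ⟨h0₃, h1₃, h5₃, h3₃, h4₃, h6₃⟩ := hr₃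
  refine Runs.seq (runs_assign hM2 hX hZ hb₃ _ _
    (hg _ (by simp only [programGrowth]; omega))) fun s₄ hs₄ => ?_
  set u' := if v % (k + 1) = 0 ∧ v ≠ 0 then ((u + turn inX n k i) % 2 + x) % 2 else u with hu'
  have hval₄ : (Expr.nextSign k).val inX inZ s₃ = u' := by
    simp only [Expr.nextSign, Expr.val_add, Expr.val_mul, Expr.val_mod, Expr.val_sub,
      Expr.val_const, Expr.val_reg, Expr.val_boundary v h5₃, Expr.val_prevSign h0₃ v u h5₃ h4₃,
      h6₃, h4₃, hu']
    split_ifs <;> simp [hi]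
  rw [hval₄] at hs₄
  have hu2' : u' < 2 := by rw [hu']; split_ifs <;> omega
  have hb₄ : s₄.BoundedBy M := by rw [hs₄]; exact hb₃.setReg _ (by omega)
  have hm₄ : s₄.mem = s₂.mem := by rw [hs₄, View.setReg_mem, hm₃]
  have hr₄ : s₄.reg 0 = n ∧ s₄.reg 1 = L ∧ s₄.reg 5 = v ∧ s₄.reg 3 = j ∧ s₄.reg 4 = u' ∧
      s₄.reg 6 = x := by
    rw [hs₄]; simp [View.setReg_reg, h0₃, h1₃, h3₃, h5₃, h6₃]
  obtain ⟨h0₄, h1₄, h5₄, h3₄, h4₄, h6₄⟩ := hr₄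
  intro σ hσ
  obtain ⟨τ, c, hc1, hc2, hc3⟩ := runs_assign hM2 hX hZ hb₄ 3 (.reg 3 - .reg 6)
    (hg _ (by simp only [programGrowth, growth_sub, growth_reg]; omega)) σ hσ
  refine ⟨τ, c, hc1, hc2, ?_⟩
  have hv : (.reg 3 - .reg 6 : Expr).val inX inZ s₄ = j - x := by simp [h3₄, h6₄]
  rw [hc3, hv]
  -- The trace of the optimum advances only when `v` is the first vertex of its component; otherwise
  -- budget and sign are carried over.
  have hnext : optState inX inZ n k L ((v - 1) / (k + 1)) = (j - x, u') := by
    rcases boundary_cases k v with ⟨h7, h8, h9⟩ | ⟨h7, h8⟩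
    · rw [optState_pred (by omega), h9, ← hi, hu', hx, if_pos ⟨h7, h8⟩, if_pos ⟨h7, h8⟩]
    · rw [h8, hu', hx, if_neg h7, if_neg h7]
      rfl
  refine ⟨hb₄.setReg _ (by omega), ?_, ?_, ?_, ?_, ?_, ?_, ?_⟩
  · simp [View.setReg_reg, h0₄]
  · simp [View.setReg_reg, h1₄]
  · simp [View.setReg_reg, h5₄]
  · rw [hnext]; simp [View.setReg_reg]
  · rw [hnext]; simp [View.setReg_reg, h4₄]
  · rw [View.setReg_mem, hm₄]; exact htab₂
  · intro v' hv1 hv2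
    rw [View.setReg_mem, hm₄, hm₂]
    rcases eq_or_lt_of_le hv1 with rfl | hlt
    · rw [Function.update_self]
    · rw [Function.update_of_ne (by omega)]
      exact hout v' hlt hv2

/-- A constant for the running time of the program. -/
noncomputable def programCost (k : ℕ) : ℕ :=
  tableBodyCost k + outputBodyCost k + 2 * (tableCond k).cost + (Expr.lastSign k).cost + 40

/-- The table has at most n(L+1) indices and the output loop n rounds, each costing a constant that
depends only on k. -/
theorem runs_ringProgram (hn : 2 * k + 1 ≤ n) (hM : n * n ≤ M) (hM' : n * (L + 1) ≤ M)
    (hM2 : 2 ≤ M) (hX : ∀ a b, inX a b ≤ 2) (hZ : ∀ a, inZ a ≤ 2)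
    (hB : M ^ programGrowth k ≤ B) :
    Runs inX inZ B (ringProgram k) (initState n L).view (programCost k * ((L + 1) * n))
      (fun s => ∀ v < n, s.mem v = outputCode inX inZ n k L v) := by
  have hg : ∀ g, g ≤ programGrowth k → M ^ g ≤ B := fun g hg =>
    (Nat.pow_le_pow_right (by omega) hg).trans hB
  have hn0 : 0 < n := by omega
  have hnM : n ≤ M := (Nat.le_mul_of_pos_right n (Nat.succ_pos L)).trans hM'
  have hLM : L ≤ M := le_trans (by nlinarith) hM'
  have hm0 : 0 < numBags n k := lt_numBags (by simpa using hn0)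
  set m := numBags n k with hm
  have hmn : m ≤ n := numBags_le k hn0
  have hinit : TableInv inX inZ n k L M 0 (initState n L).view := by
    refine ⟨⟨fun r => ?_, fun a => Nat.zero_le _⟩, ?_, ?_, ?_, ?_⟩
    · simp only [State.view, initState, Function.update_apply]
      split_ifs <;> omega
    · simp [State.view, initState]
    · simp [State.view, initState]
    · simp [State.view, initState]
    · intro i j u _ _ h
      omega
  have hcond : ∀ t s, TableInv inX inZ n k L M t s →
      (tableCond k).val inX inZ s = if t < m * (L + 1) then 1 else 0 := by
    rintro t s ⟨-, h0, h1, h2, -⟩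
    simp [tableCond, Expr.val_bags h0, h1, h2, hm]
  have hloop₁ := runs_whileNonzero hM2 hX hZ (tableCond k)
    (hg _ (by simp only [programGrowth]; omega)) (tableBody k) (tableBodyCost k) (m * (L + 1))
    (TableInv inX inZ n k L M) (fun _ _ h => h.1)
    (fun t ht s hs => ⟨by rw [hcond t s hs, if_pos ht]; omega,
      runs_tableBody hn hM hM' hM2 hX hZ hB ht hs⟩)
    (fun s hs => by rw [hcond _ s hs, if_neg (lt_irrefl _)]) hinit
  have hmain := Runs.seq (P' := .seq (.assign 3 (.reg 1)) (.seq (.assign 4 (Expr.lastSign k))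
      (.seq (.assign 5 (.reg 0)) (.whileNonzero (.reg 5) (outputBody k)))))
    (Q' := fun s => ∀ v < n, s.mem v = outputCode inX inZ n k L v)
    (T' := (Expr.reg 1).cost + 2 + ((Expr.lastSign k).cost + 2 + ((Expr.reg 0).cost + 2 +
      ((Expr.reg 5).cost + (n * (outputBodyCost k + (Expr.reg 5).cost + 1) + 1)))))
    hloop₁ fun s hs => ?_
  · intro σ hσ
    obtain ⟨τ, c, h1, h2, h3⟩ := hmain σ hσ
    refine ⟨τ, c, h1, h2.trans ?_, h3⟩
    have hLn : 1 ≤ (L + 1) * n := Nat.mul_pos (Nat.succ_pos L) hn0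
    have hnL : n ≤ (L + 1) * n := Nat.le_mul_of_pos_left n (Nat.succ_pos L)
    have hmL : m * (L + 1) ≤ (L + 1) * n := by
      rw [mul_comm]; exact Nat.mul_le_mul_left _ hmn
    simp only [Expr.cost, programCost]
    have e1 := Nat.mul_le_mul_right (tableBodyCost k + (tableCond k).cost + 1) hmL
    have e2 := Nat.mul_le_mul_right (outputBodyCost k + 2 + 1) hnL
    have e3 := Nat.mul_le_mul_left ((tableCond k).cost + (Expr.lastSign k).cost + 20) hLn
    nlinarith
  obtain ⟨hb, h0, h1, h2, htab⟩ := hs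
  refine Runs.seq (runs_assign hM2 hX hZ hb _ _
    (hg _ (by simp only [programGrowth, growth_reg]; omega))) fun s₁ hs₁ => ?_
  rw [Expr.val_reg, h1] at hs₁
  have hb₁ : s₁.BoundedBy M := by rw [hs₁]; exact hb.setReg _ hLM
  have hm₁ : s₁.mem = s.mem := by rw [hs₁, View.setReg_mem]
  have hr₁ : s₁.reg 0 = n ∧ s₁.reg 1 = L ∧ s₁.reg 3 = L := by
    rw [hs₁]; simp [View.setReg_reg, h0, h1]
  obtain ⟨h0₁, h1₁, h3₁⟩ := hr₁
  refine Runs.seq (runs_assign hM2 hX hZ hb₁ _ _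
    (hg _ (by simp only [programGrowth]; omega))) fun s₂ hs₂ => ?_
  have hlast : (Expr.lastSign k).val inX inZ s₁ = (optState inX inZ n k L (m - 1)).2 := by
    have hlt : (m - 1) * (L + 1) + L < m * (L + 1) := by
      obtain ⟨m', hm'⟩ := Nat.exists_eq_succ_of_ne_zero hm0.ne'
      rw [hm', Nat.succ_sub_one, Nat.succ_mul]
      omega
    have c0 := htab (m - 1) L 0 le_rfl (by omega) hlt
    have c1 := htab (m - 1) L 1 le_rfl (by omega) hlt
    simp only [Expr.lastSign, Expr.val_lt, Expr.val_cell h0₁, Expr.val_add, Expr.val_mul,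
      Expr.val_sub, Expr.val_bags h0₁, Expr.val_const, Expr.val_reg, h1₁, hm₁]
    rw [← hm, c0, c1, optState, ← hm, Nat.sub_self, backtrack, ← hm]
  rw [hlast] at hs₂
  have hu2 : (optState inX inZ n k L (m - 1)).2 < 2 := (backtrack_le inX inZ n k L _).2
  have hb₂ : s₂.BoundedBy M := by rw [hs₂]; exact hb₁.setReg _ (by omega)
  have hm₂ : s₂.mem = s.mem := by rw [hs₂, View.setReg_mem, hm₁]
  have hr₂ : s₂.reg 0 = n ∧ s₂.reg 1 = L ∧ s₂.reg 3 = L ∧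
      s₂.reg 4 = (optState inX inZ n k L (m - 1)).2 := by
    rw [hs₂]; simp [View.setReg_reg, h0₁, h1₁, h3₁]
  obtain ⟨h0₂, h1₂, h3₂, h4₂⟩ := hr₂
  refine Runs.seq (runs_assign hM2 hX hZ hb₂ _ _
    (hg _ (by simp only [programGrowth, growth_reg]; omega))) fun s₃ hs₃ => ?_
  rw [Expr.val_reg, h0₂] at hs₃
  have hlastbag : (n - 1) / (k + 1) = m - 1 := by
    have e1 : n + k = (n - 1) + (k + 1) := by omega
    rw [hm, numBags, e1, Nat.add_div_right _ (Nat.succ_pos k)]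
    rfl
  have hinv : OutputInv inX inZ n k L M (n - 0) s₃ := by
    rw [Nat.sub_zero, hs₃]
    refine ⟨hb₂.setReg _ hnM, ?_, ?_, ?_, ?_, ?_, ?_, ?_⟩
    · simp [View.setReg_reg, h0₂]
    · simp [View.setReg_reg, h1₂]
    · simp [View.setReg_reg]
    · rw [hlastbag, optState, ← hm, Nat.sub_self, backtrack]
      simp [View.setReg_reg, h3₂]
    · rw [hlastbag]
      simp [View.setReg_reg, h4₂]
    · rw [View.setReg_mem, hm₂]
      exact htab
    · intro v' hv1 hv2
      omega
  intro σ hσ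
  obtain ⟨τ, c, hc1, hc2, hc3⟩ := runs_whileNonzero hM2 hX hZ (.reg 5)
    (hg _ (by simp only [programGrowth, growth_reg]; omega)) (outputBody k) (outputBodyCost k) n
    -- The loop rule counts rounds upwards while the program runs down through the vertices.
    (fun c s => OutputInv inX inZ n k L M (n - c) s) (fun _ _ h => h.1)
    (fun c hc s hs => by
      refine ⟨by rw [Expr.val_reg, hs.2.2.2.1]; omega, ?_⟩
      have e1 : n - c = (n - (c + 1)) + 1 := by omega
      rw [e1] at hs
      exact runs_outputBody hn0 hM' hM2 hX hZ hB (by omega) hs)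
    (fun s hs => by rw [Expr.val_reg, hs.2.2.2.1, Nat.sub_self]) hinv σ hσ
  refine ⟨τ, c, hc1, hc2, fun v hv => ?_⟩
  exact hc3.2.2.2.2.2.2.2 v (by omega) hv

end Loops

/-! ## The decoding program: correctness -/

/-- The sign with code `b`. -/
def signOf (b : ℕ) : ℤˣ := (-1) ^ b

theorem signOf_add (a b : ℕ) : signOf (a + b) = signOf a * signOf b := pow_add _ _ _

theorem signOf_mod_two (a : ℕ) : signOf (a % 2) = signOf a := by
  conv_rhs => rw [← Nat.div_add_mod a 2]
  rw [signOf_add]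
  unfold signOf
  rw [pow_mul]
  simp

theorem signCode_signOf (b : ℕ) : signCode (signOf b) = 1 + b % 2 := by
  rw [← signOf_mod_two]
  rcases Nat.mod_two_eq_zero_or_one b with h | h <;> rw [h]
  · simp [signOf, signCode]
  · simp [signOf, signCode, show ¬ ((-1 : ℤˣ) = 1) by decide]

theorem signCode_inj (x y : ℤˣ) : signCode x = signCode y ↔ x = y := by
  unfold signCode
  revert x y
  decide

theorem signOf_eq_iff (a b : ℕ) : signOf a = signOf b ↔ a % 2 = b % 2 := by
  rw [← signCode_inj, signCode_signOf, signCode_signOf]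
  omega

theorem exists_signOf (x : ℤˣ) : ∃ b < 2, signOf b = x := by
  rcases Int.units_eq_one_or x with rfl | rfl
  · exact ⟨0, by omega, by simp [signOf]⟩
  · exact ⟨1, by omega, by simp [signOf]⟩

/-- Ensures that the enumeration of masks reaches every labelling of an extended component. -/
theorem exists_bits (K : ℕ) (f : ℕ → ℕ) (hf : ∀ a, f a < 2) :
    ∃ x < 2 ^ K, ∀ a < K, bitAt x a = f a := by
  induction K with
  | zero => exact ⟨0, by simp, fun a ha => absurd ha (Nat.not_lt_zero a)⟩
  | succ K ih =>
    obtain ⟨x, hx, h⟩ := ih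
    refine ⟨x + 2 ^ K * f K, ?_, fun a ha => ?_⟩
    · have : 2 ^ K * f K ≤ 2 ^ K * 1 := Nat.mul_le_mul_left _ (by have := hf K; omega)
      rw [pow_succ]
      omega
    · rcases Nat.lt_succ_iff_lt_or_eq.1 ha with hlt | rfl
      · rw [← h a hlt]
        unfold bitAt
        obtain ⟨d, rfl⟩ : ∃ d, K = a + (d + 1) := ⟨K - a - 1, by omega⟩
        have e : 2 ^ (a + (d + 1)) * f (a + (d + 1)) = 2 ^ a * (2 * (2 ^ d * f (a + (d + 1)))) := by
          rw [pow_add, pow_succ]; ring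
        rw [e, Nat.add_mul_div_left _ _ (by positivity), Nat.add_mul_mod_self_left]
      · unfold bitAt
        rw [Nat.add_mul_div_left _ _ (by positivity), Nat.div_eq_of_lt hx, zero_add,
          Nat.mod_eq_of_lt (hf _)]

theorem inputX_le {n : ℕ} (G : SimpleGraph (Fin n)) (X : G.edgeSet → ℤˣ) (a b : ℕ) :
    inputX G X a b ≤ 2 := by
  unfold inputX signCode
  split_ifs <;> omega

theorem inputZ_le {n : ℕ} (Z : Fin n → ℤˣ) (a : ℕ) : inputZ Z a ≤ 2 := by
  unfold inputZ signCode
  split_ifs <;> omega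

theorem inputX_of_adj {n : ℕ} {H G : SimpleGraph (Fin n)} (hG : H ≤ G) (X : G.edgeSet → ℤˣ)
    {u v : Fin n} (h : H.Adj u v) :
    inputX G X u.val v.val = signCode (discard H G X ⟨s(u, v), h⟩) := by
  have hGuv : s(u, v) ∈ G.edgeSet := hG h
  have hex : ∃ (ha : u.val < n) (hb : v.val < n), s(⟨u.val, ha⟩, ⟨v.val, hb⟩) ∈ G.edgeSet :=
    ⟨u.isLt, v.isLt, hGuv⟩
  rw [inputX, dif_pos hex, discard, dif_pos hGuv]

theorem inputZ_val {n : ℕ} (Z : Fin n → ℤˣ) (v : Fin n) : inputZ Z v.val = signCode (Z v) := by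
  rw [inputZ, dif_pos v.isLt]

/-! ### Minimality of the enumerated mask -/

section Keys

variable (inX : ℕ → ℕ → ℕ) (n k : ℕ)

theorem foldr_min_mem_or_eq (l : List ℕ) (a : ℕ) : l.foldr min a ∈ l ∨ l.foldr min a = a := by
  induction l with
  | nil => exact Or.inr rfl
  | cons b l ih =>
    rw [List.foldr_cons]
    rcases min_choice b (l.foldr min a) with h | h
    · rw [h]; exact Or.inl List.mem_cons_self
    · rw [h]
      exact ih.imp (List.mem_cons_of_mem b) id

theorem foldr_min_le (l : List ℕ) (a : ℕ) {b : ℕ} (hb : b ∈ l) : l.foldr min a ≤ b := by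
  induction l with
  | nil => exact absurd hb List.not_mem_nil
  | cons c l ih =>
    rw [List.foldr_cons]
    rcases List.mem_cons.1 hb with rfl | h
    · exact min_le_left _ _
    · exact (min_le_right _ _).trans (ih h)

/-- A key is a number in base 2^(4k+1) with the mismatches as leading part and the mask as last
digit, so comparison of keys is lexicographic. -/
theorem bestMask_spec (i x : ℕ) (hx : x < 2 ^ (4 * k + 1)) :
    mismatches inX n k i (bestMask inX n k i) ≤ mismatches inX n k i x := by
  obtain ⟨x0, hx0, h0⟩ : ∃ x0 < 2 ^ (4 * k + 1), bestKey inX n k i = maskKey inX n k i x0 := by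
    rcases foldr_min_mem_or_eq ((List.range (2 ^ (4 * k + 1))).map (maskKey inX n k i))
      (maskKey inX n k i 0) with h | h
    · obtain ⟨x0, h1, h2⟩ := List.mem_map.1 h
      exact ⟨x0, List.mem_range.1 h1, h2.symm⟩
    · exact ⟨0, by positivity, h⟩
  have hle : bestKey inX n k i ≤ maskKey inX n k i x :=
    foldr_min_le _ _ (List.mem_map.2 ⟨x, List.mem_range.2 hx, rfl⟩)
  have hmask : bestMask inX n k i = x0 := by
    rw [bestMask, h0, maskKey, mul_comm, Nat.mul_add_mod, Nat.mod_eq_of_lt hx0]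
  rw [hmask]
  rw [h0] at hle
  unfold maskKey at hle
  by_contra hcon
  push Not at hcon
  have := Nat.mul_le_mul_right (2 ^ (4 * k + 1)) (Nat.succ_le_of_lt hcon)
  rw [Nat.succ_mul] at this
  omega

end Keys

/-! ### Correctness of the dynamic program -/

section Optimum

variable (inX : ℕ → ℕ → ℕ) (inZ : ℕ → ℕ) (n k L : ℕ)

/-- Whether the edge between the components `i` and `i + 1` is violated. -/
noncomputable def breakAt (b : ℕ → ℕ) (i : ℕ) : ℕ :=
  if b i = (b (i + 1) + turn inX n k (i + 1)) % 2 then 0 else 1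

/-- The optimality half, by induction along the path: every admissible sign sequence takes, at each
component, one of the branches over which the recursion minimizes. A break implies that the budget
is positive, so the second branch is available. -/
theorem minCost_le_sum (b : ℕ → ℕ) (hb : ∀ i, b i < 2) (i j : ℕ)
    (h : ∑ i' ∈ Finset.range i, breakAt inX n k b i' ≤ j) :
    minCost inX inZ n k i j (b i) ≤
      ∑ i' ∈ Finset.range (i + 1), maskCost inX inZ n k i' (b i') := by
  induction i generalizing j with
  | zero => simp [minCost]
  | succ i ih =>
    rw [Finset.sum_range_succ _ (i + 1), minCost,
      add_comm (∑ i' ∈ Finset.range (i + 1), maskCost inX inZ n k i' (b i'))]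
    refine Nat.add_le_add_left ?_ _
    rw [Finset.sum_range_succ] at h
    set u := (b (i + 1) + turn inX n k (i + 1)) % 2 with hu
    by_cases hbr : b i = u
    · have h1 := ih j (by omega)
      rw [hbr] at h1
      split_ifs
      · exact h1
      · exact (min_le_left _ _).trans h1
    · have hbr1 : breakAt inX n k b i = 1 := if_neg hbr
      have h1 := ih (j - 1) (by omega)
      have hbu : b i = (u + 1) % 2 := by
        have := hb i
        omega
      rw [hbu] at h1
      rw [if_neg (by omega)]
      exact (min_le_right _ _).trans h1

/-- Follows the branch that attains the minimum; ties count as no violation. -/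
theorem minCost_step (i j s : ℕ) : minCost inX inZ n k (i + 1) j s =
    maskCost inX inZ n k (i + 1) s + minCost inX inZ n k i (j - violated inX inZ n k (i + 1) j s)
      (((s + turn inX n k (i + 1)) % 2 + violated inX inZ n k (i + 1) j s) % 2) := by
  rw [minCost]
  congr 1
  unfold violated
  rw [Nat.add_sub_cancel]
  set u := (s + turn inX n k (i + 1)) % 2 with hu
  have hu2 : (u + 0) % 2 = u := by omega
  by_cases hj : j = 0
  · have hu3 : u % 2 = u := hu2
    simp [hj, hu3]
  · rw [if_neg hj]
    split_ifs with h
    · rw [min_eq_right h.2.le]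
    · rw [hu2, Nat.sub_zero, min_eq_left]
      by_contra hcon
      exact h ⟨hj, not_le.1 hcon⟩

theorem violated_le (i j s : ℕ) : violated inX inZ n k i j s ≤ j ∧
    violated inX inZ n k i j s ≤ 1 := by
  unfold violated
  split_ifs with h
  · omega
  · omega

/-- Two quantities are conserved along the trace: cost paid plus cost still to come, and budget
spent plus budget left. -/
theorem backtrack_sum (d : ℕ) (hd : d < numBags n k) :
    minCost inX inZ n k (numBags n k - 1) L (backtrack inX inZ n k L 0).2 =
      minCost inX inZ n k (numBags n k - 1 - d) (backtrack inX inZ n k L d).1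
        (backtrack inX inZ n k L d).2 + ∑ d' ∈ Finset.range d,
          maskCost inX inZ n k (numBags n k - 1 - d') (backtrack inX inZ n k L d').2 ∧
    (backtrack inX inZ n k L d).1 + ∑ d' ∈ Finset.range d,
      violated inX inZ n k (numBags n k - 1 - d') (backtrack inX inZ n k L d').1
        (backtrack inX inZ n k L d').2 = L := by
  induction d with
  | zero => exact ⟨rfl, rfl⟩
  | succ d ih =>
    obtain ⟨h1, h2⟩ := ih (by omega)
    have e : numBags n k - 1 - d = (numBags n k - 1 - (d + 1)) + 1 := by omega
    rw [Finset.sum_range_succ, Finset.sum_range_succ]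
    constructor
    · rw [h1, e, minCost_step, ← e]
      simp only [backtrack]
      ring
    · have h3 := (violated_le inX inZ n k (numBags n k - 1 - d) (backtrack inX inZ n k L d).1
        (backtrack inX inZ n k L d).2).1
      simp only [backtrack]
      omega

/-- The code of the sign of the component `i` in the optimum. -/
noncomputable def optSign (i : ℕ) : ℕ := (optState inX inZ n k L i).2

/-- The attainment half: at the first component the remaining minimal cost is its own cost, so the
conserved cost becomes the full sum. -/
theorem sum_optSign (hm : 0 < numBags n k) :
    ∑ i ∈ Finset.range (numBags n k), maskCost inX inZ n k i (optSign inX inZ n k L i) =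
      minCost inX inZ n k (numBags n k - 1) L (optSign inX inZ n k L (numBags n k - 1)) := by
  have h := (backtrack_sum inX inZ n k L (numBags n k - 1) (by omega)).1
  rw [Nat.sub_self, minCost] at h
  rw [← Finset.sum_range_reflect, optSign, optState, Nat.sub_self, h]
  obtain ⟨m, hm'⟩ : ∃ m, numBags n k = m + 1 := ⟨numBags n k - 1, by omega⟩
  rw [hm', Finset.sum_range_succ, add_comm]
  simp only [optSign, optState, hm', Nat.add_sub_cancel]
  congr 1
  · simp
  · refine Finset.sum_congr rfl fun d hd => ?_
    have := Finset.mem_range.1 hd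
    congr 4
    omega

/-- A break occurs in the trace only where a violation was charged to the budget. -/
theorem sum_breakAt_optSign :
    ∑ i ∈ Finset.range (numBags n k - 1), breakAt inX n k (optSign inX inZ n k L) i ≤ L := by
  rcases Nat.eq_zero_or_pos (numBags n k) with hm | hm
  · simp [hm]
  have h := (backtrack_sum inX inZ n k L (numBags n k - 1) (by omega)).2
  rw [← Finset.sum_range_reflect]
  refine le_trans (Finset.sum_le_sum fun d hd => ?_) (le_trans (Nat.le_add_left _ _) h.le)
  have hd := Finset.mem_range.1 hd
  have e1 : numBags n k - 1 - 1 - d + 1 = numBags n k - 1 - d := by omega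
  have e2 := optState_pred (inX := inX) (inZ := inZ) (n := n) (k := k) (L := L)
    (i := numBags n k - 1 - 1 - d) (by omega)
  have e3 : optState inX inZ n k L (numBags n k - 1 - d) = backtrack inX inZ n k L d := by
    unfold optState
    congr 1
    omega
  have e4 : optSign inX inZ n k L (numBags n k - 1 - 1 - d) = _ := congrArg Prod.snd e2
  have h5 := violated_le inX inZ n k (numBags n k - 1 - d) (backtrack inX inZ n k L d).1
        (backtrack inX inZ n k L d).2
  rw [e1, e3] at e4
  have e5 : optSign inX inZ n k L (numBags n k - 1 - d) = (backtrack inX inZ n k L d).2 := by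
    rw [optSign, e3]
  unfold breakAt
  rw [e1, e4, e5]
  split_ifs with hif
  · omega
  · simp only at hif
    omega

theorem minCost_optSign_le (u : ℕ) (hu : u < 2) :
    minCost inX inZ n k (numBags n k - 1) L (optSign inX inZ n k L (numBags n k - 1)) ≤
      minCost inX inZ n k (numBags n k - 1) L u := by
  have hu' : u = 0 ∨ u = 1 := by omega
  rw [optSign, optState, Nat.sub_self, backtrack]
  dsimp only
  split_ifs with h <;> rcases hu' with rfl | rfl <;> omega

end Optimum

/-! ### Violations on a path as a sum over consecutive indices -/

section PathGraph

theorem violations_pathGraph {m : ℕ} (S : Sym2 (Fin m) → ℤˣ) (s : Fin m → ℤˣ)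
    (f : ℕ → ℕ) (hf : ∀ (i : ℕ) (h : i + 1 < m), f i =
      if s ⟨i, by omega⟩ * s ⟨i + 1, h⟩ ≠ S s(⟨i, by omega⟩, ⟨i + 1, h⟩) then 1 else 0) :
    violations (SimpleGraph.pathGraph m) S s = ∑ i ∈ Finset.range (m - 1), f i := by
  classical
  have h1 : ∑ i ∈ Finset.range (m - 1), f i =
      ((Finset.range (m - 1)).filter fun i => f i = 1).card := by
    rw [Finset.card_filter]
    refine Finset.sum_congr rfl fun i hi => ?_
    have := Finset.mem_range.1 hi
    rw [hf i (by omega)]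
    split_ifs <;> simp_all
  rw [h1]
  unfold violations
  symm
  refine Finset.card_bij (fun i hi => s(⟨i, by
    have := Finset.mem_range.1 (Finset.mem_filter.1 hi).1; omega⟩, ⟨i + 1, by
    have := Finset.mem_range.1 (Finset.mem_filter.1 hi).1; omega⟩)) ?_ ?_ ?_
  · intro i hi
    obtain ⟨hi1, hi2⟩ := Finset.mem_filter.1 hi
    have := Finset.mem_range.1 hi1
    rw [hf i (by omega)] at hi2
    refine Finset.mem_filter.2 ⟨by simp [SimpleGraph.pathGraph_adj], ?_⟩
    by_contra hcon
    rw [edgeSign_mk] at hcon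
    rw [if_neg (not_not.2 hcon)] at hi2
    omega
  · intro i _ j _ h
    rcases Sym2.eq_iff.1 h with ⟨h1, -⟩ | ⟨h1, h2⟩
    · exact congrArg Fin.val h1
    · have h1 := congrArg Fin.val h1
      have h2 := congrArg Fin.val h2
      simp only at h1 h2
      omega
  · intro e he
    obtain ⟨he1, he2⟩ := Finset.mem_filter.1 he
    have key : ∀ (i j : Fin m), i.val + 1 = j.val → edgeSign s s(i, j) ≠ S s(i, j) →
        i.val ∈ (Finset.range (m - 1)).filter fun i => f i = 1 := by
      intro i j hij hne
      have hj := j.isLt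
      have hj' : (⟨i.val + 1, by omega⟩ : Fin m) = j := Fin.ext hij
      refine Finset.mem_filter.2 ⟨Finset.mem_range.2 (by omega), ?_⟩
      rw [hf i.val (by omega), hj']
      exact if_pos hne
    induction e using Sym2.inductionOn with
    | _ i j =>
      have hadj := SimpleGraph.pathGraph_adj.1 (SimpleGraph.mem_edgeFinset.1 he1)
      rcases hadj with h | h
      · refine ⟨i.val, key i j h he2, ?_⟩
        congr 2
      · rw [Sym2.eq_swap] at he2 ⊢
        refine ⟨j.val, key j i h he2, ?_⟩
        congr 2

end PathGraph

theorem disagreement_eq_card {V β : Type} [Fintype V] {H : SimpleGraph V} {X : H.edgeSet → ℤˣ}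
    {A : Finset V} {y : V → ℤˣ} (T : Finset β) (f : ∀ b ∈ T, H.edgeSet)
    (hf : ∀ b hb, (∀ v ∈ (f b hb).1, v ∈ A) ∧ edgeSign y (f b hb).1 ≠ X (f b hb))
    (hinj : ∀ b hb b' hb', f b hb = f b' hb' → b = b')
    (hsurj : ∀ e : H.edgeSet, (∀ v ∈ e.1, v ∈ A) → edgeSign y e.1 ≠ X e →
      ∃ b hb, f b hb = e) : disagreement H X A y = T.card := by
  classical
  unfold disagreement
  symm
  refine Finset.card_bij f (fun b hb => ?_) (fun b hb b' hb' => hinj b hb b' hb') fun e he => ?_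
  · rw [Finset.mem_filter]
    exact ⟨Finset.mem_univ _, hf b hb⟩
  · rw [Finset.mem_filter] at he
    exact hsurj e he.2.1 he.2.2

/-! ### The program computes an output of the decoder -/

section Output

variable {n k : ℕ} {G : SimpleGraph (Fin n)} (X : G.edgeSet → ℤˣ) (Z : Fin n → ℤˣ)

theorem starNumber_eq (hn0 : 0 < n) (k i a : ℕ) :
    starNumber n k i a = (starVertex hn0 k i a).val := rfl

/-- As 5k < n, the edges inside an extended component correspond bijectively to the position pairs a
< b ≤ a + k; ordering the pair avoids counting an edge twice. -/
theorem disagreement_eq_mismatches (hn : 5 * k < n) (hG : ringLattice n k ≤ G)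
    (i : Fin (numBags n k)) (x : ℕ) (y : Fin n → ℤˣ)
    (hy : ∀ a ≤ 4 * k, y (starVertex (by omega) k i a) = signOf (bitAt x a)) :
    disagreement (ringLattice n k) (discard (ringLattice n k) G X)
      ((ringDecomposition n k).star i) y = mismatches (inputX G X) n k i x := by
  have hn0 : 0 < n := by omega
  have hmis : mismatches (inputX G X) n k i x =
      (((Finset.range (4 * k + 1) ×ˢ Finset.range (4 * k + 1)).filter
        fun ab => ab.1 < ab.2 ∧ ab.2 ≤ ab.1 + k).filter fun ab =>
          ¬ inputX G X (starNumber n k i ab.1) (starNumber n k i ab.2) =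
            1 + (bitAt x ab.1 + bitAt x ab.2) % 2).card := by
    rw [mismatches, starPairs, Finset.sum_map_toList, Finset.card_filter]
    refine Finset.sum_congr rfl fun ab _ => ?_
    split_ifs <;> rfl
  have hpos : ∀ a b, a < b → b ≤ 4 * k → ∀ h : (ringLattice n k).Adj (starVertex hn0 k i a)
      (starVertex hn0 k i b), (edgeSign y s(starVertex hn0 k i a, starVertex hn0 k i b) ≠
        discard (ringLattice n k) G X ⟨s(starVertex hn0 k i a, starVertex hn0 k i b), h⟩ ↔
      ¬ inputX G X (starNumber n k i a) (starNumber n k i b) =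
        1 + (bitAt x a + bitAt x b) % 2) := by
    intro a b hab hb h
    rw [starNumber_eq hn0, starNumber_eq hn0, inputX_of_adj hG X h, ← signCode_signOf,
      signCode_inj, signOf_add, edgeSign_mk, hy a (by omega), hy b hb]
    exact not_congr eq_comm
  rw [hmis]
  have hmem : ∀ ab, ab ∈ (((Finset.range (4 * k + 1) ×ˢ Finset.range (4 * k + 1)).filter
        fun ab : ℕ × ℕ => ab.1 < ab.2 ∧ ab.2 ≤ ab.1 + k).filter fun ab =>
          ¬ inputX G X (starNumber n k i ab.1) (starNumber n k i ab.2) =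
            1 + (bitAt x ab.1 + bitAt x ab.2) % 2) ↔ ab.2 ≤ 4 * k ∧ ab.1 < ab.2 ∧
          ab.2 ≤ ab.1 + k ∧ ¬ inputX G X (starNumber n k i ab.1) (starNumber n k i ab.2) =
            1 + (bitAt x ab.1 + bitAt x ab.2) % 2 := by
    intro ab
    simp only [Finset.mem_filter, Finset.mem_product, Finset.mem_range]
    constructor
    · rintro ⟨⟨⟨h1, h2⟩, h3, h4⟩, h5⟩
      exact ⟨by omega, h3, h4, h5⟩
    · rintro ⟨h1, h2, h3, h4⟩
      exact ⟨⟨⟨by omega, by omega⟩, h2, h3⟩, h4⟩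
  have hadj : ∀ ab : ℕ × ℕ, ab.2 ≤ 4 * k → ab.1 < ab.2 → ab.2 ≤ ab.1 + k →
      (ringLattice n k).Adj (starVertex hn0 k i ab.1) (starVertex hn0 k i ab.2) :=
    fun ab h1 h2 h3 => (starVertex_adj hn i h2 h1).2 h3
  refine disagreement_eq_card _ (fun ab h => ⟨s(starVertex hn0 k i ab.1, starVertex hn0 k i ab.2),
    hadj ab ((hmem ab).1 h).1 ((hmem ab).1 h).2.1 ((hmem ab).1 h).2.2.1⟩) ?_ ?_ ?_
  · intro ab h
    obtain ⟨h1, h2, h3, h4⟩ := (hmem ab).1 h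
    refine ⟨?_,
      (hpos ab.1 ab.2 h2 h1 (hadj ab h1 h2 h3)).2 h4⟩
    intro v hv
    rcases Sym2.mem_iff.1 hv with rfl | rfl
    · exact (mem_ringStar hn i _).2 ⟨ab.1, by omega, rfl⟩
    · exact (mem_ringStar hn i _).2 ⟨ab.2, h1, rfl⟩
  · intro ab h ab' h' he
    obtain ⟨h1, h2, h3, h4⟩ := (hmem ab).1 h
    obtain ⟨h1', h2', h3', h4'⟩ := (hmem ab').1 h'
    rcases Sym2.eq_iff.1 (congrArg Subtype.val he) with ⟨e1, e2⟩ | ⟨e1, e2⟩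
    · exact Prod.ext (starVertex_injective hn i (by omega) (by omega) e1)
        (starVertex_injective hn i (by omega) (by omega) e2)
    · have := starVertex_injective hn i (by omega) (by omega) e1
      have := starVertex_injective hn i (by omega) (by omega) e2
      omega
  · rintro ⟨e, he⟩ hin hne
    induction e using Sym2.inductionOn with
    | _ u v =>
      obtain ⟨a, ha, rfl⟩ := (mem_ringStar hn i u).1 (hin u (Sym2.mem_mk_left u v))
      obtain ⟨b, hb, rfl⟩ := (mem_ringStar hn i v).1 (hin v (Sym2.mem_mk_right _ v))
      rcases lt_trichotomy a b with hab | rfl | hab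
      · refine ⟨(a, b), (hmem _).2 ⟨hb, hab, (starVertex_adj hn i hab hb).1 he,
          (hpos a b hab hb he).1 hne⟩, rfl⟩
      · exact absurd he ((ringLattice n k).loopless.irrefl _)
      · have he' : (ringLattice n k).Adj (starVertex hn0 k i b) (starVertex hn0 k i a) :=
          SimpleGraph.Adj.symm he
        have heq : (⟨s(starVertex hn0 k i b, starVertex hn0 k i a), he'⟩ :
            (ringLattice n k).edgeSet) = ⟨s(starVertex hn0 k i a, starVertex hn0 k i b), he⟩ :=
          Subtype.ext Sym2.eq_swap
        refine ⟨(b, a), (hmem _).2 ⟨ha, hab, (starVertex_adj hn i hab ha).1 he',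
          (hpos b a hab ha he').1 ?_⟩, heq⟩
        rw [heq, Sym2.eq_swap]
        exact hne

open Classical in
/-- The local estimator of the component `i` that the program computes. -/
noncomputable def localLabel (i : ℕ) (v : Fin n) : ℤˣ :=
  -- Off the extended component the value 1 is a default and does not matter.
  if h : ∃ a ≤ 4 * k, v.val = starNumber n k i a then
    signOf (bitAt (bestMask (inputX G X) n k i) h.choose) else 1

theorem localLabel_starVertex (hn : 5 * k < n) (i : ℕ) {a : ℕ} (ha : a ≤ 4 * k) :
    localLabel (k := k) X i (starVertex (by omega) k i a) =
      signOf (bitAt (bestMask (inputX G X) n k i) a) := by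
  have hex : ∃ a' ≤ 4 * k, (starVertex (n := n) (by omega) k i a).val = starNumber n k i a' :=
    ⟨a, ha, rfl⟩
  rw [localLabel, dif_pos hex]
  congr 2
  exact starVertex_injective hn i hex.choose_spec.1 ha (Fin.ext hex.choose_spec.2.symm)

theorem isLocalEstimator_localLabel (hn : 5 * k < n) (hG : ringLattice n k ≤ G)
    (i : Fin (numBags n k)) :
    IsLocalEstimator (ringLattice n k) (discard (ringLattice n k) G X)
      ((ringDecomposition n k).star i) (localLabel (k := k) X i) := by
  intro y
  choose b hb2 hb using fun a => exists_signOf (y (starVertex (by omega) k i a))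
  obtain ⟨x, hx, hxb⟩ := exists_bits (4 * k + 1) b hb2
  rw [disagreement_eq_mismatches X hn hG i (bestMask (inputX G X) n k i) _
      fun a ha => localLabel_starVertex X hn i ha,
    disagreement_eq_mismatches X hn hG i x y
      fun a ha => by rw [hxb a (by omega), hb a]]
  exact bestMask_spec _ n k i x hx

theorem bagCost_localLabel (hn : 5 * k < n) (i : Fin (numBags n k)) (s : ℕ) :
    bagCost ((ringDecomposition n k).bag i) Z (localLabel (k := k) X i) (signOf s) =
      maskCost (inputX G X) (inputZ Z) n k i s := by
  classical
  have hn0 : 0 < n := by omega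
  have hcost : maskCost (inputX G X) (inputZ Z) n k i s = ((Finset.range (2 * k + 1)).filter
      fun a => ¬ inputZ Z (starNumber n k i (k + a)) =
        1 + (s + bitAt (bestMask (inputX G X) n k i) (k + a)) % 2).card := by
    rw [maskCost, ← List.sum_toFinset _ List.nodup_range, List.toFinset_range, Finset.card_filter]
    refine Finset.sum_congr rfl fun a _ => ?_
    split_ifs <;> rfl
  have hpos : ∀ a < 2 * k + 1, (signOf s * localLabel (k := k) X i (starVertex hn0 k i (k + a)) ≠
      Z (starVertex hn0 k i (k + a)) ↔ ¬ inputZ Z (starNumber n k i (k + a)) =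
        1 + (s + bitAt (bestMask (inputX G X) n k i) (k + a)) % 2) := by
    intro a ha
    rw [starNumber_eq hn0, inputZ_val, ← signCode_signOf, signCode_inj, signOf_add,
      localLabel_starVertex X hn i (by omega)]
    exact not_congr eq_comm
  rw [hcost]
  unfold bagCost
  symm
  refine Finset.card_bij (fun a _ => starVertex hn0 k i (k + a)) ?_ ?_ ?_
  · intro a h
    obtain ⟨h1, h2⟩ := Finset.mem_filter.1 h
    have h1 := Finset.mem_range.1 h1
    exact Finset.mem_filter.2 ⟨(mem_ringBag hn i _).2 ⟨k + a, by omega, by omega, rfl⟩,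
      (hpos a h1).2 h2⟩
  · intro a h a' h' he
    have h1 := Finset.mem_range.1 (Finset.mem_filter.1 h).1
    have h1' := Finset.mem_range.1 (Finset.mem_filter.1 h').1
    have := starVertex_injective hn i (by omega) (by omega) he
    omega
  · intro v h
    obtain ⟨h1, h2⟩ := Finset.mem_filter.1 h
    obtain ⟨a, ha1, ha2, rfl⟩ := (mem_ringBag hn i v).1 h1
    obtain ⟨a, rfl⟩ := Nat.exists_eq_add_of_le ha1
    exact ⟨a, Finset.mem_filter.2 ⟨Finset.mem_range.2 (by omega), (hpos a (by omega)).1 h2⟩, rfl⟩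

/-- The signs on the edges of the path of components. -/
noncomputable def turnSign (inX : ℕ → ℕ → ℕ) (n k : ℕ) : Sym2 (Fin (numBags n k)) → ℤˣ :=
  -- The maximum makes the definition symmetric; on a path edge it is the later component.
  Sym2.lift ⟨fun i j => signOf (turn inX n k (max i.val j.val)), fun i j => by
    simp only [max_comm]⟩

theorem turnSign_mk (inX : ℕ → ℕ → ℕ) {i j : Fin (numBags n k)} (h : i.val + 1 = j.val) :
    turnSign inX n k s(i, j) = signOf (turn inX n k (i.val + 1)) := by
  change signOf (turn inX n k (max i.val j.val)) = _
  rw [max_eq_right (by omega), h]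

theorem violations_eq_sum_breakAt (inX : ℕ → ℕ → ℕ) (b : ℕ → ℕ) (hb : ∀ i, b i < 2) :
    violations (SimpleGraph.pathGraph (numBags n k)) (turnSign inX n k)
      (fun i => signOf (b i)) =
      ∑ i ∈ Finset.range (numBags n k - 1), breakAt inX n k b i := by
  refine violations_pathGraph _ _ _ fun i h => ?_
  have h1 := hb i
  have h2 := hb (i + 1)
  rw [turnSign_mk inX rfl, ← signOf_add, breakAt]
  simp only [ne_eq, signOf_eq_iff]
  split_ifs <;> omega

theorem exists_common_vertex (hn : 5 * k < n) (hk : 1 ≤ k)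
    {i j : Fin (numBags n k)} (h : i.val + 1 = j.val) :
    ∃ v, v ∈ (ringDecomposition n k).bag i ∧ v ∈ (ringDecomposition n k).bag j ∧
      turnSign (inputX G X) n k s(i, j) =
        localLabel (k := k) X i v * localLabel (k := k) X j v := by
  have hn0 : 0 < n := by omega
  have hv : starVertex hn0 k i (3 * k) = starVertex hn0 k j (2 * k - 1) := by
    rw [starVertex, starVertex, ← h, add_mul]
    congr 1
    have := center_lt i.isLt
    omega
  refine ⟨starVertex hn0 k i (3 * k), (mem_ringBag hn i _).2 ⟨3 * k, by omega, by omega, rfl⟩,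
    (mem_ringBag hn j _).2 ⟨2 * k - 1, by omega, by omega, hv⟩, ?_⟩
  rw [turnSign_mk _ h, localLabel_starVertex X hn i (by omega), hv,
    localLabel_starVertex X hn j (by omega), turn, signOf_mod_two, signOf_add, h,
    show j.val - 1 = i.val by omega]

/-- The trace is feasible by the budget identity, its cost is a table value, and the table bounds
every feasible competitor from below. -/
theorem isTreeDecoding_optSign (hn : 5 * k < n) (L : ℕ) :
    IsTreeDecoding (ringDecomposition n k).tree
      (fun i x => bagCost ((ringDecomposition n k).bag i) Z (localLabel (k := k) X i) x)
      (turnSign (inputX G X) n k) L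
      (fun i => signOf (optSign (inputX G X) (inputZ Z) n k L i)) := by
  have hm : 0 < numBags n k := lt_numBags (by rw [zero_mul]; omega)
  refine ⟨?_, fun s hs => ?_⟩
  · refine (violations_eq_sum_breakAt (inputX G X) (optSign (inputX G X) (inputZ Z) n k L)
      fun i => ?_).trans_le (sum_breakAt_optSign _ _ n k L)
    exact (backtrack_le _ _ n k L _).2
  · have hb : ∃ b : ℕ → ℕ, (∀ i, b i < 2) ∧ ∀ i : Fin (numBags n k), signOf (b i) = s i := by
      choose b hb2 hb using fun i => exists_signOf (s i)
      refine ⟨fun i => if h : i < numBags n k then b ⟨i, h⟩ else 0, fun i => ?_, fun i => ?_⟩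
      · dsimp only
        split_ifs
        · exact hb2 _
        · omega
      · simp [hb]
    obtain ⟨b, hb2, hb⟩ := hb
    obtain rfl : (fun i : Fin (numBags n k) => signOf (b i)) = s := funext hb
    have hviol := (violations_eq_sum_breakAt (n := n) (k := k) (inputX G X) b hb2).symm.trans_le hs
    simp only [bagCost_localLabel X Z hn]
    rw [Fin.sum_univ_eq_sum_range fun i => maskCost (inputX G X) (inputZ Z) n k i
        (optSign (inputX G X) (inputZ Z) n k L i),
      Fin.sum_univ_eq_sum_range fun i => maskCost (inputX G X) (inputZ Z) n k i (b i),
      sum_optSign _ _ n k L hm]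
    refine (minCost_optSign_le _ _ n k L _ (hb2 (numBags n k - 1))).trans ?_
    have := minCost_le_sum (inputX G X) (inputZ Z) n k b hb2 (numBags n k - 1) L hviol
    rwa [Nat.sub_add_cancel hm] at this

theorem exists_ringDecoderOutput (hn : 5 * k < n) (hG : ringLattice n k ≤ G) (hk : 1 ≤ k)
    (L : ℕ) : ∃ out : Fin n → ℤˣ,
    (∀ v, outputCode (inputX G X) (inputZ Z) n k L v.val = signCode (out v)) ∧
    IsRingDecoderOutput n k L G X Z out := by
  have hn0 : 0 < n := by omega
  have hc : ∀ v : Fin n, v.val / (k + 1) < numBags n k := fun v =>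
    lt_numBags ((Nat.div_mul_le_self _ _).trans_lt v.isLt)
  have hv : ∀ v : Fin n,
      v = starVertex hn0 k (v.val / (k + 1)) (v.val % (k + 1) + 2 * k) := by
    intro v
    have h := Nat.div_add_mod' v.val (k + 1)
    have e : v.val / (k + 1) * (k + 1) + n - 2 * k + (v.val % (k + 1) + 2 * k) = v.val + n := by
      omega
    refine Fin.ext ?_
    rw [← starNumber_eq, starNumber, e, Nat.add_mod_right, Nat.mod_eq_of_lt v.isLt]
  have hmod : ∀ v : Fin n, v.val % (k + 1) ≤ k := fun v =>
    Nat.lt_succ_iff.1 (Nat.mod_lt _ (Nat.succ_pos k))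
  refine ⟨fun v => signOf (optSign (inputX G X) (inputZ Z) n k L (v.val / (k + 1))) *
      localLabel (k := k) X (v.val / (k + 1)) v, fun v => ?_,
    fun i => localLabel (k := k) X i, turnSign (inputX G X) n k,
    fun i => signOf (optSign (inputX G X) (inputZ Z) n k L i),
    fun v => ⟨v.val / (k + 1), hc v⟩, fun i => isLocalEstimator_localLabel X hn hG i,
    fun i j hij => ?_, isTreeDecoding_optSign X Z hn L, fun v => ⟨?_, rfl⟩⟩
  · have h1 := localLabel_starVertex X hn (v.val / (k + 1))
      (a := v.val % (k + 1) + 2 * k) (by have := hmod v; omega)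
    rw [← hv v] at h1
    dsimp only
    rw [h1, ← signOf_add, signCode_signOf]
    rfl
  · rcases SimpleGraph.pathGraph_adj.1 hij with h | h
    · exact exists_common_vertex X hn hk h
    · obtain ⟨v, h1, h2, h3⟩ := exists_common_vertex X hn hk h
      exact ⟨v, h2, h1, by rw [Sym2.eq_swap, h3, mul_comm]⟩
  · exact (mem_ringBag hn _ v).2 ⟨v.val % (k + 1) + 2 * k, by omega,
      by have := hmod v; omega, hv v⟩

end Output

/-- All variables and cells stay below M = (n+L+2)², and an expression raises M at most to its
growth, whence the exponent of the word bound. -/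
theorem decodesWithin_ringProgram {n k : ℕ} (hk : 1 ≤ k) (hn : 5 * k < n) (L : ℕ)
    {G : SimpleGraph (Fin n)} (hG : ringLattice n k ≤ G) (X : G.edgeSet → ℤˣ) (Z : Fin n → ℤˣ)
    {T : ℝ} (hT : (programCost k : ℝ) * ((L + 1) * n) ≤ T) :
    DecodesWithin (ringProgram k) (2 * programGrowth k) n k L G X Z T := by
  obtain ⟨out, h1, h2⟩ := exists_ringDecoderOutput X Z hn hG hk L
  have hle : n + (L + 2) ≤ (n + L + 2) ^ 2 := by
    rw [← add_assoc, sq]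
    exact Nat.le_mul_self _
  have hmul : (n + (L + 2)) * (n + (L + 2)) = (n + L + 2) ^ 2 := by ring
  obtain ⟨τ, t, h3, h4, h5⟩ := runs_ringProgram (inX := inputX G X) (inZ := inputZ Z) (n := n)
    (k := k) (L := L) (M := (n + L + 2) ^ 2) (B := (n + L + 2) ^ (2 * programGrowth k))
    (by omega) ((Nat.mul_le_mul (by omega) (by omega)).trans hmul.le)
    ((Nat.mul_le_mul (by omega) (by omega)).trans hmul.le) (by omega) (inputX_le G X) (inputZ_le Z)
    (by rw [← pow_mul]) (initState n L) rfl
  refine ⟨τ, t, out, h3, le_trans ?_ hT, fun v => ?_, h2⟩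
  · exact_mod_cast h4
  · rw [← h1 v, ← h5 v.val v.isLt]
    rfl

end NewmanWatts

/-! ### Assembly of the bounds -/

theorem mainTheorem10 (k : ℕ) (hk : 1 ≤ k) (α q : ℝ) (hα0 : 0 ≤ α) (hα1 : α < 1)
    (hq0 : 0 < q) (hq1 : q < 1 / 2) :
    -- lower bound: every estimator, on all but an asymptotically negligible part of the graphs
    (∃ c : ℝ, 0 < c ∧
      Tendsto (fun n : ℕ => NewmanWatts.graphProb n k α (fun G =>
        ∀ p : ℝ, 0 < p → p < q → ∀ est : NewmanWatts.Estimator G,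
          ∃ Y : Fin n → ℤˣ, c * (p ^ k * n) ≤ NewmanWatts.expectedError G Y p q est))
        atTop (𝓝 1)) ∧
    -- upper bound and running time of the decoder
    ∃ (P : NewmanWatts.Program) (w : ℕ) (A C : ℝ) (n₀ : ℕ), 0 < A ∧ 0 < C ∧
      -- the decoder with failure parameter `δ`
      (∀ n : ℕ, n₀ ≤ n → ∀ p δ : ℝ, 0 < p → p < q → 0 < δ → δ < 1 →
        ∀ G : SimpleGraph (Fin n), NewmanWatts.ringLattice n k ≤ G →
          (∀ Y : Fin n → ℤˣ, 1 - δ ≤ NewmanWatts.obsProb G Y p q (fun X Z =>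
            ∀ out : Fin n → ℤˣ,
              NewmanWatts.IsRingDecoderOutput n k (NewmanWatts.ringBudget n k A p δ) G X Z out →
              (hammingDist out Y : ℝ) ≤
                C * (p ^ k * n + Real.log (2 / δ)) * Real.log n)) ∧
          ∀ (X : G.edgeSet → ℤˣ) (Z : Fin n → ℤˣ),
            NewmanWatts.DecodesWithin P w n k (NewmanWatts.ringBudget n k A p δ) G X Z
              (C * ((⌈p ^ k * n⌉₊ : ℝ) + Real.log (2 / δ)) * n)) ∧
      -- high probability, for arbitrary sequences of edge noise levels
      ∀ p : ℕ → ℝ, (∀ n, 0 < p n ∧ p n < q) → ∃ L : ℕ → ℕ,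
        (∀ Y : (n : ℕ) → Fin n → ℤˣ,
          Tendsto (fun n : ℕ => NewmanWatts.modelProb n k α (p n) q (Y n) (fun G X Z =>
            ∀ out : Fin n → ℤˣ, NewmanWatts.IsRingDecoderOutput n k (L n) G X Z out →
              (hammingDist out (Y n) : ℝ) ≤ C * (p n ^ k * n) * Real.log n ^ 3))
            atTop (𝓝 1)) ∧
        (∀ᶠ n : ℕ in atTop, ∀ G : SimpleGraph (Fin n), NewmanWatts.ringLattice n k ≤ G →
          ∀ (X : G.edgeSet → ℤˣ) (Z : Fin n → ℤˣ),
            NewmanWatts.DecodesWithin P w n k (L n) G X Z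
              (C * ⌈p n ^ k * n⌉₊ * n * Real.log n)) ∧
        (Tendsto (fun n : ℕ => p n ^ k * n) atTop atTop ∨
            Tendsto (fun n : ℕ => p n ^ k * n) atTop (𝓝 0) →
          ∀ᶠ n : ℕ in atTop, ∀ G : SimpleGraph (Fin n), NewmanWatts.ringLattice n k ≤ G →
            ∀ (X : G.edgeSet → ℤˣ) (Z : Fin n → ℤˣ),
              NewmanWatts.DecodesWithin P w n k (L n) G X Z
                (C * ⌈p n ^ k * n⌉₊ * n)) := by
  obtain ⟨A, C₀, hA0, hC0, hAC⟩ := NewmanWatts.decoder_error_bound k hk q hq0 hq1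
  have hlog2 : ∀ δ : ℝ, 0 < δ → δ < 1 → 0 ≤ Real.log (2 / δ) := fun δ h0 h1 =>
    Real.log_nonneg (by rw [le_div_iff₀ h0]; linarith)
  set R : ℝ := (NewmanWatts.programCost k : ℝ) with hR
  have hR0 : 0 ≤ R := Nat.cast_nonneg _
  -- One constant for error and time: the first summand makes C/3 at least C₀, for the factor 3 lost
  -- in `exists_budgets`; the second covers the running time.
  set C : ℝ := 3 * C₀ + R * (3 * A + 1) with hC
  have hCpos : 0 < C := by positivity
  have hAC' : ∀ n : ℕ, 5 * k + 3 ≤ n → ∀ p δ : ℝ, 0 < p → p < q → 0 < δ →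
      δ < 1 → ∀ G : SimpleGraph (Fin n), NewmanWatts.ringLattice n k ≤ G → ∀ Y : Fin n → ℤˣ,
        ∀ C' : ℝ, C₀ ≤ C' → 1 - δ ≤ NewmanWatts.obsProb G Y p q (fun X Z => ∀ out : Fin n → ℤˣ,
          NewmanWatts.IsRingDecoderOutput n k (NewmanWatts.ringBudget n k A p δ) G X Z out →
            (hammingDist out Y : ℝ) ≤ C' * (p ^ k * n + Real.log (2 / δ)) * Real.log n) := by
    intro n hn p δ hp0 hp1 hδ0 hδ1 G hG Y C' hC'
    refine (hAC n hn p δ hp0 hp1 hδ0 hδ1 G hG Y).trans (NewmanWatts.obsProb_mono G Y hp0.le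
      (by linarith) hq0.le (by linarith) fun X Z h out hout => (h out hout).trans ?_)
    have h1 := hlog2 δ hδ0 hδ1
    have h2 : 0 ≤ Real.log n := Real.log_natCast_nonneg n
    gcongr
  have hCR : R * (3 * A + 1) ≤ C := by linarith
  refine ⟨NewmanWatts.lower_bound k α q hα0 hα1 hq0 hq1, NewmanWatts.ringProgram k,
    2 * NewmanWatts.programGrowth k, A, C, 5 * k + 3, hA0, hCpos, ?_, ?_⟩
  · intro n hn p δ hp0 hp1 hδ0 hδ1 G hG
    refine ⟨fun Y => hAC' n hn p δ hp0 hp1 hδ0 hδ1 G hG Y C ?_, fun X Z =>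
      NewmanWatts.decodesWithin_ringProgram hk (by omega) _ hG X Z ?_⟩
    · have : 0 ≤ R * (3 * A + 1) := by positivity
      linarith
    have hl := hlog2 δ hδ0 hδ1
    have hn0 : (0 : ℝ) < n := Nat.cast_pos.2 (by omega)
    have hP : 0 < p ^ k * n := by positivity
    have hceil : p ^ k * n ≤ (⌈p ^ k * n⌉₊ : ℝ) := Nat.le_ceil _
    have hone : (1 : ℝ) ≤ (⌈p ^ k * n⌉₊ : ℝ) := by exact_mod_cast Nat.ceil_pos.2 hP
    have hL : (NewmanWatts.ringBudget n k A p δ : ℝ) ≤ A * (p ^ k * n + Real.log (2 / δ)) :=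
      Nat.floor_le (by positivity)
    have hsum : (NewmanWatts.ringBudget n k A p δ : ℝ) + 1 ≤
        (3 * A + 1) * ((⌈p ^ k * n⌉₊ : ℝ) + Real.log (2 / δ)) := by
      have h1 : A * (p ^ k * n + Real.log (2 / δ)) ≤
          3 * A * ((⌈p ^ k * n⌉₊ : ℝ) + Real.log (2 / δ)) := by
        gcongr
        linarith
      linarith
    calc R * (((NewmanWatts.ringBudget n k A p δ : ℝ) + 1) * n)
        ≤ R * ((3 * A + 1) * ((⌈p ^ k * n⌉₊ : ℝ) + Real.log (2 / δ)) * n) := by gcongr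
      _ = R * (3 * A + 1) * ((⌈p ^ k * n⌉₊ : ℝ) + Real.log (2 / δ)) * n := by ring
      _ ≤ _ := by gcongr
  · intro p hp
    obtain ⟨L, h1, h2, h3⟩ := NewmanWatts.exists_budgets k hk α q hα0 hα1 hq0 hq1 hA0
      (C := C / 3) (by positivity) (fun n hn p δ hp0 hp1 hδ0 hδ1 G hG Y =>
        hAC' n hn p δ hp0 hp1 hδ0 hδ1 G hG Y (C / 3) (by
          have : 0 ≤ R * (3 * A + 1) := by positivity
          linarith)) p hp
    have hC3 : 3 * (C / 3) = C := by ring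
    rw [hC3] at h1
    refine ⟨L, h1, ?_, fun hlim => ?_⟩
    · filter_upwards [h2, eventually_ge_atTop (5 * k + 3)] with n hL hn G hG X Z
      refine NewmanWatts.decodesWithin_ringProgram hk (by omega) _ hG X Z ?_
      have hl : 0 ≤ Real.log n := Real.log_natCast_nonneg n
      calc R * (((L n : ℝ) + 1) * n)
          ≤ R * ((3 * A + 1) * ⌈p n ^ k * n⌉₊ * Real.log n * n) := by gcongr
        _ = R * (3 * A + 1) * ⌈p n ^ k * n⌉₊ * n * Real.log n := by ring
        _ ≤ _ := by gcongr
    · filter_upwards [h3 hlim, eventually_ge_atTop (5 * k + 3)] with n hL hn G hG X Z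
      refine NewmanWatts.decodesWithin_ringProgram hk (by omega) _ hG X Z ?_
      calc R * (((L n : ℝ) + 1) * n)
          ≤ R * ((3 * A + 1) * ⌈p n ^ k * n⌉₊ * n) := by gcongr
        _ = R * (3 * A + 1) * ⌈p n ^ k * n⌉₊ * n := by ring
        _ ≤ _ := by gcongr
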